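/- **Setting.** Consider agents $i=1,\dots,N$ ($N\ge 1$), $\dot x_i=A_ix_i+B_iu_i$, $y_i=C_ix_i$, with real matrices, $x_i\in\mathbb R^{n_i}$, $u_i\in\mathbb R^{m_i}$, $y_i\in\mathbb R^p$, such that for every $i$: $(A_i,B_i)$ is stabilizable and $(A_i,C_i)$ detectable; all eigenvalues of $A_i$ lie in the closed left half plane; $(A_i,B_i,C_i,0)$ is right-invertible (its transfer matrix has a rational right inverse); and no eigenvalue of $A_1$ in the closed right half plane is an invariant zero of $(A_i,B_i,C_i,0)$ (a point where the Rosenbrock matrix $\begin{pmatrix}A_i-\lambda I&B_i\\ C_i&0\end{pmatrix}$ has rank below its normal rank). Let $\beta>0$. Let $\mathbb G_\beta^N$ be the set of weighted directed graphs with weights $a_{ij}\ge 0$, $a_{ii}=0$ ($a_{ij}>0$ iff there is an edge from $j$ to $i$) that are equal to a directed spanning tree with root $1$ and whose Laplacian $L=[\ell_{ij}]$ ($\ell_{ii}=\sum_ka_{ik}$, $\ell_{ij}=-a_{ij}$ for $i\ne j$) is lower triangular with zero first row and $\ell_{ii}\ge\beta$ for $i\ge 2$. Each edge has an unknown constant delay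 $\tau_{ij}\ge 0$. Let $\bar\tau_i$ be the sum of the delays along the path from the root to $i$, so $\bar\tau_i-\bar\tau_j=\tau_{ij}$ on edges, and put $\tau_{ij}:=\bar\tau_i-\bar\tau_j$ for all other pairs. A *distributed dynamic protocol* consists of $u_1=0$ and, for $i\ge 2$, $$\dot\chi_i=A_c^i\chi_i+B_c^i\zeta_i+E_c^i\hat\zeta_i,\qquad u_i=C_c^i\chi_i+D_c^i\zeta_i,$$ $$\zeta_i(t)=\sum_ja_{ij}[y_i(t)-y_j(t-\tau_{ij})],\qquad \hat\zeta_i(t)=\sum_ja_{ij}[\psi_i(t)-\psi_j(t-\tau_{ij})],$$ where $\psi_1=0$ and $\psi_i=H_c^i\chi_i\in\mathbb R^p$ is transmitted over the same network. It *solves the delayed output synchronization problem* if, for every graph in $\mathbb G_\beta^N$, all delays and all initial data, $$\lim_{t\to\infty}[y_i(t)-y_j(t-\tau_{ij})]=0\qquad\text{for all }i,j .$$ **The observer and output-regulation protocol.** For $i\ge2$ let $O_i$ be the observability matrix with block rows $(C_iA_i^k,\,-C_1A_1^k)$, $0\le k<n_i+n_1$; let the columns of $\begin{pmatrix}\Lambda_i^u\\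 \Phi_i^u\end{pmatrix}$ be a basis of $\ker O_i$, $q_i=\dim\ker O_i$, let $\Phi_i=(\Phi_i^u\ \Phi_i^c)$ be nonsingular, and let $R_i$ and $N_i'$ be the first $q_i$ and the remaining $k_i=n_1-q_i$ rows of $\Phi_i^{-1}$. Put $\bar A_{12}^i=\Lambda_i^uR_iA_1\Phi_i^c$, $\bar A_{22}^i=N_i'A_1\Phi_i^c$, $\bar C_2^i=-C_1\Phi_i^c$, $$\bar A_i=\begin{pmatrix}A_i&\bar A_{12}^i\\0&\bar A_{22}^i\end{pmatrix},\quad \bar B_i=\begin{pmatrix}B_i\\0\end{pmatrix},\quad \bar C_i=(C_i\ \ {-\bar C_2^i}).$$ Let $K_i$ be such that $A_i+B_iK_i$ is Hurwitz, let $(\Pi_i,\Gamma_i)$ satisfy $\Pi_i\bar A^i_{22}=A_i\Pi_i+\bar A^i_{12}+B_i\Gamma_i$ and $C_i\Pi_i=\bar C^i_2$, and put $F_i=(K_i\ \ \Gamma_i-K_i\Pi_i)$. Call such choices *design data*. Let $\bar n\ge n_i+n_1$ for all $i\ge2$, let $\Xi_i$ have the block rows $\bar C_i\bar A_i^k$,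 $0\le k<\bar n$, put $\Xi_i^+=(\Xi_i^{T}\Xi_i)^{-1}\Xi_i^{T}$, $$A_o=\begin{pmatrix}0&I_{p(\bar n-1)}\\0&0\end{pmatrix},\quad C_o=(I_p\ \ 0),\quad K_o^i=\begin{pmatrix}0\\ \bar C_i\bar A_i^{\bar n}\Xi_i^+\end{pmatrix},\quad H_\varepsilon=\mathrm{diag}(\varepsilon^{-1}I_p,\dots,\varepsilon^{-\bar n}I_p),$$ and, for an arbitrary $K\in\mathbb R^{p\times p\bar n}$, $K_\varepsilon=\begin{pmatrix}0\\ \varepsilon^{\bar n+1}KH_\varepsilon\end{pmatrix}$. Let $Q_\varepsilon>0$ satisfy $$(A_o+K_\varepsilon)Q_\varepsilon+Q_\varepsilon(A_o+K_\varepsilon)^{T}-2\beta Q_\varepsilon C_o^{T}C_oQ_\varepsilon+I=0 .\qquad(*)$$ The protocol is, with $\psi_i=C_o\hat\phi_i$ for $i\ge2$ and $\psi_1=0$, $$\dot{\hat\phi}_i=(A_o+K_o^i)\hat\phi_i+\Xi_i\bar B_iu_i+H_\varepsilon Q_\varepsilon C_o^{T}(\zeta_i-\hat\zeta_i),\qquad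 u_i=F_i\Xi_i^+\hat\phi_i\qquad(i\ge2).$$ **Theorem.** 1. The delayed output synchronization problem is solvable: one distributed dynamic protocol solves it for all graphs in $\mathbb G_\beta^N$ and all delays. 2. Let $\bar n\ge n_i+n_1$ for all $i\ge2$ and $K\in\mathbb R^{p\times p\bar n}$. For every $\varepsilon>0$, $(*)$ has exactly one solution $Q_\varepsilon>0$; and for all design data there is $\varepsilon^*>0$, independent of the graph and the delays, such that for every $\varepsilon\in(0,\varepsilon^*]$ the observer and output-regulation protocol solves the delayed output synchronization problem. 3. Design data exist for every $i\ge2$ if, for all $i\ge2$, $(A_i,C_i)$ is observable and no eigenvalue of $A_1$ whatsoever is an invariant zero of $(A_i,B_i,C_i,0)$. -/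

import Mathlib

open Matrix

noncomputable section

namespace DelayedSync

/-! ## Linear systems `ẋ = A x + B u`, `y = C x` -/

section LinearSystems

variable {ν μ π : Type} [Fintype ν] [DecidableEq ν] [Fintype μ] [DecidableEq μ]
  [Fintype π] [DecidableEq π]

/-- The complex eigenvalues of a real square matrix. -/
def eigenvalues (A : Matrix ν ν ℝ) : Set ℂ :=
  spectrum ℂ (A.map (algebraMap ℝ ℂ))

/-- All eigenvalues lie in the open left half plane. -/
def IsHurwitz (A : Matrix ν ν ℝ) : Prop :=
  ∀ z ∈ eigenvalues A, z.re < 0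

def Stabilizable (A : Matrix ν ν ℝ) (B : Matrix ν μ ℝ) : Prop :=
  ∃ K : Matrix μ ν ℝ, IsHurwitz (A + B * K)

def Detectable (A : Matrix ν ν ℝ) (C : Matrix π ν ℝ) : Prop :=
  ∃ K : Matrix ν π ℝ, IsHurwitz (A + K * C)

def Observable (A : Matrix ν ν ℝ) (C : Matrix π ν ℝ) : Prop :=
  ∀ x : ν → ℝ, (∀ k : ℕ, (C * A ^ k) *ᵥ x = 0) → x = 0

/-- The transfer matrix `C (s I - A)⁻¹ B`, a matrix of real rational functions in `s`. -/
def transferMatrix (A : Matrix ν ν ℝ) (B : Matrix ν μ ℝ) (C : Matrix π ν ℝ) :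
    Matrix π μ (RatFunc ℝ) :=
  C.map (algebraMap ℝ (RatFunc ℝ)) *
    (Matrix.scalar ν (RatFunc.X : RatFunc ℝ) - A.map (algebraMap ℝ (RatFunc ℝ)))⁻¹ *
    B.map (algebraMap ℝ (RatFunc ℝ))

/-- `(A, B, C, 0)` is right-invertible: its transfer matrix has a rational right inverse. -/
def RightInvertible (A : Matrix ν ν ℝ) (B : Matrix ν μ ℝ) (C : Matrix π ν ℝ) : Prop :=
  ∃ R : Matrix μ π (RatFunc ℝ), transferMatrix A B C * R = 1

/-- The Rosenbrock system matrix of `(A, B, C, 0)` at a point `s` of an extension field. -/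
def rosenbrock {𝕜 : Type} [Field 𝕜] [Algebra ℝ 𝕜] (A : Matrix ν ν ℝ) (B : Matrix ν μ ℝ)
    (C : Matrix π ν ℝ) (s : 𝕜) : Matrix (ν ⊕ π) (ν ⊕ μ) 𝕜 :=
  Matrix.fromBlocks (A.map (algebraMap ℝ 𝕜) - Matrix.scalar ν s) (B.map (algebraMap ℝ 𝕜))
    (C.map (algebraMap ℝ 𝕜)) 0

/-- The normal rank of the Rosenbrock matrix: its rank over the field of rational functions. -/
def normalRank (A : Matrix ν ν ℝ) (B : Matrix ν μ ℝ) (C : Matrix π ν ℝ) : ℕ :=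
  (rosenbrock A B C (RatFunc.X : RatFunc ℝ)).rank

/-- `z` is an invariant zero of `(A, B, C, 0)`: the Rosenbrock matrix loses rank at `z`. -/
def IsInvariantZero (A : Matrix ν ν ℝ) (B : Matrix ν μ ℝ) (C : Matrix π ν ℝ) (z : ℂ) : Prop :=
  (rosenbrock A B C z).rank < normalRank A B C

/-- The matrix with block rows `C, C A, …, C A ^ (l - 1)`. -/
def obsMatrix (l : ℕ) (A : Matrix ν ν ℝ) (C : Matrix π ν ℝ) : Matrix (Fin l × π) ν ℝ :=
  Matrix.of fun r j => (C * A ^ (r.1 : ℕ)) r.2 j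

end LinearSystems

/-! ## Heterogeneous multi-agent systems and communication graphs -/

/-- `M + 1` agents `(A i, B i, C i)` with a common output dimension `p`. Agent `0` is the root,
the agents `f.succ` with `f : Fin M` are the other ones. -/
structure MAS (M p : ℕ) where
  n : Fin (M + 1) → ℕ
  m : Fin (M + 1) → ℕ
  A : ∀ i, Matrix (Fin (n i)) (Fin (n i)) ℝ
  B : ∀ i, Matrix (Fin (n i)) (Fin (m i)) ℝ
  C : ∀ i, Matrix (Fin p) (Fin (n i)) ℝ

/-- The standing assumptions on the agents. -/
structure MAS.Admissible {M p : ℕ} (S : MAS M p) : Prop where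
  stabilizable : ∀ i, Stabilizable (S.A i) (S.B i)
  detectable : ∀ i, Detectable (S.A i) (S.C i)
  closed_left : ∀ i, ∀ z ∈ eigenvalues (S.A i), z.re ≤ 0
  rightInvertible : ∀ i, RightInvertible (S.A i) (S.B i) (S.C i)
  zeros : ∀ i, ∀ z ∈ eigenvalues (S.A 0), 0 ≤ z.re →
    ¬ IsInvariantZero (S.A i) (S.B i) (S.C i) z

/-- The Laplacian of a weighting matrix `a`; `a i j > 0` means that there is an edge from
`j` to `i`. -/
def laplacian {N : ℕ} (a : Matrix (Fin N) (Fin N) ℝ) : Matrix (Fin N) (Fin N) ℝ :=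
  Matrix.of fun i j => if i = j then ∑ k, a i k else - a i j

/-- The graph of `a` is a directed tree on all nodes, with root `0`. -/
structure IsSpanningTree {M : ℕ} (a : Matrix (Fin (M + 1)) (Fin (M + 1)) ℝ) : Prop where
  root : ∀ j, ¬ 0 < a 0 j
  parent : ∀ i, i ≠ 0 → ∃! j, 0 < a i j
  reach : ∀ i, Relation.ReflTransGen (fun j k => 0 < a k j) 0 i

/-- The class `𝔾_β^N` (with `N = M + 1`). -/
structure MemG {M : ℕ} (β : ℝ) (a : Matrix (Fin (M + 1)) (Fin (M + 1)) ℝ) : Prop where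
  nonneg : ∀ i j, 0 ≤ a i j
  loopless : ∀ i, a i i = 0
  tree : IsSpanningTree a
  lower : ∀ i j, i < j → laplacian a i j = 0
  top : ∀ j, laplacian a 0 j = 0
  diag : ∀ i, i ≠ 0 → β ≤ laplacian a i i

/-- The relative, delayed signal `∑ j, a i j (v i (t) - v j (t - τ i j))` that the network
delivers to agent `i` when agent `j` transmits `v j`. -/
def networkSignal {N p : ℕ} (a τ : Matrix (Fin N) (Fin N) ℝ) (v : Fin N → ℝ → Fin p → ℝ)
    (i : Fin N) (t : ℝ) : Fin p → ℝ :=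
  ∑ j, a i j • (v i t - v j (t - τ i j))

/-- `T` is the sum of the delays along a directed path from the root to `i`. -/
inductive IsPathDelay {M : ℕ} (a τ : Matrix (Fin (M + 1)) (Fin (M + 1)) ℝ) :
    Fin (M + 1) → ℝ → Prop
  | root : IsPathDelay a τ 0 0
  | step {i j : Fin (M + 1)} {T : ℝ} :
      0 < a i j → IsPathDelay a τ j T → IsPathDelay a τ i (T + τ i j)

/-- Delayed synchronization of the signals `y i`: `y i (t) - y j (t - τ i j) → 0` along every
edge, and for every pair of nodes, where the delay between two arbitrary nodes is the difference
of their accumulated delays from the root. -/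
def DelayedSynchronization {M p : ℕ} (a τ : Matrix (Fin (M + 1)) (Fin (M + 1)) ℝ)
    (y : Fin (M + 1) → ℝ → Fin p → ℝ) : Prop :=
  (∀ i j, 0 < a i j →
    Filter.Tendsto (fun t => y i t - y j (t - τ i j)) Filter.atTop (nhds 0)) ∧
  (∀ i j Ti Tj, IsPathDelay a τ i Ti → IsPathDelay a τ j Tj →
    Filter.Tendsto (fun t => y i t - y j (t - (Ti - Tj))) Filter.atTop (nhds 0))

/-! ## Distributed dynamic protocols -/

/-- A distributed linear dynamic protocol. Every non-root agent `f` has a protocol state `χ f`,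
transmits `H f χ f` over the network besides its output, and applies
`χ' = Ac χ + Bc ζ + Ec ζhat`, `u = Cc χ + Dc ζ`, where `ζ` and `ζhat` are what the network
delivers from the outputs and from the transmitted protocol signals. The root has no protocol:
its input is `0`, and it transmits only its output. -/
structure Protocol {M p : ℕ} (S : MAS M p) where
  σ : Fin M → Type
  [fintype : ∀ f : Fin M, Fintype (σ f)]
  Ac : ∀ f : Fin M, Matrix (σ f) (σ f) ℝ
  Bc : ∀ f : Fin M, Matrix (σ f) (Fin p) ℝ
  Ec : ∀ f : Fin M, Matrix (σ f) (Fin p) ℝ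
  Cc : ∀ f : Fin M, Matrix (Fin (S.m f.succ)) (σ f) ℝ
  Dc : ∀ f : Fin M, Matrix (Fin (S.m f.succ)) (Fin p) ℝ
  H : ∀ f : Fin M, Matrix (Fin p) (σ f) ℝ

attribute [instance] Protocol.fintype

/-- The outputs of the agents. -/
def MAS.output {M p : ℕ} (S : MAS M p) (x : ∀ i, ℝ → Fin (S.n i) → ℝ) (i : Fin (M + 1)) (t : ℝ) :
    Fin p → ℝ :=
  S.C i *ᵥ x i t

/-- The transmitted protocol signals; the one of the root is `0`. -/
def Protocol.signal {M p : ℕ} {S : MAS M p} (P : Protocol S) (χ : ∀ f, ℝ → P.σ f → ℝ)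
    (i : Fin (M + 1)) (t : ℝ) : Fin p → ℝ :=
  Fin.cases (motive := fun _ => Fin p → ℝ) 0 (fun f => P.H f *ᵥ χ f t) i

/-- `(x, χ)` is a trajectory, for `t > 0`, of the closed loop of the agents and the protocol over
the network with weights `a` and delays `τ`. The values at `t ≤ 0` are the initial history, on
which nothing is imposed. -/
structure IsTrajectory {M p : ℕ} (S : MAS M p) (P : Protocol S)
    (a τ : Matrix (Fin (M + 1)) (Fin (M + 1)) ℝ)
    (x : ∀ i, ℝ → Fin (S.n i) → ℝ) (χ : ∀ f, ℝ → P.σ f → ℝ) : Prop where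
  root : ∀ t > 0, HasDerivAt (x 0) (S.A 0 *ᵥ x 0 t) t
  agent : ∀ f : Fin M, ∀ t > 0, HasDerivAt (x f.succ)
    (S.A f.succ *ᵥ x f.succ t + S.B f.succ *ᵥ
      (P.Cc f *ᵥ χ f t + P.Dc f *ᵥ networkSignal a τ (S.output x) f.succ t)) t
  protocol : ∀ f : Fin M, ∀ t > 0, HasDerivAt (χ f)
    (P.Ac f *ᵥ χ f t + P.Bc f *ᵥ networkSignal a τ (S.output x) f.succ t
      + P.Ec f *ᵥ networkSignal a τ (P.signal χ) f.succ t) t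

/-- The protocol solves the delayed output synchronization problem: one and the same protocol
works for all graphs in `𝔾_β^N`, all delays and all initial data. -/
def Protocol.Solves {M p : ℕ} {S : MAS M p} (P : Protocol S) (β : ℝ) : Prop :=
  ∀ a : Matrix (Fin (M + 1)) (Fin (M + 1)) ℝ, MemG β a →
  ∀ τ : Matrix (Fin (M + 1)) (Fin (M + 1)) ℝ, (∀ i j, 0 < a i j → 0 ≤ τ i j) →
  ∀ (x : ∀ i, ℝ → Fin (S.n i) → ℝ) (χ : ∀ f, ℝ → P.σ f → ℝ),
    IsTrajectory S P a τ x χ → DelayedSynchronization a τ (S.output x)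

/-! ## The observer and output-regulation protocol -/

/-- The observability matrix `O` of the pair consisting of agent `f` and the root, with output
`y_f - y_root`. -/
def MAS.pairObs {M p : ℕ} (S : MAS M p) (f : Fin M) :
    Matrix (Fin (S.n f.succ + S.n 0) × Fin p) (Fin (S.n f.succ) ⊕ Fin (S.n 0)) ℝ :=
  obsMatrix (S.n f.succ + S.n 0) (Matrix.fromBlocks (S.A f.succ) 0 0 (S.A 0))
    (Matrix.fromCols (S.C f.succ) (-S.C 0))

/-- The choices for the change of coordinates: the columns of `(Λu; Φu)` are a basis of the null
space of `O`, and `Φ = (Φu Φc)` is nonsingular with inverse `Φinv`. (A completion of `Λu` to a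
nonsingular matrix `Λ = (Λu Λc)` would enter only through `Λ diag(I, 0) = (Λu 0)`.) -/
structure Coordinates {M p : ℕ} (S : MAS M p) (f : Fin M) where
  q : ℕ
  k : ℕ
  Λu : Matrix (Fin (S.n f.succ)) (Fin q) ℝ
  Φu : Matrix (Fin (S.n 0)) (Fin q) ℝ
  Φc : Matrix (Fin (S.n 0)) (Fin k) ℝ
  Φinv : Matrix (Fin q ⊕ Fin k) (Fin (S.n 0)) ℝ
  q_eq : q = Module.finrank ℝ (LinearMap.ker (S.pairObs f).mulVecLin)
  null : S.pairObs f * Matrix.fromRows Λu Φu = 0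
  rank_eq : (Matrix.fromRows Λu Φu).rank = q
  mul_inv : Matrix.fromCols Φu Φc * Φinv = 1
  inv_mul : Φinv * Matrix.fromCols Φu Φc = 1

namespace Coordinates

variable {M p : ℕ} {S : MAS M p} {f : Fin M} (D : Coordinates S f)

/-! In the coordinates `w₁ = x_f - (Λu 0) Φinv x_root`, `w₂ = - (0 I) Φinv x_root` the pair reads
`w₁' = A w₁ + A12 w₂ + B u`, `w₂' = A22 w₂`, `e = C w₁ - C2 w₂`. -/

def A12 : Matrix (Fin (S.n f.succ)) (Fin D.k) ℝ :=
  D.Λu * (D.Φinv.toRows₁ * S.A 0 * D.Φc)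

def A22 : Matrix (Fin D.k) (Fin D.k) ℝ :=
  D.Φinv.toRows₂ * S.A 0 * D.Φc

def C2 : Matrix (Fin p) (Fin D.k) ℝ :=
  -(S.C 0 * D.Φc)

def Abar : Matrix (Fin (S.n f.succ) ⊕ Fin D.k) (Fin (S.n f.succ) ⊕ Fin D.k) ℝ :=
  Matrix.fromBlocks (S.A f.succ) D.A12 0 D.A22

def Bbar : Matrix (Fin (S.n f.succ) ⊕ Fin D.k) (Fin (S.m f.succ)) ℝ :=
  Matrix.fromRows (S.B f.succ) 0

def Cbar : Matrix (Fin p) (Fin (S.n f.succ) ⊕ Fin D.k) ℝ :=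
  Matrix.fromCols (S.C f.succ) (-D.C2)

def Ξ (l : ℕ) : Matrix (Fin l × Fin p) (Fin (S.n f.succ) ⊕ Fin D.k) ℝ :=
  obsMatrix l D.Abar D.Cbar

/-- The left inverse `(Ξᵀ Ξ)⁻¹ Ξᵀ`. -/
def Ξpinv (l : ℕ) : Matrix (Fin (S.n f.succ) ⊕ Fin D.k) (Fin l × Fin p) ℝ :=
  ((D.Ξ l)ᵀ * D.Ξ l)⁻¹ * (D.Ξ l)ᵀ

end Coordinates

/-- The design data for agent `f`: coordinates, a stabilizing feedback `K`, and a solution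
`(Pi, Γ)` of the regulator equations. -/
structure Design {M p : ℕ} (S : MAS M p) (f : Fin M) extends Coordinates S f where
  K : Matrix (Fin (S.m f.succ)) (Fin (S.n f.succ)) ℝ
  Γ : Matrix (Fin (S.m f.succ)) (Fin k) ℝ
  Pi : Matrix (Fin (S.n f.succ)) (Fin k) ℝ
  hurwitz : IsHurwitz (S.A f.succ + S.B f.succ * K)
  regulator_state : Pi * toCoordinates.A22 =
    S.A f.succ * Pi + toCoordinates.A12 + S.B f.succ * Γ
  regulator_output : S.C f.succ * Pi = toCoordinates.C2

/-- The feedback `F = (K, Γ - K Pi)`. -/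
def Design.F {M p : ℕ} {S : MAS M p} {f : Fin M} (D : Design S f) :
    Matrix (Fin (S.m f.succ)) (Fin (S.n f.succ) ⊕ Fin D.k) ℝ :=
  Matrix.fromCols D.K (D.Γ - D.K * D.Pi)

section Observer

variable (l p : ℕ)

/-- The block shift `(0 I; 0 0)`. -/
def shiftA : Matrix (Fin l × Fin p) (Fin l × Fin p) ℝ :=
  Matrix.of fun r s => if (s.1 : ℕ) = r.1 + 1 ∧ s.2 = r.2 then 1 else 0

/-- `(I 0)`. -/
def shiftC : Matrix (Fin p) (Fin l × Fin p) ℝ :=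
  Matrix.of fun b s => if (s.1 : ℕ) = 0 ∧ s.2 = b then 1 else 0

variable {l p}

/-- `(0; G)`: the last block row is `G`, the others are `0`. -/
def lastRow (G : Matrix (Fin p) (Fin l × Fin p) ℝ) : Matrix (Fin l × Fin p) (Fin l × Fin p) ℝ :=
  Matrix.of fun r s => if (r.1 : ℕ) + 1 = l then G r.2 s else 0

variable (l p)

/-- `H_ε = diag(ε⁻¹ I, ε⁻² I, …, ε⁻ˡ I)`. -/
def gainH (ε : ℝ) : Matrix (Fin l × Fin p) (Fin l × Fin p) ℝ :=
  Matrix.diagonal fun r => (ε⁻¹) ^ ((r.1 : ℕ) + 1)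

variable {l p}

/-- `K_ε = (0; ε ^ (l + 1) K H_ε)`. -/
def gainK (K : Matrix (Fin p) (Fin l × Fin p) ℝ) (ε : ℝ) :
    Matrix (Fin l × Fin p) (Fin l × Fin p) ℝ :=
  lastRow (ε ^ (l + 1) • (K * gainH l p ε))

/-- `Q` is a solution of the algebraic Riccati equation for the parameters `β`, `K`, `ε`. -/
def IsRiccati (β : ℝ) (K : Matrix (Fin p) (Fin l × Fin p) ℝ) (ε : ℝ)
    (Q : Matrix (Fin l × Fin p) (Fin l × Fin p) ℝ) : Prop :=
  (shiftA l p + gainK K ε) * Q + Q * (shiftA l p + gainK K ε)ᵀ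
    - (2 * β) • (Q * (shiftC l p)ᵀ * shiftC l p * Q) + 1 = 0

end Observer

/-- The observer and output-regulation protocol, with state `φhat`:
`φhat' = (A_o + K_o) φhat + Ξ Bbar u + H_ε Q C_oᵀ (ζ - ζhat)`, `u = F (ΞᵀΞ)⁻¹Ξᵀ φhat`,
where `K_o = (0; Cbar Abar ^ l (ΞᵀΞ)⁻¹Ξᵀ)` and `ζhat` comes from the transmitted `C_o φhat`. -/
def regulationProtocol {M p : ℕ} {S : MAS M p} (l : ℕ) (D : ∀ f, Design S f) (ε : ℝ)
    (Q : Matrix (Fin l × Fin p) (Fin l × Fin p) ℝ) : Protocol S where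
  σ := fun _ => Fin l × Fin p
  Ac := fun f => shiftA l p + lastRow ((D f).Cbar * (D f).Abar ^ l * (D f).Ξpinv l)
    + (D f).Ξ l * (D f).Bbar * ((D f).F * (D f).Ξpinv l)
  Bc := fun _ => gainH l p ε * Q * (shiftC l p)ᵀ
  Ec := fun _ => -(gainH l p ε * Q * (shiftC l p)ᵀ)
  Cc := fun f => (D f).F * (D f).Ξpinv l
  Dc := fun _ => 0
  H := fun _ => shiftC l p

end DelayedSync

end

/-!
The outputs are compared after undoing the delays. Along the tree, the delays accumulate to the time
shift `T i` of agent `i`, and it suffices that `y i (t) - y_root (t - T i) → 0` for every agent. An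
agent `f` hears only its parent `j`, through `l (v_f (t) - v_j (t - τ))` with an unknown weight
`l ≥ β`. If every agent transmits its estimate `ψ` of its own error `y_f - y_root (t - T f)`, then
`ζ - ζhat` is `l` times the difference of the estimation errors `y - ψ - y_root (t - T)` of `f` and
of `j`, in which all delays have disappeared. The estimation errors therefore form a cascade along
the tree, whose blocks are the observer matrices `N - l Bc H`. If these are Hurwitz for every
`l ≥ β`, then the estimation errors decay one after another, by the convergence of `x' = A x + d`
for Hurwitz `A` and `d → 0` (`IsHurwitz.tendsto_zero`), and an output regulator driven by the
estimates makes the errors decay. `RegulatingObserver` collects what is needed of a protocol and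
`solves_of_regulatingObserver` carries out this argument.

The gains come from the filter Riccati equation `A Q + Q Aᵀ - 2 β Q Cᵀ C Q + 1 = 0`: its positive
definite solution is a Lyapunov matrix for `A - l Q Cᵀ C` for all `l ≥ β` at once
(`isHurwitz_sub_of_riccati`). It exists for detectable pairs (`exists_riccati`) and is unique
(`riccati_unique`). Lyapunov equations are reduced by the Cayley transform to Stein equations,
which are solved by convergent series.

The error between an agent and the root is the output of an observable system `(Abar, Cbar)`, the
quotient of the pair by its unobservable subspace (`Coordinates.observable_bar`). In the regulation
protocol this system is embedded by `Ξ` into a block companion form, and the scaling by `H_ε` turns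
the last block row of the companion matrix into a perturbation that vanishes as `ε → 0`, while the
solutions `Q_ε` stay bounded; hence a single `ε₀` serves all graphs
(`eventually_isHurwitz_observer`, `exists_regulationProtocol_solves`).

Design data require a solution of the regulator equations. By duality and by the generalized left
eigenvectors of the exosystem, these are solvable when the Rosenbrock matrix has full row rank at
the eigenvalues of the exosystem (`exists_regulator`), and right-invertibility gives this rank away
from the invariant zeros (`RightInvertible.hasFullRowRankAt`). For observable agents the
unobservable subspace of the pair is a graph over a subspace of the state space of the root, which
gives the coordinates (`nonempty_design`).

Under the standing assumptions only the unstable eigenvalues of the root are known to be no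
invariant zeros, and the agents need not be observable. The general protocol is therefore designed
for reduced agents: the root is replaced by the quotient by its stable modes, which do not matter
asymptotically (`exists_antistable_quotient`), and every other agent by its observable quotient,
which keeps stabilizability and the full row rank (`Stabilizable.quotient`,
`HasFullRowRankAt.quotient`). Design data of the reduced agents exist, and they yield regulating
observers of the original ones (`reducedObserver`).
-/

noncomputable section

namespace DelayedSync

open Filter Topology

/-! ### Real quadratic forms -/

section Quadratic

variable {ν μ : Type} [Fintype ν] [Fintype μ]

theorem posSemidef_iff_real {P : Matrix ν ν ℝ} :
    P.PosSemidef ↔ Pᵀ = P ∧ ∀ x : ν → ℝ, 0 ≤ x ⬝ᵥ P *ᵥ x := by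
  rw [posSemidef_iff_dotProduct_mulVec]
  simp [IsHermitian, conjTranspose_eq_transpose_of_trivial]

theorem posDef_iff_real {P : Matrix ν ν ℝ} :
    P.PosDef ↔ Pᵀ = P ∧ ∀ x : ν → ℝ, x ≠ 0 → 0 < x ⬝ᵥ P *ᵥ x := by
  rw [posDef_iff_dotProduct_mulVec]
  simp [IsHermitian, conjTranspose_eq_transpose_of_trivial]

theorem dotProduct_transpose_mulVec (P : Matrix ν μ ℝ) (x : μ → ℝ) (y : ν → ℝ) :
    x ⬝ᵥ Pᵀ *ᵥ y = y ⬝ᵥ P *ᵥ x := by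
  rw [mulVec_transpose, dotProduct_comm, ← dotProduct_mulVec]

theorem dotProduct_conj_mulVec (N : Matrix ν μ ℝ) (P : Matrix μ μ ℝ) (x : ν → ℝ) :
    x ⬝ᵥ (N * P * Nᵀ) *ᵥ x = (Nᵀ *ᵥ x) ⬝ᵥ P *ᵥ (Nᵀ *ᵥ x) := by
  rw [← mulVec_mulVec, ← mulVec_mulVec, dotProduct_mulVec, mulVec_transpose]

theorem dotProduct_self_pos {x : ν → ℝ} (hx : x ≠ 0) : 0 < x ⬝ᵥ x := by
  have := dotProduct_star_self_pos_iff.2 hx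
  simpa using this

theorem dotProduct_self_nonneg' (x : ν → ℝ) : 0 ≤ x ⬝ᵥ x :=
  Finset.sum_nonneg fun _ _ => mul_self_nonneg _

/-- The entrywise `ℓ¹` norm of `M` bounds its quadratic form. -/
theorem abs_dotProduct_mulVec_le (M : Matrix ν ν ℝ) (x : ν → ℝ) :
    |x ⬝ᵥ M *ᵥ x| ≤ (∑ i, ∑ j, |M i j|) * (x ⬝ᵥ x) := by
  have hx : ∀ i, x i * x i ≤ x ⬝ᵥ x := fun i =>
    Finset.single_le_sum (f := fun i => x i * x i) (fun j _ => mul_self_nonneg _)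
      (Finset.mem_univ i)
  have h : x ⬝ᵥ M *ᵥ x = ∑ i, ∑ j, M i j * (x i * x j) := by
    simp only [dotProduct, mulVec, Finset.mul_sum]
    exact Finset.sum_congr rfl fun i _ => Finset.sum_congr rfl fun j _ => by ring
  rw [h, Finset.sum_mul]
  refine (Finset.abs_sum_le_sum_abs _ _).trans (Finset.sum_le_sum fun i _ => ?_)
  rw [Finset.sum_mul]
  refine (Finset.abs_sum_le_sum_abs _ _).trans (Finset.sum_le_sum fun j _ => ?_)
  rw [abs_mul]
  refine mul_le_mul_of_nonneg_left ?_ (abs_nonneg _)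
  have := hx i
  have := hx j
  rw [abs_le]
  constructor <;> nlinarith [sq_nonneg (x i - x j), sq_nonneg (x i + x j)]

/-- A positive semidefinite form vanishes only on its radical. -/
theorem mulVec_eq_zero_of_posSemidef {P : Matrix ν ν ℝ} (hP : P.PosSemidef) {x : ν → ℝ}
    (h : x ⬝ᵥ P *ᵥ x = 0) : P *ᵥ x = 0 := by
  have := (hP.dotProduct_mulVec_zero_iff x).1 (by simpa using h)
  exact this

/-- A positive definite form dominates a positive multiple of the Euclidean one. -/
theorem exists_pos_mul_le_of_posDef [DecidableEq ν] {P : Matrix ν ν ℝ} (hP : P.PosDef) :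
    ∃ c > 0, ∀ x : ν → ℝ, c * (x ⬝ᵥ x) ≤ x ⬝ᵥ P *ᵥ x := by
  have hPr := posDef_iff_real.1 hP
  have hu := (Matrix.isUnit_iff_isUnit_det _).1 hP.isUnit
  obtain ⟨K, hK, hKle⟩ : ∃ K : ℝ, 0 ≤ K ∧ ∀ x : ν → ℝ, x ⬝ᵥ P⁻¹ *ᵥ x ≤ K * (x ⬝ᵥ x) :=
    ⟨_, Finset.sum_nonneg fun _ _ => Finset.sum_nonneg fun _ _ => abs_nonneg _,
      fun x => (le_abs_self _).trans (abs_dotProduct_mulVec_le _ x)⟩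
  refine ⟨1 / (K + 1), by positivity, fun x => ?_⟩
  set s := 1 / (K + 1) with hs
  -- evaluate the form at `x - s P⁻¹ x`
  have h0 := (posSemidef_iff_real.1 hP.posSemidef).2 (x - s • P⁻¹ *ᵥ x)
  have h1 : P *ᵥ (P⁻¹ *ᵥ x) = x := by rw [mulVec_mulVec, mul_nonsing_inv _ hu, one_mulVec]
  have h2 : (P⁻¹ *ᵥ x) ⬝ᵥ P *ᵥ x = x ⬝ᵥ x := by
    rw [← dotProduct_transpose_mulVec, hPr.1, h1]
  have h3 : (x - s • P⁻¹ *ᵥ x) ⬝ᵥ P *ᵥ (x - s • P⁻¹ *ᵥ x) =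
      x ⬝ᵥ P *ᵥ x - 2 * s * (x ⬝ᵥ x) + s ^ 2 * (x ⬝ᵥ P⁻¹ *ᵥ x) := by
    rw [mulVec_sub, mulVec_smul, h1]
    simp only [sub_dotProduct, dotProduct_sub, smul_dotProduct, dotProduct_smul, smul_eq_mul, h2]
    rw [dotProduct_comm (P⁻¹ *ᵥ x) x]
    ring
  rw [h3] at h0
  have h4 := dotProduct_self_nonneg' x
  have h5 : s * K ≤ 1 := by
    rw [hs, div_mul_eq_mul_div, one_mul, div_le_one (by positivity)]
    linarith
  have h6 : 0 < s := by positivity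
  have h7 : s ^ 2 * (x ⬝ᵥ P⁻¹ *ᵥ x) ≤ s * (x ⬝ᵥ x) := by
    calc s ^ 2 * (x ⬝ᵥ P⁻¹ *ᵥ x) ≤ s ^ 2 * (K * (x ⬝ᵥ x)) :=
          mul_le_mul_of_nonneg_left (hKle x) (sq_nonneg s)
      _ = (s * K) * (s * (x ⬝ᵥ x)) := by ring
      _ ≤ 1 * (s * (x ⬝ᵥ x)) := mul_le_mul_of_nonneg_right h5 (by positivity)
      _ = s * (x ⬝ᵥ x) := one_mul _
  linarith

/-- A symmetric real matrix is determined by its quadratic form. -/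
theorem eq_zero_of_forall_dotProduct [DecidableEq ν] {M : Matrix ν ν ℝ} (hM : Mᵀ = M)
    (h : ∀ x : ν → ℝ, x ⬝ᵥ M *ᵥ x = 0) : M = 0 := by
  have hP : M.PosSemidef := posSemidef_iff_real.2 ⟨hM, fun x => (h x).ge⟩
  ext i j
  have := congrFun (mulVec_eq_zero_of_posSemidef hP (h (Pi.single j 1))) i
  simpa using this

end Quadratic

/-! ### Eigenvalues and the Cayley transform -/

section Eigenvalues

variable {ν : Type} [Fintype ν] [DecidableEq ν]

theorem mem_eigenvalues_iff_vecMul {A : Matrix ν ν ℝ} {z : ℂ} :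
    z ∈ eigenvalues A ↔
      ∃ v : ν → ℂ, v ≠ 0 ∧ v ᵥ* A.map (algebraMap ℝ ℂ) = z • v := by
  rw [eigenvalues, spectrum.mem_iff, Matrix.isUnit_iff_isUnit_det, isUnit_iff_ne_zero, not_not,
    ← exists_vecMul_eq_zero_iff]
  refine exists_congr fun v => and_congr_right fun _ => ?_
  rw [vecMul_sub, sub_eq_zero, Algebra.algebraMap_eq_smul_one, vecMul_smul, vecMul_one, eq_comm]

theorem mem_eigenvalues_iff_mulVec {A : Matrix ν ν ℝ} {z : ℂ} :
    z ∈ eigenvalues A ↔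
      ∃ v : ν → ℂ, v ≠ 0 ∧ A.map (algebraMap ℝ ℂ) *ᵥ v = z • v := by
  rw [eigenvalues, spectrum.mem_iff, Matrix.isUnit_iff_isUnit_det, isUnit_iff_ne_zero, not_not,
    ← exists_mulVec_eq_zero_iff]
  refine exists_congr fun v => and_congr_right fun _ => ?_
  rw [sub_mulVec, sub_eq_zero, Algebra.algebraMap_eq_smul_one, smul_mulVec, one_mulVec, eq_comm]

theorem eigenvalues_transpose (A : Matrix ν ν ℝ) : eigenvalues Aᵀ = eigenvalues A := by
  ext z
  rw [mem_eigenvalues_iff_vecMul, mem_eigenvalues_iff_mulVec]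
  simp only [transpose_map, vecMul_transpose]

theorem IsHurwitz.transpose {A : Matrix ν ν ℝ} (hA : IsHurwitz A) : IsHurwitz Aᵀ := by
  rwa [IsHurwitz, eigenvalues_transpose]

omit [DecidableEq ν] in
theorem map_mulVec_ofReal (A : Matrix ν ν ℝ) (v : ν → ℝ) :
    A.map (algebraMap ℝ ℂ) *ᵥ (fun i => (v i : ℂ)) = fun i => ((A *ᵥ v) i : ℂ) := by
  ext i
  simp [mulVec, dotProduct]

/-- The entries of the powers of a matrix with spectrum in the open unit disc decay
geometrically; this is Gelfand's formula. -/
theorem exists_abs_pow_le {T : Matrix ν ν ℝ} (hT : ∀ z ∈ eigenvalues T, ‖z‖ < 1) :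
    ∃ r : ℝ, 0 ≤ r ∧ r < 1 ∧ ∀ᶠ k : ℕ in atTop, ∀ i j, |(T ^ k) i j| ≤ r ^ k := by
  classical
  rcases isEmpty_or_nonempty ν with hν | hν
  · exact ⟨0, le_rfl, one_pos, Eventually.of_forall fun k i => hν.elim i⟩
  let _ : NormedRing (Matrix ν ν ℂ) := Matrix.linftyOpNormedRing
  let _ : NormedAlgebra ℂ (Matrix ν ν ℂ) := Matrix.linftyOpNormedAlgebra
  set Tc : Matrix ν ν ℂ := T.map (algebraMap ℝ ℂ) with hTc
  have hlt : spectralRadius ℂ Tc < (1 : NNReal) :=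
    spectrum.spectralRadius_lt_of_forall_lt Tc fun z hz => by
      have := hT z hz
      exact_mod_cast this
  obtain ⟨r, h1, h2⟩ := ENNReal.lt_iff_exists_nnreal_btwn.1 hlt
  refine ⟨r, r.2, by exact_mod_cast h2, ?_⟩
  have hG := (spectrum.pow_nnnorm_pow_one_div_tendsto_nhds_spectralRadius Tc).eventually
    (gt_mem_nhds h1)
  filter_upwards [hG, eventually_gt_atTop 0] with k hk hk0 i j
  have hk' : (‖Tc ^ k‖₊ : ENNReal) ≤ (r : ENNReal) ^ k := by
    have := ENNReal.rpow_le_rpow hk.le (Nat.cast_nonneg k : (0 : ℝ) ≤ k)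
    rwa [← ENNReal.rpow_mul, one_div, inv_mul_cancel₀ (by exact_mod_cast hk0.ne'),
      ENNReal.rpow_one, ENNReal.rpow_natCast] at this
  have hk2 : ‖Tc ^ k‖₊ ≤ r ^ k := by exact_mod_cast hk'
  have hent : Tc ^ k = (T ^ k).map (algebraMap ℝ ℂ) := by
    rw [hTc, ← RingHom.mapMatrix_apply, ← RingHom.mapMatrix_apply, map_pow]
  have hle : ‖(Tc ^ k) i j‖₊ ≤ ‖Tc ^ k‖₊ := by
    rw [linfty_opNNNorm_def]
    exact (Finset.single_le_sum (f := fun j => ‖(Tc ^ k) i j‖₊) (fun _ _ => zero_le)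
      (Finset.mem_univ j)).trans
      (Finset.le_sup (f := fun i => ∑ j, ‖(Tc ^ k) i j‖₊) (Finset.mem_univ i))
  have h3 : ‖(Tc ^ k) i j‖ ≤ (r : ℝ) ^ k := by exact_mod_cast hle.trans hk2
  rw [hent] at h3
  simpa using h3

/-- The Cayley transform `T = (A + 1) (A - 1)⁻¹` of a Hurwitz matrix: `A - 1` is invertible and
the spectrum of `T` lies in the open unit disc. -/
theorem IsHurwitz.exists_cayley {A : Matrix ν ν ℝ} (hA : IsHurwitz A) :
    ∃ T N : Matrix ν ν ℝ, (A - 1) * N = 1 ∧ N * (A - 1) = 1 ∧ T * (A - 1) = A + 1 ∧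
      ∀ z ∈ eigenvalues T, ‖z‖ < 1 := by
  have hdet : (A - 1).det ≠ 0 := by
    intro h0
    obtain ⟨v, hv, h⟩ := exists_vecMul_eq_zero_iff.2 h0
    have : (1 : ℂ) ∈ eigenvalues A := by
      rw [← eigenvalues_transpose, mem_eigenvalues_iff_mulVec]
      refine ⟨fun i => (v i : ℂ), fun h => hv (funext fun i => ?_), ?_⟩
      · simpa using congrFun h i
      · rw [vecMul_sub, vecMul_one, sub_eq_zero] at h
        rw [map_mulVec_ofReal, mulVec_transpose, h, one_smul]
    have := hA 1 this
    norm_num at this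
  have hu : IsUnit (A - 1).det := isUnit_iff_ne_zero.2 hdet
  refine ⟨(A + 1) * (A - 1)⁻¹, (A - 1)⁻¹, mul_nonsing_inv _ hu, nonsing_inv_mul _ hu, ?_, ?_⟩
  · rw [Matrix.mul_assoc, nonsing_inv_mul _ hu, Matrix.mul_one]
  intro z hz
  obtain ⟨v, hv, h⟩ := mem_eigenvalues_iff_vecMul.1 hz
  have h1 : v ᵥ* (A + 1).map (algebraMap ℝ ℂ) = z • (v ᵥ* (A - 1).map (algebraMap ℝ ℂ)) := by
    rw [← smul_vecMul, ← h, vecMul_vecMul, ← Matrix.map_mul, Matrix.mul_assoc,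
      nonsing_inv_mul _ hu, Matrix.mul_one]
  have e1 : (A + 1).map (algebraMap ℝ ℂ) = A.map (algebraMap ℝ ℂ) + 1 := by
    rw [Matrix.map_add _ (map_add _), Matrix.map_one _ (map_zero _) (map_one _)]
  have e2 : (A - 1).map (algebraMap ℝ ℂ) = A.map (algebraMap ℝ ℂ) - 1 := by
    rw [Matrix.map_sub _ (map_sub _), Matrix.map_one _ (map_zero _) (map_one _)]
  rw [e1, e2, vecMul_add, vecMul_sub, vecMul_one] at h1
  have h2 : (1 - z) • (v ᵥ* A.map (algebraMap ℝ ℂ)) = (-(1 + z)) • v := by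
    ext i
    have := congrFun h1 i
    simp only [Pi.add_apply, Pi.smul_apply, Pi.sub_apply, smul_eq_mul] at this ⊢
    linear_combination this
  have hz1 : 1 - z ≠ 0 := by
    intro h0
    have hz' : z = 1 := by linear_combination -h0
    rw [h0, zero_smul, hz'] at h2
    refine hv (funext fun i => ?_)
    have := congrFun h2 i
    simp only [Pi.zero_apply, Pi.smul_apply, smul_eq_mul] at this
    simp only [Pi.zero_apply]
    linear_combination (-1 / 2 : ℂ) * this.symm
  have hmem : -(1 + z) / (1 - z) ∈ eigenvalues A := by
    refine mem_eigenvalues_iff_vecMul.2 ⟨v, hv, ?_⟩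
    rw [div_eq_inv_mul, mul_smul, ← h2, smul_smul, inv_mul_cancel₀ hz1, one_smul]
  have hre := hA _ hmem
  -- the real part of `-(1 + z) / (1 - z)` is `(‖z‖² - 1) / ‖1 - z‖²`
  rw [Complex.div_re, ← add_div] at hre
  have hpos : 0 < Complex.normSq (1 - z) := Complex.normSq_pos.2 hz1
  rw [div_lt_iff₀ hpos, zero_mul] at hre
  simp only [Complex.neg_re, Complex.add_re, Complex.one_re, Complex.sub_re, Complex.neg_im,
    Complex.add_im, Complex.one_im, Complex.sub_im] at hre
  have hn : ‖z‖ ^ 2 < 1 := by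
    rw [Complex.sq_norm, Complex.normSq_apply]
    nlinarith
  nlinarith [norm_nonneg z]

end Eigenvalues

/-! ### Lyapunov equations -/

section Lyapunov

variable {ν : Type} [Fintype ν] [DecidableEq ν]

theorem tendsto_pow_entry {T : Matrix ν ν ℝ} (hT : ∀ z ∈ eigenvalues T, ‖z‖ < 1) (i j : ν) :
    Tendsto (fun k : ℕ => (T ^ k) i j) atTop (𝓝 0) := by
  obtain ⟨r, h0, h1, h⟩ := exists_abs_pow_le hT
  refine squeeze_zero_norm' ?_ (tendsto_pow_atTop_nhds_zero_of_lt_one h0 h1)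
  filter_upwards [h] with k hk using hk i j

/-- The Stein equation `T P Tᵀ - P = -W` is solved by `P = ∑ Tᵏ W (Tᵏ)ᵀ`. -/
theorem exists_stein {T : Matrix ν ν ℝ} (hT : ∀ z ∈ eigenvalues T, ‖z‖ < 1)
    {W : Matrix ν ν ℝ} (hW : W.PosSemidef) :
    ∃ P : Matrix ν ν ℝ, P.PosSemidef ∧ T * P * Tᵀ - P = -W := by
  obtain ⟨r, h0, h1, h⟩ := exists_abs_pow_le hT
  set f : ℕ → Matrix ν ν ℝ := fun k => T ^ k * W * (T ^ k)ᵀ with hf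
  have hs : Summable f := by
    refine Pi.summable.2 fun i => Pi.summable.2 fun j => ?_
    refine Summable.of_norm_bounded_eventually_nat
      (g := fun k => (∑ a, ∑ b, |W a b|) * (r ^ 2) ^ k)
      ((summable_geometric_of_lt_one (sq_nonneg r) (by nlinarith)).mul_left _) ?_
    filter_upwards [h] with k hk
    have e : f k i j = ∑ b, ∑ a, W a b * ((T ^ k) i a * (T ^ k) j b) := by
      simp only [hf, Matrix.mul_apply, transpose_apply, Finset.sum_mul]
      exact Finset.sum_congr rfl fun b _ => Finset.sum_congr rfl fun a _ => by ring
    rw [e, Finset.sum_comm, Real.norm_eq_abs, Finset.sum_mul]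
    refine (Finset.abs_sum_le_sum_abs _ _).trans (Finset.sum_le_sum fun a _ => ?_)
    rw [Finset.sum_mul]
    refine (Finset.abs_sum_le_sum_abs _ _).trans (Finset.sum_le_sum fun b _ => ?_)
    rw [abs_mul, abs_mul]
    refine mul_le_mul_of_nonneg_left ?_ (abs_nonneg _)
    rw [← pow_mul, mul_comm 2 k, pow_mul, sq]
    exact mul_le_mul (hk i a) (hk j b) (abs_nonneg _) (pow_nonneg h0 _)
  obtain ⟨P, hP⟩ := hs
  have hWr := posSemidef_iff_real.1 hW
  refine ⟨P, posSemidef_iff_real.2 ⟨?_, fun x => ?_⟩, ?_⟩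
  · have h2 : HasSum (fun k => (f k)ᵀ) Pᵀ := hP.matrix_transpose
    have h3 : (fun k => (f k)ᵀ) = f := by
      funext k
      simp only [hf, transpose_mul, transpose_transpose, hWr.1, Matrix.mul_assoc]
    rw [h3] at h2
    exact h2.unique hP
  · let φ : Matrix ν ν ℝ →+ ℝ :=
      { toFun := fun M => x ⬝ᵥ M *ᵥ x
        map_zero' := by simp
        map_add' := fun a b => by rw [add_mulVec, dotProduct_add] }
    have hc : Continuous φ := by
      change Continuous fun M : Matrix ν ν ℝ => x ⬝ᵥ M *ᵥ x
      fun_prop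
    have h2 : HasSum (fun k => x ⬝ᵥ f k *ᵥ x) (x ⬝ᵥ P *ᵥ x) := hP.map φ hc
    refine h2.nonneg fun k => ?_
    simp only [hf]
    rw [dotProduct_conj_mulVec]
    exact hWr.2 _
  · have h2 : HasSum (fun k => T * f k * Tᵀ) (T * P * Tᵀ) :=
      (hP.mul_left T).mul_right Tᵀ
    have h3 : (fun k => T * f k * Tᵀ) = fun k => f (k + 1) := by
      funext k
      simp only [hf, pow_succ' T k, transpose_mul, Matrix.mul_assoc]
    rw [h3] at h2
    have h4 := (hasSum_nat_add_iff' 1).2 hP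
    rw [h2.unique h4]
    simp [hf]

/-- The Cayley transform exchanges the Lyapunov and the Stein operators. -/
theorem cayley_identity {A T : Matrix ν ν ℝ} (h : T * (A - 1) = A + 1) (X : Matrix ν ν ℝ) :
    T * ((A - 1) * X * (A - 1)ᵀ) * Tᵀ - (A - 1) * X * (A - 1)ᵀ =
      (2 : ℝ) • (A * X + X * Aᵀ) := by
  have e : T * ((A - 1) * X * (A - 1)ᵀ) * Tᵀ = (T * (A - 1)) * X * (T * (A - 1))ᵀ := by
    simp only [transpose_mul, Matrix.mul_assoc]
  rw [e, h, two_smul]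
  simp only [transpose_add, transpose_sub, transpose_one]
  noncomm_ring

/-- For Hurwitz `A`, the Lyapunov equation is solvable with a positive semidefinite solution. -/
theorem IsHurwitz.exists_lyapunov {A : Matrix ν ν ℝ} (hA : IsHurwitz A) {W : Matrix ν ν ℝ}
    (hW : W.PosSemidef) : ∃ P : Matrix ν ν ℝ, P.PosSemidef ∧ A * P + P * Aᵀ = -W := by
  obtain ⟨T, N, hN1, hN2, hTA, hT⟩ := hA.exists_cayley
  obtain ⟨P, hP, hst⟩ := exists_stein hT (hW.smul (a := (2 : ℝ)) (by norm_num))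
  have hPr := posSemidef_iff_real.1 hP
  refine ⟨N * P * Nᵀ, posSemidef_iff_real.2 ⟨?_, fun x => ?_⟩, ?_⟩
  · simp [transpose_mul, hPr.1, Matrix.mul_assoc]
  · rw [dotProduct_conj_mulVec]
    exact hPr.2 _
  have h := cayley_identity hTA (N * P * Nᵀ)
  have e : (A - 1) * (N * P * Nᵀ) * (A - 1)ᵀ = P := by
    calc (A - 1) * (N * P * Nᵀ) * (A - 1)ᵀ = ((A - 1) * N) * P * ((A - 1) * N)ᵀ := by
          simp only [transpose_mul, Matrix.mul_assoc]
      _ = P := by rw [hN1]; simp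
  rw [e, hst] at h
  ext i j
  have := congrFun (congrFun h i) j
  simp only [Matrix.smul_apply, Matrix.neg_apply, smul_eq_mul] at this ⊢
  linarith

theorem IsHurwitz.exists_lyapunov_posDef {A : Matrix ν ν ℝ} (hA : IsHurwitz A)
    {W : Matrix ν ν ℝ} (hW : W.PosDef) :
    ∃ P : Matrix ν ν ℝ, P.PosDef ∧ A * P + P * Aᵀ = -W := by
  obtain ⟨P, hP, h⟩ := hA.exists_lyapunov hW.posSemidef
  have hPr := posSemidef_iff_real.1 hP
  refine ⟨P, posDef_iff_real.2 ⟨hPr.1, fun x hx => (hPr.2 x).lt_of_ne fun h0 => ?_⟩, h⟩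
  have h1 := mulVec_eq_zero_of_posSemidef hP h0.symm
  have h2 : x ⬝ᵥ (A * P + P * Aᵀ) *ᵥ x = 0 := by
    rw [add_mulVec, dotProduct_add, ← mulVec_mulVec, ← mulVec_mulVec, h1, dotProduct_mulVec x P,
      ← mulVec_transpose, hPr.1, h1]
    simp
  rw [h, neg_mulVec, dotProduct_neg] at h2
  have := (posDef_iff_real.1 hW).2 x hx
  linarith

/-- Comparison principle for the Lyapunov operator of a Hurwitz matrix. -/
theorem IsHurwitz.dotProduct_nonpos {A : Matrix ν ν ℝ} (hA : IsHurwitz A) {X : Matrix ν ν ℝ}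
    (h : ∀ x, 0 ≤ x ⬝ᵥ (A * X + X * Aᵀ) *ᵥ x) (x : ν → ℝ) : x ⬝ᵥ X *ᵥ x ≤ 0 := by
  obtain ⟨T, N, hN1, hN2, hTA, hT⟩ := hA.exists_cayley
  set Y := (A - 1) * X * (A - 1)ᵀ with hY
  have hmono : ∀ y, y ⬝ᵥ Y *ᵥ y ≤ (Tᵀ *ᵥ y) ⬝ᵥ Y *ᵥ (Tᵀ *ᵥ y) := fun y => by
    have h1 := congrArg (fun M : Matrix ν ν ℝ => y ⬝ᵥ M *ᵥ y) (cayley_identity hTA X)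
    simp only [sub_mulVec, dotProduct_sub, smul_mulVec, dotProduct_smul, smul_eq_mul] at h1
    rw [dotProduct_conj_mulVec T] at h1
    have := h y
    linarith
  have hpow : ∀ (k : ℕ) y,
      y ⬝ᵥ Y *ᵥ y ≤ (((T ^ k)ᵀ) *ᵥ y) ⬝ᵥ Y *ᵥ ((T ^ k)ᵀ *ᵥ y) := by
    intro k
    induction k with
    | zero => intro y; simp
    | succ k ih =>
      intro y
      refine (ih y).trans ((hmono _).trans_eq ?_)
      rw [mulVec_mulVec, ← transpose_mul, ← pow_succ]
  have hlim : ∀ y, Tendsto (fun k : ℕ => ((T ^ k)ᵀ *ᵥ y) ⬝ᵥ Y *ᵥ ((T ^ k)ᵀ *ᵥ y)) atTop (𝓝 0) := by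
    intro y
    have h1 : Tendsto (fun k : ℕ => (T ^ k)ᵀ *ᵥ y) atTop (𝓝 0) := by
      refine tendsto_pi_nhds.2 fun i => ?_
      simp only [mulVec, dotProduct, transpose_apply]
      have := tendsto_finsetSum (Finset.univ : Finset ν) fun j _ =>
        (tendsto_pow_entry hT j i).mul_const (y j)
      simpa using this
    have hc : Continuous fun v : ν → ℝ => v ⬝ᵥ Y *ᵥ v := by fun_prop
    have := (hc.tendsto 0).comp h1
    simp only [mulVec_zero, dotProduct_zero] at this
    exact this
  have hYn : ∀ y, y ⬝ᵥ Y *ᵥ y ≤ 0 := fun y => ge_of_tendsto' (hlim y) fun k => hpow k y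
  have hx := hYn (Nᵀ *ᵥ x)
  rw [hY, dotProduct_conj_mulVec, mulVec_mulVec, ← transpose_mul, hN2] at hx
  simpa using hx

omit [DecidableEq ν] in
theorem dotProduct_lyapunov (A : Matrix ν ν ℝ) {P : Matrix ν ν ℝ} (hP : Pᵀ = P) (x : ν → ℝ) :
    x ⬝ᵥ (A * P + P * Aᵀ) *ᵥ x = 2 * ((Aᵀ *ᵥ x) ⬝ᵥ P *ᵥ x) := by
  rw [add_mulVec, dotProduct_add, ← mulVec_mulVec, ← mulVec_mulVec, dotProduct_mulVec x A,
    ← mulVec_transpose, two_mul, ← dotProduct_transpose_mulVec P x, hP]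

/-- Lyapunov's criterion. -/
theorem isHurwitz_of_lyapunov {A P : Matrix ν ν ℝ} (hP : P.PosDef)
    (h : ∀ x, x ≠ 0 → x ⬝ᵥ (A * P + P * Aᵀ) *ᵥ x < 0) : IsHurwitz A := by
  intro z hz
  obtain ⟨v, hv, hvz⟩ := mem_eigenvalues_iff_vecMul.1 hz
  rw [posDef_iff_real] at hP
  have hP2 : ∀ x, 0 ≤ x ⬝ᵥ P *ᵥ x := fun x => by
    rcases eq_or_ne x 0 with rfl | hx
    · simp
    · exact (hP.2 x hx).le
  have h2 : ∀ x, x ⬝ᵥ (A * P + P * Aᵀ) *ᵥ x ≤ 0 := fun x => by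
    rcases eq_or_ne x 0 with rfl | hx
    · simp
    · exact (h x hx).le
  simp only [dotProduct_lyapunov A hP.1] at h h2
  -- the real and imaginary parts of a left eigenvector
  set a : ν → ℝ := fun i => (v i).re with ha
  set b : ν → ℝ := fun i => (v i).im with hb
  have ha' : Aᵀ *ᵥ a = z.re • a - z.im • b := by
    ext i
    have := congrArg Complex.re (congrFun hvz i)
    rw [mulVec_transpose]
    simpa [vecMul, dotProduct, ha, hb] using this
  have hb' : Aᵀ *ᵥ b = z.re • b + z.im • a := by
    ext i
    have := congrArg Complex.im (congrFun hvz i)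
    rw [mulVec_transpose]
    simpa [vecMul, dotProduct, ha, hb] using this
  have hab : b ⬝ᵥ P *ᵥ a = a ⬝ᵥ P *ᵥ b := by
    rw [← dotProduct_transpose_mulVec, hP.1]
  have hsum : (Aᵀ *ᵥ a) ⬝ᵥ P *ᵥ a + (Aᵀ *ᵥ b) ⬝ᵥ P *ᵥ b =
      z.re * (a ⬝ᵥ P *ᵥ a + b ⬝ᵥ P *ᵥ b) := by
    rw [ha', hb', sub_dotProduct, add_dotProduct, smul_dotProduct, smul_dotProduct,
      smul_dotProduct, smul_dotProduct, hab]
    simp only [smul_eq_mul]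
    ring
  have hne : a ≠ 0 ∨ b ≠ 0 := by
    by_contra! hcon
    exact hv (funext fun i => Complex.ext (congrFun hcon.1 i) (congrFun hcon.2 i))
  have h1 : (Aᵀ *ᵥ a) ⬝ᵥ P *ᵥ a + (Aᵀ *ᵥ b) ⬝ᵥ P *ᵥ b < 0 := by
    have := h2 a
    have := h2 b
    rcases hne with hne | hne <;> have := h _ hne <;> linarith
  rw [hsum] at h1
  by_contra! hcon
  have := mul_nonneg hcon (add_nonneg (hP2 a) (hP2 b))
  linarith

end Lyapunov

/-! ### Convergence of perturbed linear differential equations -/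

section ODE

variable {ν μ : Type} [Fintype ν] [Fintype μ]

theorem hasDerivAt_mulVec (M : Matrix μ ν ℝ) {x : ℝ → ν → ℝ} {x' : ν → ℝ} {t : ℝ}
    (h : HasDerivAt x x' t) : HasDerivAt (fun s => M *ᵥ x s) (M *ᵥ x') t := by
  classical
  exact (LinearMap.toContinuousLinearMap M.mulVecLin).hasFDerivAt.comp_hasDerivAt t h

theorem hasDerivAt_dotProduct {x y : ℝ → ν → ℝ} {x' y' : ν → ℝ} {t : ℝ}
    (hx : HasDerivAt x x' t) (hy : HasDerivAt y y' t) :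
    HasDerivAt (fun s => x s ⬝ᵥ y s) (x' ⬝ᵥ y t + x t ⬝ᵥ y') t := by
  have := HasDerivAt.fun_sum fun (i : ν) (_ : i ∈ Finset.univ) =>
    (hasDerivAt_pi.1 hx i).mul (hasDerivAt_pi.1 hy i)
  simpa [dotProduct, Finset.sum_add_distrib] using this

omit [Fintype μ] in
theorem tendsto_mulVec_zero (M : Matrix μ ν ℝ) {x : ℝ → ν → ℝ} {l : Filter ℝ}
    (h : Tendsto x l (𝓝 0)) : Tendsto (fun t => M *ᵥ x t) l (𝓝 0) := by
  have hc : Continuous fun v : ν → ℝ => M *ᵥ v := by fun_prop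
  have := (hc.tendsto 0).comp h
  rw [mulVec_zero] at this
  exact this

/-- A nonnegative function with `V' ≤ -κ V + g`, where `g → 0`, tends to `0`. -/
theorem tendsto_zero_of_deriv_le {V V' g : ℝ → ℝ} {T κ : ℝ} (hκ : 0 < κ)
    (hV : ∀ t, 0 ≤ V t) (hd : ∀ t > T, HasDerivAt V (V' t) t)
    (hle : ∀ t > T, V' t ≤ -κ * V t + g t) (hg : Tendsto g atTop (𝓝 0)) :
    Tendsto V atTop (𝓝 0) := by
  rw [Metric.tendsto_atTop]
  intro η hη
  obtain ⟨T₁, hT₁⟩ := (hg.eventually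
    (gt_mem_nhds (show 0 < κ * (η / 2) by positivity))).exists_forall_of_atTop
  set T₂ := max T₁ (T + 1)
  -- the weighted excess of `V` over `η / 2` decreases
  set U : ℝ → ℝ := fun t => (V t - η / 2) * Real.exp (κ * t) with hU
  have hUd : ∀ t > T, HasDerivAt U
      (V' t * Real.exp (κ * t) + (V t - η / 2) * (Real.exp (κ * t) * κ)) t := fun t ht => by
    have h1 : HasDerivAt (fun s => κ * s) κ t := by simpa using (hasDerivAt_id t).const_mul κ
    exact ((hd t ht).sub_const _).mul h1.exp
  have hanti : AntitoneOn U (Set.Ici T₂) := by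
    have hT₂ : ∀ t ∈ Set.Ici T₂, T < t := fun t ht => by
      have : T + 1 ≤ t := (le_max_right _ _).trans ht
      linarith
    refine antitoneOn_of_deriv_nonpos (convex_Ici _)
      (fun t ht => (hUd t (hT₂ t ht)).continuousAt.continuousWithinAt)
      (fun t ht => (hUd t (hT₂ t (interior_subset ht))).differentiableAt.differentiableWithinAt)
      fun t ht => ?_
    have ht' := interior_subset ht
    rw [(hUd t (hT₂ t ht')).deriv]
    have h1 := hle t (hT₂ t ht')
    have h2 := hT₁ t ((le_max_left _ _).trans ht')
    have h3 := Real.exp_pos (κ * t)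
    nlinarith
  have hexp : Tendsto (fun t => U T₂ * Real.exp (-(κ * t))) atTop (𝓝 0) := by
    have h1 : Tendsto (fun t : ℝ => κ * t) atTop atTop := tendsto_id.const_mul_atTop hκ
    simpa using (Real.tendsto_exp_neg_atTop_nhds_zero.comp h1).const_mul (U T₂)
  obtain ⟨T₃, hT₃⟩ :=
    (hexp.eventually (gt_mem_nhds (half_pos hη))).exists_forall_of_atTop
  refine ⟨max T₂ T₃, fun t ht => ?_⟩
  have h1 : U t ≤ U T₂ := hanti (Set.self_mem_Ici) ((le_max_left _ _).trans ht)
    ((le_max_left _ _).trans ht)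
  have h2 := hT₃ t ((le_max_right _ _).trans ht)
  have h3 : U t * Real.exp (-(κ * t)) = V t - η / 2 := by
    rw [hU]
    simp only
    rw [mul_assoc, ← Real.exp_add]
    simp
  have h4 := mul_le_mul_of_nonneg_right h1 (Real.exp_pos (-(κ * t))).le
  rw [Real.dist_eq, sub_zero, abs_of_nonneg (hV t)]
  linarith

/-- The solutions of `x' = A x + d` with `A` Hurwitz and `d → 0` tend to `0`. -/
theorem IsHurwitz.tendsto_zero [DecidableEq ν] {A : Matrix ν ν ℝ} (hA : IsHurwitz A)
    {x d : ℝ → ν → ℝ} {T : ℝ} (hx : ∀ t > T, HasDerivAt x (A *ᵥ x t + d t) t)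
    (hd : Tendsto d atTop (𝓝 0)) : Tendsto x atTop (𝓝 0) := by
  obtain ⟨P, hP, hlyap⟩ := hA.transpose.exists_lyapunov_posDef (PosDef.one (n := ν) (R := ℝ))
  have hPr := posDef_iff_real.1 hP
  have hP2 : ∀ y, 0 ≤ y ⬝ᵥ P *ᵥ y := (posSemidef_iff_real.1 hP.posSemidef).2
  set c := ∑ i, ∑ j, |P i j| with hc
  have hc0 : 0 ≤ c := Finset.sum_nonneg fun _ _ => Finset.sum_nonneg fun _ _ => abs_nonneg _
  have hPle : ∀ y, y ⬝ᵥ P *ᵥ y ≤ c * (y ⬝ᵥ y) := fun y =>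
    (le_abs_self _).trans (abs_dotProduct_mulVec_le P y)
  have hAP : ∀ y : ν → ℝ, 2 * ((A *ᵥ y) ⬝ᵥ P *ᵥ y) = -(y ⬝ᵥ y) := fun y => by
    have h1 := dotProduct_lyapunov Aᵀ hPr.1 y
    rw [hlyap, transpose_transpose, neg_mulVec, one_mulVec, dotProduct_neg] at h1
    exact h1.symm
  set e : ℝ → ν → ℝ := fun t => P *ᵥ d t with he
  have he0 : Tendsto (fun t => 2 * (e t ⬝ᵥ e t)) atTop (𝓝 0) := by
    have h1 : Tendsto e atTop (𝓝 0) := tendsto_mulVec_zero P hd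
    have h2 : Continuous fun v : ν → ℝ => 2 * (v ⬝ᵥ v) := by fun_prop
    have h3 := (h2.tendsto 0).comp h1
    rw [dotProduct_zero, mul_zero] at h3
    exact h3
  have hVd : ∀ t > T, HasDerivAt (fun t => x t ⬝ᵥ P *ᵥ x t)
      (-(x t ⬝ᵥ x t) + 2 * (x t ⬝ᵥ e t)) t := fun t ht => by
    have h1 := hasDerivAt_dotProduct (hx t ht) (hasDerivAt_mulVec P (hx t ht))
    have h2 : x t ⬝ᵥ P *ᵥ (A *ᵥ x t + d t) = (A *ᵥ x t + d t) ⬝ᵥ P *ᵥ x t := by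
      rw [← dotProduct_transpose_mulVec, hPr.1]
    have h3 : d t ⬝ᵥ P *ᵥ x t = x t ⬝ᵥ e t := by
      rw [he, ← dotProduct_transpose_mulVec, hPr.1]
    rw [h2, add_dotProduct, h3, ← two_mul, mul_add, hAP] at h1
    exact h1
  have hV0 : Tendsto (fun t => x t ⬝ᵥ P *ᵥ x t) atTop (𝓝 0) := by
    refine tendsto_zero_of_deriv_le (κ := 1 / (2 * (c + 1))) (by positivity)
      (fun t => hP2 _) hVd (fun t _ => ?_) he0
    have h1 : 0 ≤ (x t - (2 : ℝ) • e t) ⬝ᵥ (x t - (2 : ℝ) • e t) := dotProduct_self_nonneg' _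
    have h2 : (x t - (2 : ℝ) • e t) ⬝ᵥ (x t - (2 : ℝ) • e t) =
        x t ⬝ᵥ x t - 4 * (x t ⬝ᵥ e t) + 4 * (e t ⬝ᵥ e t) := by
      simp only [sub_dotProduct, dotProduct_sub, smul_dotProduct, dotProduct_smul, smul_eq_mul,
        dotProduct_comm (e t) (x t)]
      ring
    have h3 : 1 / (2 * (c + 1)) * (x t ⬝ᵥ P *ᵥ x t) ≤ (x t ⬝ᵥ x t) / 2 := by
      have h4 := hPle (x t)
      have h5 := dotProduct_self_nonneg' (x t)
      rw [div_mul_eq_mul_div, one_mul, div_le_iff₀ (by positivity)]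
      nlinarith
    linarith
  obtain ⟨κ, hκ, hκP⟩ := exists_pos_mul_le_of_posDef hP
  have hsq : Tendsto (fun t => x t ⬝ᵥ x t) atTop (𝓝 0) := by
    refine squeeze_zero (fun t => dotProduct_self_nonneg' _)
      (fun t => (le_div_iff₀' hκ).2 (hκP (x t))) ?_
    simpa using hV0.div_const κ
  refine tendsto_pi_nhds.2 fun i => ?_
  refine squeeze_zero_norm (a := fun t => √(x t ⬝ᵥ x t)) (fun t => ?_) ?_
  · refine Real.abs_le_sqrt ?_
    rw [sq]
    exact Finset.single_le_sum (f := fun i => x t i * x t i) (fun j _ => mul_self_nonneg _)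
      (Finset.mem_univ i)
  · simpa using hsq.sqrt

end ODE

/-! ### The filter Riccati equation -/

section Riccati

variable {ν π : Type} [Fintype ν] [DecidableEq ν] [Fintype π]

/-- A large negative shift of a matrix is Hurwitz. -/
theorem exists_isHurwitz_sub_smul (A : Matrix ν ν ℝ) :
    ∃ s : ℝ, 0 < s ∧ IsHurwitz (A - s • 1) := by
  set c := ∑ i, ∑ j, |A i j| with hc
  have hc0 : 0 ≤ c := Finset.sum_nonneg fun _ _ => Finset.sum_nonneg fun _ _ => abs_nonneg _
  refine ⟨c + 1, by positivity, isHurwitz_of_lyapunov (P := 1) PosDef.one fun x hx => ?_⟩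
  have h1 := (le_abs_self _).trans (abs_dotProduct_mulVec_le A x)
  have h2 := dotProduct_transpose_mulVec A x x
  have h3 := dotProduct_self_pos hx
  rw [Matrix.mul_one, Matrix.one_mul, add_mulVec, dotProduct_add, dotProduct_transpose_mulVec,
    sub_mulVec, dotProduct_sub, smul_mulVec, one_mulVec, dotProduct_smul, smul_eq_mul]
  nlinarith

omit [DecidableEq ν] in
theorem dotProduct_transpose_mul_self (C : Matrix π ν ℝ) (x : ν → ℝ) :
    x ⬝ᵥ (Cᵀ * C) *ᵥ x = (C *ᵥ x) ⬝ᵥ (C *ᵥ x) := by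
  rw [← mulVec_mulVec, dotProduct_transpose_mulVec]

/-- An observable pair can be stabilized by output injection. The gain is `-P⁻¹ Cᵀ`, where `P`
solves the Lyapunov equation `(A + s)ᵀ P + P (A + s) = 2 Cᵀ C` for a large `s`; observability
makes `P` definite. -/
theorem exists_isHurwitz_add_mul {A : Matrix ν ν ℝ} {C : Matrix π ν ℝ} (h : Observable A C) :
    ∃ L : Matrix ν π ℝ, IsHurwitz (A + L * C) := by
  classical
  obtain ⟨s, hs, hH⟩ := exists_isHurwitz_sub_smul (-Aᵀ)
  have hW : ((2 : ℝ) • (Cᵀ * C)).PosSemidef := by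
    refine PosSemidef.smul ?_ (by norm_num)
    refine posSemidef_iff_real.2 ⟨by simp, fun x => ?_⟩
    rw [dotProduct_transpose_mul_self]
    exact dotProduct_self_nonneg' _
  obtain ⟨P, hP, hlyap⟩ := hH.exists_lyapunov hW
  have hPr := posSemidef_iff_real.1 hP
  have e : Aᵀ * P + P * A = (2 : ℝ) • (Cᵀ * C) - (2 * s) • P := by
    have h1 : (-Aᵀ - s • (1 : Matrix ν ν ℝ)) * P + P * (-Aᵀ - s • (1 : Matrix ν ν ℝ))ᵀ =
        -(Aᵀ * P + P * A) - (2 * s) • P := by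
      simp only [transpose_sub, transpose_neg, transpose_transpose, transpose_smul, transpose_one,
        Matrix.sub_mul, Matrix.mul_sub, Matrix.neg_mul, Matrix.mul_neg, smul_mul, Matrix.one_mul,
        Matrix.mul_smul, Matrix.mul_one]
      module
    rw [h1] at hlyap
    rw [← neg_neg ((2 : ℝ) • (Cᵀ * C)), ← hlyap]
    abel
  have hker : ∀ x, P *ᵥ x = 0 → C *ᵥ x = 0 ∧ P *ᵥ (A *ᵥ x) = 0 := fun x hx => by
    have h1 := congrArg (fun M : Matrix ν ν ℝ => M *ᵥ x) e
    simp only [add_mulVec, sub_mulVec, smul_mulVec, ← mulVec_mulVec, hx, mulVec_zero, zero_add,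
      smul_zero, sub_zero] at h1
    have h2 := congrArg (fun y => x ⬝ᵥ y) h1
    simp only [dotProduct_smul, smul_eq_mul] at h2
    have h3 : x ⬝ᵥ P *ᵥ (A *ᵥ x) = 0 := by
      rw [← dotProduct_transpose_mulVec, hPr.1, hx, dotProduct_zero]
    rw [h3, dotProduct_transpose_mulVec] at h2
    have h4 : C *ᵥ x = 0 := by
      by_contra hne
      have := dotProduct_self_pos hne
      linarith
    exact ⟨h4, by rw [h1, h4]; simp⟩
  have hpow : ∀ (k : ℕ) x, P *ᵥ x = 0 → P *ᵥ (A ^ k *ᵥ x) = 0 := by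
    intro k
    induction k with
    | zero => intro x hx; simpa using hx
    | succ k ih =>
      intro x hx
      rw [pow_succ, ← mulVec_mulVec]
      exact ih _ (hker x hx).2
  have hPd : P.PosDef := by
    refine posDef_iff_real.2 ⟨hPr.1, fun x hx => (hPr.2 x).lt_of_ne fun h0 => hx (h x fun k => ?_)⟩
    rw [← mulVec_mulVec]
    exact (hker _ (hpow k x (mulVec_eq_zero_of_posSemidef hP h0.symm))).1
  have hu := (Matrix.isUnit_iff_isUnit_det _).1 hPd.isUnit
  have hPi : P⁻¹ᵀ = P⁻¹ := by rw [transpose_nonsing_inv, hPr.1]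
  refine ⟨-(P⁻¹ * Cᵀ), ?_⟩
  have h1 : IsHurwitz (Aᵀ - Cᵀ * C * P⁻¹) := by
    refine isHurwitz_of_lyapunov hPd fun x hx => ?_
    have h2 : (Aᵀ - Cᵀ * C * P⁻¹) * P + P * (Aᵀ - Cᵀ * C * P⁻¹)ᵀ = -((2 * s) • P) := by
      simp only [Matrix.sub_mul, transpose_sub, transpose_mul, transpose_transpose,
        Matrix.mul_sub, hPi]
      rw [Matrix.mul_assoc (Cᵀ * C), nonsing_inv_mul _ hu, ← Matrix.mul_assoc P,
        mul_nonsing_inv _ hu, Matrix.mul_one, Matrix.one_mul, sub_add_sub_comm, e]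
      module
    rw [h2, neg_mulVec, dotProduct_neg, smul_mulVec, dotProduct_smul, smul_eq_mul]
    have := (posDef_iff_real.1 hPd).2 x hx
    nlinarith
  have h3 := h1.transpose
  simp only [transpose_sub, transpose_mul, transpose_transpose, hPi] at h3
  rwa [Matrix.neg_mul, ← sub_eq_add_neg, Matrix.mul_assoc]

variable (β : ℝ) (A : Matrix ν ν ℝ) (C : Matrix π ν ℝ)

/-- The Riccati operator `Q ↦ A Q + Q Aᵀ - 2 β Q Cᵀ C Q + 1`. -/
def riccati (Q : Matrix ν ν ℝ) : Matrix ν ν ℝ :=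
  A * Q + Q * Aᵀ - (2 * β) • (Q * Cᵀ * C * Q) + 1

variable {β A C}

/-- Completion of squares: the Riccati operator is the minimum over the gains `L` of the
Lyapunov operators of `A + L C` with cost `1 + L Lᵀ / (2 β)`. -/
theorem lyapunov_eq_riccati_add (hβ : 0 < β) (L : Matrix ν π ℝ) {P : Matrix ν ν ℝ}
    (hP : Pᵀ = P) :
    (A + L * C) * P + P * (A + L * C)ᵀ + (1 + (2 * β)⁻¹ • (L * Lᵀ)) =
      riccati β A C P +
        (2 * β)⁻¹ • ((L + (2 * β) • (P * Cᵀ)) * (L + (2 * β) • (P * Cᵀ))ᵀ) := by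
  have h2 : 2 * β ≠ 0 := by positivity
  have e : (2 * β)⁻¹ • ((L + (2 * β) • (P * Cᵀ)) * (L + (2 * β) • (P * Cᵀ))ᵀ) =
      (2 * β)⁻¹ • (L * Lᵀ) + L * C * P + P * Cᵀ * Lᵀ + (2 * β) • (P * Cᵀ * C * P) := by
    simp only [transpose_add, transpose_smul, transpose_mul, transpose_transpose, hP,
      Matrix.add_mul, Matrix.mul_add, smul_mul, Matrix.mul_smul, smul_add, Matrix.mul_assoc]
    simp only [smul_smul, inv_mul_cancel₀ h2, one_smul, ← mul_assoc, one_mul]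
    abel
  rw [e, riccati]
  simp only [transpose_add, transpose_mul, Matrix.add_mul, Matrix.mul_add, Matrix.mul_assoc]
  abel

omit [DecidableEq ν] in
theorem dotProduct_smul_mul_transpose_nonneg {c : ℝ} (hc : 0 ≤ c) (N : Matrix ν π ℝ)
    (x : ν → ℝ) : 0 ≤ x ⬝ᵥ (c • (N * Nᵀ)) *ᵥ x := by
  rw [smul_mulVec, dotProduct_smul, smul_eq_mul]
  refine mul_nonneg hc ?_
  have := dotProduct_transpose_mul_self Nᵀ x
  rw [transpose_transpose] at this
  rw [this]
  exact dotProduct_self_nonneg' _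

/-- Every supersolution for a stabilizing gain is an upper bound for the solutions of the Riccati
equation. -/
theorem riccati_le (hβ : 0 < β) {L : Matrix ν π ℝ} (hL : IsHurwitz (A + L * C))
    {P Q : Matrix ν ν ℝ}
    (hP : ∀ x, x ⬝ᵥ ((A + L * C) * P + P * (A + L * C)ᵀ +
      (1 + (2 * β)⁻¹ • (L * Lᵀ))) *ᵥ x ≤ 0)
    (hQ : Qᵀ = Q) (hric : riccati β A C Q = 0) (x : ν → ℝ) :
    x ⬝ᵥ Q *ᵥ x ≤ x ⬝ᵥ P *ᵥ x := by
  have h := hL.dotProduct_nonpos (X := Q - P) (fun y => ?_) x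
  · rw [sub_mulVec, dotProduct_sub] at h
    linarith
  have h1 := lyapunov_eq_riccati_add (A := A) (C := C) hβ L hQ
  rw [hric, zero_add] at h1
  have h2 := dotProduct_smul_mul_transpose_nonneg (c := (2 * β)⁻¹) (by positivity)
    (L + (2 * β) • (Q * Cᵀ)) y
  rw [← h1] at h2
  have h3 := hP y
  have h4 : (A + L * C) * (Q - P) + (Q - P) * (A + L * C)ᵀ =
      ((A + L * C) * Q + Q * (A + L * C)ᵀ + (1 + (2 * β)⁻¹ • (L * Lᵀ))) -
      ((A + L * C) * P + P * (A + L * C)ᵀ + (1 + (2 * β)⁻¹ • (L * Lᵀ))) := by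
    noncomm_ring
  rw [h4, sub_mulVec, dotProduct_sub]
  linarith

theorem posDef_of_riccati_nonpos {P : Matrix ν ν ℝ} (hP : P.PosSemidef)
    (h : ∀ x, x ⬝ᵥ riccati β A C P *ᵥ x ≤ 0) : P.PosDef := by
  have hPr := posSemidef_iff_real.1 hP
  refine posDef_iff_real.2 ⟨hPr.1, fun x hx => (hPr.2 x).lt_of_ne fun h0 => ?_⟩
  have h1 := mulVec_eq_zero_of_posSemidef hP h0.symm
  have h2 := h x
  have h3 : x ᵥ* P = 0 := by rw [← mulVec_transpose, hPr.1, h1]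
  simp only [riccati, add_mulVec, sub_mulVec, smul_mulVec, ← mulVec_mulVec, h1, mulVec_zero,
    smul_zero, sub_zero, zero_add, one_mulVec, dotProduct_add, dotProduct_mulVec x P, h3,
    zero_dotProduct] at h2
  have := dotProduct_self_pos hx
  linarith

/-- The gain `-l Q Cᵀ` of a supersolution of the Riccati equation is stabilizing for every `l ≥ β`,
with a margin against perturbations `E` of the system matrix. -/
theorem isHurwitz_sub_of_riccati {Q : Matrix ν ν ℝ} (hQ : Q.PosDef)
    (h : ∀ x, x ⬝ᵥ riccati β A C Q *ᵥ x ≤ 0) {l : ℝ} (hl : β ≤ l) (E : Matrix ν ν ℝ)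
    (hE : ∀ x, x ≠ 0 → x ⬝ᵥ (E * Q + Q * Eᵀ) *ᵥ x < x ⬝ᵥ x) :
    IsHurwitz (A + E - l • (Q * Cᵀ * C)) := by
  refine isHurwitz_of_lyapunov hQ fun x hx => ?_
  have hQ' := (posDef_iff_real.1 hQ).1
  have e : (A + E - l • (Q * Cᵀ * C)) * Q + Q * (A + E - l • (Q * Cᵀ * C))ᵀ =
      riccati β A C Q - 1 + (E * Q + Q * Eᵀ) - (2 * (l - β)) • ((Q * Cᵀ) * (Q * Cᵀ)ᵀ) := by
    simp only [riccati, transpose_sub, transpose_add, transpose_smul, transpose_mul,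
      transpose_transpose, hQ', Matrix.add_mul, Matrix.sub_mul, Matrix.mul_add, Matrix.mul_sub,
      smul_mul, Matrix.mul_smul, Matrix.mul_assoc]
    module
  rw [e]
  simp only [add_mulVec, sub_mulVec, dotProduct_add, dotProduct_sub, one_mulVec]
  have h1 := dotProduct_smul_mul_transpose_nonneg (c := 2 * (l - β)) (by linarith) (Q * Cᵀ) x
  have h2 := h x
  have h3 := hE x hx
  rw [add_mulVec, dotProduct_add] at h3
  linarith

theorem isHurwitz_sub_of_riccati' {Q : Matrix ν ν ℝ} (hQ : Q.PosDef)
    (h : ∀ x, x ⬝ᵥ riccati β A C Q *ᵥ x ≤ 0) {l : ℝ} (hl : β ≤ l) :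
    IsHurwitz (A - l • (Q * Cᵀ * C)) := by
  have := isHurwitz_sub_of_riccati hQ h hl 0 fun x hx => by simpa using dotProduct_self_pos hx
  rwa [add_zero] at this

/-- One Newton step decreases a supersolution, strictly unless it solves the Riccati equation. -/
theorem exists_newton_step (hβ : 0 < β) {P : Matrix ν ν ℝ} (hP : P.PosSemidef)
    (h : ∀ x, x ⬝ᵥ riccati β A C P *ᵥ x ≤ 0) :
    ∃ P' : Matrix ν ν ℝ, P'.PosSemidef ∧ (∀ x, x ⬝ᵥ riccati β A C P' *ᵥ x ≤ 0) ∧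
      (P - P').PosSemidef ∧ (P' = P → riccati β A C P = 0) := by
  have hPr := posSemidef_iff_real.1 hP
  have hPd := posDef_of_riccati_nonpos hP h
  set L : Matrix ν π ℝ := -((2 * β) • (P * Cᵀ)) with hL
  have hM : IsHurwitz (A + L * C) := by
    have := isHurwitz_sub_of_riccati' hPd h (l := 2 * β) (by linarith)
    rwa [sub_eq_add_neg, ← smul_mul, ← Matrix.neg_mul, ← hL] at this
  have hW : (1 + (2 * β)⁻¹ • (L * Lᵀ)).PosSemidef := by
    refine posSemidef_iff_real.2 ⟨by simp, fun x => ?_⟩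
    have := dotProduct_smul_mul_transpose_nonneg (c := (2 * β)⁻¹) (by positivity) L x
    rw [add_mulVec, dotProduct_add, one_mulVec]
    have := dotProduct_self_nonneg' x
    linarith
  obtain ⟨P', hP', hlyap⟩ := hM.exists_lyapunov hW
  have hPr' := posSemidef_iff_real.1 hP'
  have e1 := lyapunov_eq_riccati_add (A := A) (C := C) hβ L hPr.1
  have e2 := lyapunov_eq_riccati_add (A := A) (C := C) hβ L hPr'.1
  have e3 : L + (2 * β) • (P * Cᵀ) = 0 := by rw [hL]; simp
  rw [e3, Matrix.zero_mul, smul_zero, add_zero] at e1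
  rw [hlyap, neg_add_cancel] at e2
  refine ⟨P', hP', fun x => ?_, posSemidef_iff_real.2 ⟨?_, fun x => ?_⟩, fun heq => ?_⟩
  · have h1 := dotProduct_smul_mul_transpose_nonneg (c := (2 * β)⁻¹) (by positivity)
      (L + (2 * β) • (P' * Cᵀ)) x
    have h2 := congrArg (fun M : Matrix ν ν ℝ => x ⬝ᵥ M *ᵥ x) e2
    simp only [zero_mulVec, dotProduct_zero, add_mulVec (riccati β A C P'), dotProduct_add] at h2
    linarith
  · rw [transpose_sub, hPr.1, hPr'.1]
  · have h1 := hM.dotProduct_nonpos (X := P' - P) (fun y => ?_) x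
    · rw [sub_mulVec, dotProduct_sub] at h1 ⊢
      linarith
    have e4 : (A + L * C) * (P' - P) + (P' - P) * (A + L * C)ᵀ = -riccati β A C P := by
      rw [← e1, Matrix.mul_sub, Matrix.sub_mul, sub_add_sub_comm, hlyap]
      abel
    rw [e4, neg_mulVec, dotProduct_neg]
    have := h y
    linarith
  · rw [← e1, ← heq, hlyap, neg_add_cancel]

omit [DecidableEq ν] in
theorem abs_le_trace_of_posSemidef {P : Matrix ν ν ℝ} (hP : P.PosSemidef) (i j : ν) :
    |P i j| ≤ P.trace := by
  classical
  have hPr := posSemidef_iff_real.1 hP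
  have hd : ∀ i, 0 ≤ P i i := fun i => hP.diag_nonneg
  have hle : ∀ i, P i i ≤ P.trace := fun i =>
    Finset.single_le_sum (f := fun i => P i i) (fun i _ => hd i) (Finset.mem_univ i)
  have hs : P j i = P i j := congrFun (congrFun hPr.1 i) j
  have h1 := hPr.2 (Pi.single i 1 + Pi.single j 1)
  have h2 := hPr.2 (Pi.single i 1 - Pi.single j 1)
  simp only [mulVec_add, mulVec_sub, mulVec_single_one, add_dotProduct, sub_dotProduct,
    single_one_dotProduct, Pi.add_apply, Pi.sub_apply, col_apply, hs] at h1 h2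
  have := hle i
  have := hle j
  rw [abs_le]
  constructor <;> linarith

/-- A detectable pair admits a positive definite solution of the Riccati equation: a supersolution
of least trace exists by compactness, and it is fixed by the Newton step. -/
theorem exists_riccati (hβ : 0 < β) (hdet : ∃ L : Matrix ν π ℝ, IsHurwitz (A + L * C)) :
    ∃ Q : Matrix ν ν ℝ, Q.PosDef ∧ riccati β A C Q = 0 := by
  obtain ⟨L, hL⟩ := hdet
  have hW : (1 + (2 * β)⁻¹ • (L * Lᵀ)).PosSemidef := by
    refine posSemidef_iff_real.2 ⟨by simp, fun x => ?_⟩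
    have := dotProduct_smul_mul_transpose_nonneg (c := (2 * β)⁻¹) (by positivity) L x
    rw [add_mulVec, dotProduct_add, one_mulVec]
    have := dotProduct_self_nonneg' x
    linarith
  obtain ⟨P₀, hP₀, hlyap⟩ := hL.exists_lyapunov hW
  have hsub₀ : ∀ x, x ⬝ᵥ riccati β A C P₀ *ᵥ x ≤ 0 := fun x => by
    have e := lyapunov_eq_riccati_add (A := A) (C := C) hβ L (posSemidef_iff_real.1 hP₀).1
    rw [hlyap, neg_add_cancel] at e
    have h1 := dotProduct_smul_mul_transpose_nonneg (c := (2 * β)⁻¹) (by positivity)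
      (L + (2 * β) • (P₀ * Cᵀ)) x
    have h2 := congrArg (fun M : Matrix ν ν ℝ => x ⬝ᵥ M *ᵥ x) e
    simp only [zero_mulVec, dotProduct_zero, add_mulVec (riccati β A C P₀), dotProduct_add] at h2
    linarith
  set s : Set (Matrix ν ν ℝ) := {P | (Pᵀ = P ∧ ∀ x, 0 ≤ x ⬝ᵥ P *ᵥ x) ∧
    (∀ x, x ⬝ᵥ riccati β A C P *ᵥ x ≤ 0) ∧ P.trace ≤ P₀.trace} with hs
  have hclosed : IsClosed s := by
    have hc : Continuous (riccati β A C) := by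
      unfold riccati
      fun_prop
    have h1 : IsClosed {P : Matrix ν ν ℝ | Pᵀ = P} := isClosed_eq (by fun_prop) continuous_id
    have h2 : IsClosed {P : Matrix ν ν ℝ | ∀ x, 0 ≤ x ⬝ᵥ P *ᵥ x} := by
      simp only [Set.ofPred_forall]
      exact isClosed_iInter fun x => isClosed_le continuous_const (by fun_prop)
    have h3 : IsClosed {P : Matrix ν ν ℝ | ∀ x, x ⬝ᵥ riccati β A C P *ᵥ x ≤ 0} := by
      simp only [Set.ofPred_forall]
      exact isClosed_iInter fun x => isClosed_le (by fun_prop) continuous_const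
    have h4 : IsClosed {P : Matrix ν ν ℝ | P.trace ≤ P₀.trace} :=
      isClosed_le (continuous_id.matrix_trace) continuous_const
    exact (h1.inter h2).inter (h3.inter h4)
  have hcomp : IsCompact s := by
    refine IsCompact.of_isClosed_subset (isCompact_univ_pi fun _ : ν =>
      isCompact_univ_pi fun _ : ν => isCompact_Icc (a := -P₀.trace) (b := P₀.trace)) hclosed ?_
    intro P hP i _ j _
    exact abs_le.1 ((abs_le_trace_of_posSemidef (posSemidef_iff_real.2 hP.1) i j).trans hP.2.2)
  obtain ⟨Q, hQ, hmin⟩ := hcomp.exists_isMinOn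
    ⟨P₀, posSemidef_iff_real.1 hP₀, hsub₀, le_rfl⟩ (f := trace)
    continuous_id.matrix_trace.continuousOn
  have hQs := posSemidef_iff_real.2 hQ.1
  obtain ⟨Q', hQ', hsub', hle, heq⟩ := exists_newton_step hβ hQs hQ.2.1
  refine ⟨Q, posDef_of_riccati_nonpos hQs hQ.2.1, heq ?_⟩
  have h1 : Q'.trace ≤ Q.trace := by
    have := hle.trace_nonneg
    rw [trace_sub] at this
    linarith
  have h2 : Q.trace ≤ Q'.trace :=
    hmin ⟨posSemidef_iff_real.1 hQ', hsub', h1.trans hQ.2.2⟩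
  have h3 : Q - Q' = 0 := hle.trace_eq_zero_iff.1 (by rw [trace_sub]; linarith)
  exact (sub_eq_zero.1 h3).symm

/-- Two positive definite solutions bound each other, by the comparison principle for the Hurwitz
matrix `A - 2 β P Cᵀ C`. -/
theorem riccati_unique (hβ : 0 < β) {P Q : Matrix ν ν ℝ} (hP : P.PosDef) (hQ : Q.PosDef)
    (hPr : riccati β A C P = 0) (hQr : riccati β A C Q = 0) : Q = P := by
  have key : ∀ {P Q : Matrix ν ν ℝ}, P.PosDef → Q.PosDef → riccati β A C P = 0 →
      riccati β A C Q = 0 → ∀ x, x ⬝ᵥ Q *ᵥ x ≤ x ⬝ᵥ P *ᵥ x := by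
    intro P Q hP hQ hPr hQr
    have hM := isHurwitz_sub_of_riccati' hP (fun x => by rw [hPr]; simp) (l := 2 * β)
      (by linarith)
    rw [sub_eq_add_neg, ← smul_mul, ← Matrix.neg_mul] at hM
    refine riccati_le hβ hM (fun x => ?_) (posDef_iff_real.1 hQ).1 hQr
    rw [lyapunov_eq_riccati_add hβ _ (posDef_iff_real.1 hP).1, hPr, neg_add_cancel]
    simp
  refine sub_eq_zero.1 (eq_zero_of_forall_dotProduct ?_ fun x => ?_)
  · rw [transpose_sub, (posDef_iff_real.1 hP).1, (posDef_iff_real.1 hQ).1]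
  · rw [sub_mulVec, dotProduct_sub]
    have := key hP hQ hPr hQr x
    have := key hQ hP hQr hPr x
    linarith

end Riccati

/-! ### Synchronization by observers and output regulation -/

section Cascade

variable {M p : ℕ} {S : MAS M p}

/-- The protocol of agent `f` is an observer-based output regulator for the error
`y_f - y_root`. With `φ = Φ₁ x_f + Φ₀ x_root`, the protocol state estimates `φ`: it copies the
dynamics `φ' = N φ + Φ₁ B u` and injects the difference of the network signals with the gain
`Bc`. The input `u = Cc φ` makes `v = E₁ x_f + E₀ x_root` obey the Hurwitz dynamics
`v' = As v`. The error is `H φ`, and also `Cs v`, up to terms that vanish along the trajectories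
of the root. -/
structure RegulatingObserver (S : MAS M p) (β : ℝ) (f : Fin M) {σ : Type} [Fintype σ]
    [DecidableEq σ] (Ac : Matrix σ σ ℝ) (Bc : Matrix σ (Fin p) ℝ)
    (Cc : Matrix (Fin (S.m f.succ)) σ ℝ) (H : Matrix (Fin p) σ ℝ) where
  N : Matrix σ σ ℝ
  Φ₁ : Matrix σ (Fin (S.n f.succ)) ℝ
  Φ₀ : Matrix σ (Fin (S.n 0)) ℝ
  k : ℕ
  E₁ : Matrix (Fin k) (Fin (S.n f.succ)) ℝ
  E₀ : Matrix (Fin k) (Fin (S.n 0)) ℝ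
  As : Matrix (Fin k) (Fin k) ℝ
  Cs : Matrix (Fin p) (Fin k) ℝ
  Ac_eq : Ac = N + Φ₁ * S.B f.succ * Cc
  N_mul_Φ₁ : N * Φ₁ = Φ₁ * S.A f.succ
  N_mul_Φ₀ : N * Φ₀ = Φ₀ * S.A 0
  H_mul_Φ₁ : H * Φ₁ = S.C f.succ
  H_mul_Φ₀ : ∀ x : ℝ → Fin (S.n 0) → ℝ, (∀ t > 0, HasDerivAt x (S.A 0 *ᵥ x t) t) →
    Tendsto (fun t => (H * Φ₀ + S.C 0) *ᵥ x t) atTop (𝓝 0)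
  isHurwitz_observer : ∀ l, β ≤ l → IsHurwitz (N - l • (Bc * H))
  As_mul_E₁ : As * E₁ = E₁ * (S.A f.succ + S.B f.succ * Cc * Φ₁)
  As_mul_E₀ : As * E₀ = E₁ * S.B f.succ * Cc * Φ₀ + E₀ * S.A 0
  Cs_mul_E₁ : Cs * E₁ = S.C f.succ
  Cs_mul_E₀ : ∀ x : ℝ → Fin (S.n 0) → ℝ, (∀ t > 0, HasDerivAt x (S.A 0 *ᵥ x t) t) →
    Tendsto (fun t => (Cs * E₀ + S.C 0) *ᵥ x t) atTop (𝓝 0)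
  isHurwitz_As : IsHurwitz As

/-- In a tree, an agent hears only its parent. -/
theorem MemG.networkSignal_eq {β : ℝ} {a τ : Matrix (Fin (M + 1)) (Fin (M + 1)) ℝ}
    (h : MemG β a) {i j : Fin (M + 1)} (hij : 0 < a i j) (v : Fin (M + 1) → ℝ → Fin p → ℝ)
    (t : ℝ) : networkSignal a τ v i t = a i j • (v i t - v j (t - τ i j)) := by
  have hi : i ≠ 0 := fun h0 => h.tree.root j (h0 ▸ hij)
  obtain ⟨_, _, huniq⟩ := h.tree.parent i hi
  refine Finset.sum_eq_single j (fun k _ hk => ?_) (fun hj => absurd (Finset.mem_univ j) hj)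
  have : a i k = 0 := le_antisymm (not_lt.1 fun hlt => hk ((huniq k hlt).trans (huniq j hij).symm))
    (h.nonneg i k)
  rw [this, zero_smul]

theorem MemG.le_weight {β : ℝ} {a : Matrix (Fin (M + 1)) (Fin (M + 1)) ℝ} (h : MemG β a)
    {i j : Fin (M + 1)} (hij : 0 < a i j) : β ≤ a i j := by
  have hi : i ≠ 0 := fun h0 => h.tree.root j (h0 ▸ hij)
  obtain ⟨_, _, huniq⟩ := h.tree.parent i hi
  have h1 := h.diag i hi
  rw [laplacian, of_apply, if_pos rfl, Finset.sum_eq_single j] at h1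
  · exact h1
  · exact fun k _ hk => le_antisymm
      (not_lt.1 fun hlt => hk ((huniq k hlt).trans (huniq j hij).symm)) (h.nonneg i k)
  · exact fun hj => absurd (Finset.mem_univ j) hj

theorem IsSpanningTree.exists_isPathDelay {a : Matrix (Fin (M + 1)) (Fin (M + 1)) ℝ}
    (h : IsSpanningTree a) (τ : Matrix (Fin (M + 1)) (Fin (M + 1)) ℝ) (i : Fin (M + 1)) :
    ∃ T, IsPathDelay a τ i T := by
  induction h.reach i with
  | refl => exact ⟨0, .root⟩
  | tail _ hjk ih =>
    obtain ⟨T, hT⟩ := ih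
    exact ⟨_, .step hjk hT⟩

theorem tendsto_comp_sub {v : ℝ → Fin p → ℝ} (h : Tendsto v atTop (𝓝 0)) (T : ℝ) :
    Tendsto (fun t => v (t - T)) atTop (𝓝 0) :=
  h.comp (tendsto_atTop_add_const_right _ (-T) tendsto_id)

theorem hasDerivAt_comp_sub {ν : Type} [Fintype ν] {x : ℝ → ν → ℝ} {x' : ν → ℝ} {t T : ℝ}
    (h : HasDerivAt x x' (t - T)) : HasDerivAt (fun s => x (s - T)) x' t :=
  h.comp_sub_const t T

/-- The delays cancel in the estimation errors `y_i - ψ_i - y_root (t - T)`, which therefore form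
a cascade of stable systems along the tree. -/
theorem RegulatingObserver.tendsto_step {P : Protocol S} {β : ℝ} {f : Fin M}
    [DecidableEq (P.σ f)] (O : RegulatingObserver S β f (P.Ac f) (P.Bc f) (P.Cc f) (P.H f))
    (hDc : P.Dc f = 0) (hEc : P.Ec f = -P.Bc f) {a τ : Matrix (Fin (M + 1)) (Fin (M + 1)) ℝ}
    (hG : MemG β a) {x : ∀ i, ℝ → Fin (S.n i) → ℝ} {χ : ∀ f, ℝ → P.σ f → ℝ}
    (htr : IsTrajectory S P a τ x χ) {j : Fin (M + 1)} (hj : 0 < a f.succ j) {T : ℝ}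
    (hT : 0 ≤ T + τ f.succ j)
    (ih : Tendsto (fun t => S.output x j t - P.signal χ j t - S.output x 0 (t - T))
      atTop (𝓝 0)) :
    Tendsto (fun t => S.output x f.succ t - P.signal χ f.succ t -
      S.output x 0 (t - (T + τ f.succ j))) atTop (𝓝 0) ∧
    Tendsto (fun t => S.output x f.succ t - S.output x 0 (t - (T + τ f.succ j)))
      atTop (𝓝 0) := by
  set d := τ f.succ j with hd
  set l := a f.succ j with hl
  have hψ : ∀ t, P.signal χ f.succ t = P.H f *ᵥ χ f t := fun t => rfl
  set x₀ : ℝ → Fin (S.n 0) → ℝ := fun t => x 0 (t - (T + d)) with hx₀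
  set δ : ℝ → P.σ f → ℝ := fun t => O.Φ₁ *ᵥ x f.succ t + O.Φ₀ *ᵥ x₀ t - χ f t with hδ
  set w : ℝ → Fin p → ℝ := fun t => (P.H f * O.Φ₀ + S.C 0) *ᵥ x₀ t with hw
  set r : ℝ → Fin p → ℝ := fun t =>
    S.output x j (t - d) - P.signal χ j (t - d) - S.output x 0 (t - d - T) with hr
  have hw0 : Tendsto w atTop (𝓝 0) := tendsto_comp_sub (O.H_mul_Φ₀ (x 0) htr.root) (T + d)
  have hr0 : Tendsto r atTop (𝓝 0) := tendsto_comp_sub ih d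
  have hHδ : ∀ t, S.output x f.succ t - P.signal χ f.succ t - S.output x 0 (t - (T + d)) =
      P.H f *ᵥ δ t - w t := fun t => by
    simp only [hδ, hw, hψ, MAS.output, mulVec_sub, mulVec_add, add_mulVec, mulVec_mulVec,
      O.H_mul_Φ₁, hx₀]
    abel
  have hx₀d : ∀ t > T + d, HasDerivAt x₀ (S.A 0 *ᵥ x₀ t) t := fun t ht =>
    hasDerivAt_comp_sub (htr.root _ (by linarith))
  have hxd : ∀ t > T + d, HasDerivAt (x f.succ)
      (S.A f.succ *ᵥ x f.succ t + S.B f.succ *ᵥ (P.Cc f *ᵥ χ f t)) t := fun t ht => by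
    have h1 := htr.agent f t (by linarith)
    rwa [hDc, zero_mulVec, add_zero] at h1
  have hχ : ∀ t, χ f t = O.Φ₁ *ᵥ x f.succ t + O.Φ₀ *ᵥ x₀ t - δ t := fun t => by
    simp only [hδ]
    abel
  have hδd : ∀ t > T + d, HasDerivAt δ ((O.N - l • (P.Bc f * P.H f)) *ᵥ δ t +
      l • P.Bc f *ᵥ (w t + r t)) t := fun t ht => by
    have h1 := ((hasDerivAt_mulVec O.Φ₁ (hxd t ht)).add
      (hasDerivAt_mulVec O.Φ₀ (hx₀d t ht))).sub (htr.protocol f t (by linarith))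
    refine h1.congr_deriv ?_
    have hnet : networkSignal a τ (S.output x) f.succ t -
        networkSignal a τ (P.signal χ) f.succ t = l • (P.H f *ᵥ δ t - w t - r t) := by
      rw [hG.networkSignal_eq hj, hG.networkSignal_eq hj, ← smul_sub, ← hHδ, hr]
      have : t - d - T = t - (T + d) := by ring
      simp only [this]
      congr 1
      abel
    have h2 : P.Bc f *ᵥ networkSignal a τ (S.output x) f.succ t +
        P.Ec f *ᵥ networkSignal a τ (P.signal χ) f.succ t =
        l • P.Bc f *ᵥ (P.H f *ᵥ δ t - w t - r t) := by
      rw [hEc, neg_mulVec, ← sub_eq_add_neg, ← mulVec_sub, hnet, mulVec_smul]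
    have h3 : O.Φ₁ *ᵥ S.A f.succ *ᵥ x f.succ t + O.Φ₀ *ᵥ S.A 0 *ᵥ x₀ t - O.N *ᵥ χ f t =
        O.N *ᵥ δ t := by
      simp only [hδ, mulVec_sub, mulVec_add, mulVec_mulVec, O.N_mul_Φ₁, O.N_mul_Φ₀]
    have hAc : P.Ac f *ᵥ χ f t = (O.N + O.Φ₁ * S.B f.succ * P.Cc f) *ᵥ χ f t :=
      congrArg (· *ᵥ χ f t) O.Ac_eq
    rw [add_assoc (P.Ac f *ᵥ χ f t), h2, hAc, sub_mulVec, ← h3, smul_mulVec]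
    simp only [mulVec_sub, mulVec_add, add_mulVec, smul_add, smul_sub, ← mulVec_mulVec]
    abel
  have hδ0 : Tendsto δ atTop (𝓝 0) := by
    refine (O.isHurwitz_observer l (hG.le_weight hj)).tendsto_zero hδd ?_
    have h1 : Tendsto (fun t => w t + r t) atTop (𝓝 0) := by simpa using hw0.add hr0
    have h2 := (tendsto_mulVec_zero (P.Bc f) h1).const_smul l
    rwa [smul_zero] at h2
  refine ⟨?_, ?_⟩
  · simp only [hHδ]
    simpa using (tendsto_mulVec_zero (P.H f) hδ0).sub hw0
  set v : ℝ → Fin O.k → ℝ := fun t => O.E₁ *ᵥ x f.succ t + O.E₀ *ᵥ x₀ t with hv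
  have hvd : ∀ t > T + d, HasDerivAt v
      (O.As *ᵥ v t + -((O.E₁ * S.B f.succ * P.Cc f) *ᵥ δ t)) t := fun t ht => by
    have h1 := (hasDerivAt_mulVec O.E₁ (hxd t ht)).add (hasDerivAt_mulVec O.E₀ (hx₀d t ht))
    refine h1.congr_deriv ?_
    rw [hχ]
    simp only [hv, mulVec_add, mulVec_sub, mulVec_mulVec, O.As_mul_E₁, O.As_mul_E₀, add_mulVec,
      Matrix.mul_add, Matrix.mul_assoc]
    abel
  have hv0 : Tendsto v atTop (𝓝 0) := by
    refine O.isHurwitz_As.tendsto_zero hvd ?_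
    simpa using (tendsto_mulVec_zero (O.E₁ * S.B f.succ * P.Cc f) hδ0).neg
  have he : ∀ t, S.output x f.succ t - S.output x 0 (t - (T + d)) =
      O.Cs *ᵥ v t - (O.Cs * O.E₀ + S.C 0) *ᵥ x₀ t := fun t => by
    simp only [hv, MAS.output, mulVec_add, add_mulVec, mulVec_mulVec, O.Cs_mul_E₁, hx₀]
    abel
  simp only [he]
  have h1 : Tendsto (fun t => (O.Cs * O.E₀ + S.C 0) *ᵥ x₀ t) atTop (𝓝 0) :=
    tendsto_comp_sub (O.Cs_mul_E₀ (x 0) htr.root) (T + d)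
  simpa using (tendsto_mulVec_zero O.Cs hv0).sub h1

/-- Observer-based output regulators synchronize the network. -/
theorem solves_of_regulatingObserver {P : Protocol S} [∀ f, DecidableEq (P.σ f)] {β : ℝ}
    (O : ∀ f, RegulatingObserver S β f (P.Ac f) (P.Bc f) (P.Cc f) (P.H f))
    (hDc : ∀ f, P.Dc f = 0) (hEc : ∀ f, P.Ec f = -P.Bc f) : P.Solves β := by
  intro a hG τ hτ x χ htr
  have key : ∀ i T, IsPathDelay a τ i T → 0 ≤ T ∧
      Tendsto (fun t => S.output x i t - P.signal χ i t - S.output x 0 (t - T)) atTop (𝓝 0) ∧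
      Tendsto (fun t => S.output x i t - S.output x 0 (t - T)) atTop (𝓝 0) := by
    intro i T h
    induction h with
    | root =>
      have h1 : ∀ t, P.signal χ 0 t = 0 := fun t => rfl
      simp [h1]
    | @step i j T hij _ ih =>
      have hi : i ≠ 0 := fun h0 => hG.tree.root j (h0 ▸ hij)
      obtain ⟨f, rfl⟩ := Fin.exists_succ_eq.2 hi
      have hT : 0 ≤ T + τ f.succ j := add_nonneg ih.1 (hτ _ _ hij)
      exact ⟨hT, (O f).tendsto_step (hDc f) (hEc f) hG htr hij hT ih.2.1⟩
  have hpair : ∀ i j Ti Tj, IsPathDelay a τ i Ti → IsPathDelay a τ j Tj →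
      Tendsto (fun t => S.output x i t - S.output x j (t - (Ti - Tj))) atTop (𝓝 0) := by
    intro i j Ti Tj hi hj
    have h1 := (key i Ti hi).2.2.sub (tendsto_comp_sub (key j Tj hj).2.2 (Ti - Tj))
    rw [sub_zero] at h1
    refine h1.congr fun t => ?_
    have : t - (Ti - Tj) - Tj = t - Ti := by ring
    rw [this]
    abel
  refine ⟨fun i j hij => ?_, hpair⟩
  obtain ⟨T, hT⟩ := hG.tree.exists_isPathDelay τ j
  have h1 := hpair i j _ T (.step hij hT) hT
  rwa [add_sub_cancel_left] at h1

end Cascade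

/-! ### Observability and the coordinates of the error system -/

section Observability

variable {ν π : Type} [Fintype ν] [DecidableEq ν] 

theorem obsMatrix_mulVec_eq_zero_iff {l : ℕ} {A : Matrix ν ν ℝ} {C : Matrix π ν ℝ} {x : ν → ℝ} :
    obsMatrix l A C *ᵥ x = 0 ↔ ∀ k < l, (C * A ^ k) *ᵥ x = 0 := by
  constructor
  · intro h k hk
    ext b
    exact congrFun h (⟨k, hk⟩, b)
  · intro h
    ext r
    exact congrFun (h r.1 r.1.2) r.2

/-- By the Cayley–Hamilton theorem, the unobservable subspace is cut out by finitely many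
conditions. -/
theorem mul_pow_mulVec_eq_zero {l : ℕ} {A : Matrix ν ν ℝ} {C : Matrix π ν ℝ} {x : ν → ℝ}
    (hl : Fintype.card ν ≤ l) (h : obsMatrix l A C *ᵥ x = 0) (k : ℕ) :
    (C * A ^ k) *ᵥ x = 0 := by
  rcases isEmpty_or_nonempty ν with hν | hν
  · rw [Subsingleton.elim x 0, mulVec_zero]
  have hdeg : (Polynomial.X ^ k %ₘ A.charpoly).natDegree < l := by
    have h1 : A.charpoly.natDegree = Fintype.card ν := A.charpoly_natDegree_eq_dim
    refine (Polynomial.natDegree_modByMonic_lt _ A.charpoly_monic fun h2 => ?_).trans_le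
      (h1.trans_le hl)
    rw [h2, Polynomial.natDegree_one] at h1
    exact Fintype.card_ne_zero h1.symm
  rw [A.pow_eq_aeval_mod_charpoly, Polynomial.aeval_eq_sum_range' hdeg, Matrix.mul_sum,
    Matrix.sum_mulVec]
  refine Finset.sum_eq_zero fun i hi => ?_
  rw [Matrix.mul_smul, smul_mulVec,
    obsMatrix_mulVec_eq_zero_iff.1 h i (Finset.mem_range.1 hi), smul_zero]

end Observability

namespace Coordinates

variable {M p : ℕ} {S : MAS M p} {f : Fin M} (D : Coordinates S f)

/-- The state matrix of the pair consisting of agent `f` and the root. -/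
def _root_.DelayedSync.MAS.pairA (S : MAS M p) (f : Fin M) :
    Matrix (Fin (S.n f.succ) ⊕ Fin (S.n 0)) (Fin (S.n f.succ) ⊕ Fin (S.n 0)) ℝ :=
  fromBlocks (S.A f.succ) 0 0 (S.A 0)

/-- The output matrix of the pair, with output `y_f - y_root`. -/
def _root_.DelayedSync.MAS.pairC (S : MAS M p) (f : Fin M) :
    Matrix (Fin p) (Fin (S.n f.succ) ⊕ Fin (S.n 0)) ℝ :=
  fromCols (S.C f.succ) (-S.C 0)

theorem _root_.DelayedSync.MAS.pairObs_mulVec_eq_zero_iff (S : MAS M p) (f : Fin M)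
    {x : Fin (S.n f.succ) ⊕ Fin (S.n 0) → ℝ} :
    S.pairObs f *ᵥ x = 0 ↔ ∀ k : ℕ, (S.pairC f * S.pairA f ^ k) *ᵥ x = 0 :=
  ⟨fun h k => mul_pow_mulVec_eq_zero (by simp) h k,
    fun h => obsMatrix_mulVec_eq_zero_iff.2 fun k _ => h k⟩

/-- The contribution of agent `f` to the state of the error system. -/
def T₁ : Matrix (Fin (S.n f.succ) ⊕ Fin D.k) (Fin (S.n f.succ)) ℝ := fromRows 1 0

/-- The contribution of the root to the state of the error system. -/
def T₀ : Matrix (Fin (S.n f.succ) ⊕ Fin D.k) (Fin (S.n 0)) ℝ :=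
  fromRows (-(D.Λu * D.Φinv.toRows₁)) (-D.Φinv.toRows₂)

theorem exists_of_pairObs_mulVec_eq_zero {x : Fin (S.n f.succ) ⊕ Fin (S.n 0) → ℝ}
    (hx : S.pairObs f *ᵥ x = 0) : ∃ ξ : Fin D.q → ℝ, fromRows D.Λu D.Φu *ᵥ ξ = x := by
  have hle : LinearMap.range (fromRows D.Λu D.Φu).mulVecLin ≤
      LinearMap.ker (S.pairObs f).mulVecLin := by
    rintro _ ⟨ξ, rfl⟩
    rw [LinearMap.mem_ker, mulVecLin_apply, mulVecLin_apply, mulVec_mulVec, D.null, zero_mulVec]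
  have heq := Submodule.eq_of_le_of_finrank_eq hle (D.rank_eq.trans D.q_eq)
  have : x ∈ LinearMap.range (fromRows D.Λu D.Φu).mulVecLin := by
    rw [heq, LinearMap.mem_ker, mulVecLin_apply, hx]
  exact this

theorem inv_mul_blocks : D.Φinv.toRows₁ * D.Φu = 1 ∧ D.Φinv.toRows₁ * D.Φc = 0 ∧
    D.Φinv.toRows₂ * D.Φu = 0 ∧ D.Φinv.toRows₂ * D.Φc = 1 := by
  have h := D.inv_mul
  rw [← fromRows_toRows D.Φinv, fromRows_mul_fromCols, ← fromBlocks_one, fromBlocks_inj] at h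
  exact h

theorem mul_inv_blocks : D.Φu * D.Φinv.toRows₁ + D.Φc * D.Φinv.toRows₂ = 1 := by
  have h := D.mul_inv
  rwa [← fromRows_toRows D.Φinv, fromCols_mul_fromRows] at h

/-- The null space of the observability matrix is invariant and is contained in the kernel of
the output. -/
theorem exists_invariant : ∃ J : Matrix (Fin D.q) (Fin D.q) ℝ,
    S.A f.succ * D.Λu = D.Λu * J ∧ S.A 0 * D.Φu = D.Φu * J ∧
      S.C f.succ * D.Λu = S.C 0 * D.Φu := by
  have hcol : ∀ ξ : Fin D.q → ℝ, ∀ k : ℕ,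
      (S.pairC f * S.pairA f ^ k) *ᵥ (fromRows D.Λu D.Φu *ᵥ ξ) = 0 := fun ξ => by
    refine (S.pairObs_mulVec_eq_zero_iff f).1 ?_
    rw [mulVec_mulVec, D.null, zero_mulVec]
  have hinv : ∀ j : Fin D.q, ∃ ξ : Fin D.q → ℝ,
      fromRows D.Λu D.Φu *ᵥ ξ = S.pairA f *ᵥ (fromRows D.Λu D.Φu *ᵥ Pi.single j 1) := fun j => by
    refine D.exists_of_pairObs_mulVec_eq_zero ((S.pairObs_mulVec_eq_zero_iff f).2 fun k => ?_)
    have := hcol (Pi.single j 1) (k + 1)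
    rwa [pow_succ, ← Matrix.mul_assoc, ← mulVec_mulVec] at this
  choose ξ hξ using hinv
  have hJ : S.pairA f * fromRows D.Λu D.Φu =
      fromRows D.Λu D.Φu * Matrix.of fun i j => ξ j i := by
    ext i j
    have := congrFun (hξ j) i
    rw [mulVec_mulVec, mulVec_single_one] at this
    exact this.symm
  have hC : S.pairC f * fromRows D.Λu D.Φu = 0 := by
    ext i j
    have := congrFun (hcol (Pi.single j 1) 0) i
    rw [pow_zero, Matrix.mul_one, mulVec_mulVec, mulVec_single_one] at this
    exact this
  rw [MAS.pairA, fromBlocks_mul_fromRows, fromRows_mul, fromRows_inj.eq_iff] at hJ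
  rw [MAS.pairC, fromCols_mul_fromRows, Matrix.neg_mul, ← sub_eq_add_neg, sub_eq_zero] at hC
  simp only [Matrix.zero_mul, add_zero, zero_add] at hJ
  exact ⟨_, hJ.1, hJ.2, hC⟩

theorem A0_mul_rows₂ : D.Φinv.toRows₂ * S.A 0 = D.A22 * D.Φinv.toRows₂ := by
  obtain ⟨J, -, h, -⟩ := D.exists_invariant
  calc D.Φinv.toRows₂ * S.A 0
      = D.Φinv.toRows₂ * S.A 0 * (D.Φu * D.Φinv.toRows₁ + D.Φc * D.Φinv.toRows₂) := by
        rw [D.mul_inv_blocks, Matrix.mul_one]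
    _ = D.Φinv.toRows₂ * (S.A 0 * D.Φu) * D.Φinv.toRows₁ + D.A22 * D.Φinv.toRows₂ := by
        simp only [A22, Matrix.mul_add, Matrix.mul_assoc]
    _ = D.A22 * D.Φinv.toRows₂ := by
        rw [h, ← Matrix.mul_assoc D.Φinv.toRows₂, D.inv_mul_blocks.2.2.1]
        simp

theorem Abar_mul_T₁ : D.Abar * D.T₁ = D.T₁ * S.A f.succ := by
  rw [Abar, T₁, fromBlocks_mul_fromRows, fromRows_mul]
  simp

theorem Abar_mul_T₀ : D.Abar * D.T₀ = D.T₀ * S.A 0 := by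
  rw [Abar, T₀, fromBlocks_mul_fromRows, fromRows_mul, fromRows_inj.eq_iff]
  constructor
  · obtain ⟨J, h1, h2, -⟩ := D.exists_invariant
    have e : D.Λu * D.Φinv.toRows₁ * S.A 0 =
        S.A f.succ * D.Λu * D.Φinv.toRows₁ + D.A12 * D.Φinv.toRows₂ := by
      calc D.Λu * D.Φinv.toRows₁ * S.A 0
          = D.Λu * D.Φinv.toRows₁ * S.A 0 *
              (D.Φu * D.Φinv.toRows₁ + D.Φc * D.Φinv.toRows₂) := by
            rw [D.mul_inv_blocks, Matrix.mul_one]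
        _ = D.Λu * (D.Φinv.toRows₁ * (S.A 0 * D.Φu)) * D.Φinv.toRows₁ +
              D.A12 * D.Φinv.toRows₂ := by
            simp only [A12, Matrix.mul_add, Matrix.mul_assoc]
        _ = _ := by
            rw [h2, ← Matrix.mul_assoc D.Φinv.toRows₁, D.inv_mul_blocks.1, Matrix.one_mul, h1]
    rw [Matrix.neg_mul, e]
    simp only [Matrix.mul_neg, Matrix.mul_assoc, neg_add]
  · rw [Matrix.zero_mul, zero_add, Matrix.mul_neg, Matrix.neg_mul, D.A0_mul_rows₂]

theorem Cbar_mul_T₁ : D.Cbar * D.T₁ = S.C f.succ := by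
  rw [Cbar, T₁, fromCols_mul_fromRows]
  simp

theorem Cbar_mul_T₀ : D.Cbar * D.T₀ = -S.C 0 := by
  obtain ⟨J, -, -, h⟩ := D.exists_invariant
  rw [Cbar, T₀, fromCols_mul_fromRows, C2, neg_neg, Matrix.mul_neg, Matrix.mul_neg, ← neg_add,
    ← Matrix.mul_assoc, h, Matrix.mul_assoc, Matrix.mul_assoc, ← Matrix.mul_add,
    D.mul_inv_blocks, Matrix.mul_one]

theorem T₁_mul_B : D.T₁ * S.B f.succ = D.Bbar := by
  rw [T₁, Bbar, fromRows_mul]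
  simp

/-- The error system is observable, by the first `n_f + n_root` conditions: it is the quotient of
the pair by the null space of the observability matrix. -/
theorem eq_zero_of_forall_lt {z : Fin (S.n f.succ) ⊕ Fin D.k → ℝ}
    (h : ∀ r < S.n f.succ + S.n 0, (D.Cbar * D.Abar ^ r) *ᵥ z = 0) : z = 0 := by
  have hpow : ∀ r : ℕ, D.Abar ^ r * fromCols D.T₁ D.T₀ = fromCols D.T₁ D.T₀ * S.pairA f ^ r := by
    have h1 : D.Abar * fromCols D.T₁ D.T₀ = fromCols D.T₁ D.T₀ * S.pairA f := by
      rw [mul_fromCols, D.Abar_mul_T₁, D.Abar_mul_T₀, MAS.pairA, fromCols_mul_fromBlocks]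
      simp
    intro r
    induction r with
    | zero => simp
    | succ r ih => rw [pow_succ', Matrix.mul_assoc, ih, ← Matrix.mul_assoc, h1, pow_succ',
        Matrix.mul_assoc]
  have hC : D.Cbar * fromCols D.T₁ D.T₀ = S.pairC f := by
    rw [mul_fromCols, D.Cbar_mul_T₁, D.Cbar_mul_T₀, MAS.pairC]
  -- lift `z` to a state of the pair
  set w₁ : Fin (S.n f.succ) → ℝ := fun i => z (Sum.inl i) with hw₁
  set w₂ : Fin D.k → ℝ := fun i => z (Sum.inr i) with hw₂
  have hz : z = fromCols D.T₁ D.T₀ *ᵥ Sum.elim w₁ (-(D.Φc *ᵥ w₂)) := by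
    rw [fromCols_mulVec_sumElim, T₁, T₀, fromRows_mulVec, fromRows_mulVec]
    ext i
    rcases i with i | i
    · simp [hw₁, mulVec_neg, neg_mulVec, mulVec_mulVec, Matrix.mul_assoc, D.inv_mul_blocks.2.1]
    · simp [hw₂, mulVec_neg, neg_mulVec, mulVec_mulVec, D.inv_mul_blocks.2.2.2]
  have hker : S.pairObs f *ᵥ Sum.elim w₁ (-(D.Φc *ᵥ w₂)) = 0 := by
    refine obsMatrix_mulVec_eq_zero_iff.2 fun r hr => ?_
    have := h r hr
    rw [hz, mulVec_mulVec, Matrix.mul_assoc, hpow, ← Matrix.mul_assoc, hC] at this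
    exact this
  obtain ⟨ξ, hξ⟩ := D.exists_of_pairObs_mulVec_eq_zero hker
  rw [fromRows_mulVec] at hξ
  have h1 : D.Λu *ᵥ ξ = w₁ := funext fun i => congrFun hξ (Sum.inl i)
  have h2 : D.Φu *ᵥ ξ = -(D.Φc *ᵥ w₂) := funext fun i => congrFun hξ (Sum.inr i)
  have h3 : ξ = 0 := by
    have := congrArg (fun v => D.Φinv.toRows₁ *ᵥ v) h2
    simpa [mulVec_neg, D.inv_mul_blocks.1, D.inv_mul_blocks.2.1] using this
  have h4 : w₂ = 0 := by
    have := congrArg (fun v => D.Φinv.toRows₂ *ᵥ v) h2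
    simp only [mulVec_neg, mulVec_mulVec, D.inv_mul_blocks.2.2.1, D.inv_mul_blocks.2.2.2,
      zero_mulVec, one_mulVec] at this
    exact neg_eq_zero.1 this.symm
  rw [hz, ← h1, h3, h4]
  simp

theorem observable_bar : Observable D.Abar D.Cbar := fun _ h =>
  D.eq_zero_of_forall_lt fun r _ => h r

/-- By observability, `Ξ` has full column rank, so that `(Ξᵀ Ξ)⁻¹` is a true inverse. -/
theorem Ξpinv_mul_Ξ {l : ℕ} (hl : S.n f.succ + S.n 0 ≤ l) : D.Ξpinv l * D.Ξ l = 1 := by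
  rw [Ξpinv, Matrix.mul_assoc, nonsing_inv_mul]
  rw [isUnit_iff_ne_zero]
  intro h0
  obtain ⟨z, hz, h⟩ := exists_mulVec_eq_zero_iff.2 h0
  refine hz (D.eq_zero_of_forall_lt fun r hr => ?_)
  have h1 := dotProduct_transpose_mul_self (D.Ξ l) z
  rw [h, dotProduct_zero] at h1
  have h2 : D.Ξ l *ᵥ z = 0 := by
    by_contra hne
    exact (dotProduct_self_pos hne).ne h1
  exact obsMatrix_mulVec_eq_zero_iff.1 h2 r (hr.trans_le hl)

end Coordinates

namespace Design

variable {M p : ℕ} {S : MAS M p} {f : Fin M} (D : Design S f)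

/-- The deviation `w₁ - Pi w₂` from the regulated subspace, as a function of the state of the
error system. -/
def dev : Matrix (Fin (S.n f.succ)) (Fin (S.n f.succ) ⊕ Fin D.k) ℝ := fromCols 1 (-D.Pi)

theorem F_mul_T₁ : D.F * D.T₁ = D.K := by
  rw [F, Coordinates.T₁, fromCols_mul_fromRows]
  simp

theorem C_mul_dev : S.C f.succ * D.dev = D.Cbar := by
  rw [dev, Coordinates.Cbar, mul_fromCols, Matrix.mul_neg, D.regulator_output, Matrix.mul_one]

/-- By the regulator equations, the feedback `F` makes the deviation autonomous. -/
theorem closedLoop_mul_dev :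
    (S.A f.succ + S.B f.succ * D.K) * D.dev = D.dev * D.Abar + S.B f.succ * D.F := by
  rw [dev, Coordinates.Abar, F, fromCols_mul_fromBlocks, mul_fromCols, mul_fromCols]
  have h := D.regulator_state
  ext i j
  rcases j with j | j
  · simp [Matrix.add_mul]
  · have e : (S.A f.succ + S.B f.succ * D.K) * -D.Pi =
        D.A12 + -D.Pi * D.A22 + S.B f.succ * (D.Γ - D.K * D.Pi) := by
      rw [Matrix.neg_mul, h]
      simp only [Matrix.add_mul, Matrix.mul_neg, Matrix.mul_sub, Matrix.mul_assoc]
      abel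
    simp only [Matrix.one_mul]
    exact congrFun (congrFun e i) j

end Design

/-! ### The high-gain observer -/

section HighGain

variable {l p : ℕ}

omit l p in
/-- Similarity up to a positive factor preserves the Hurwitz property. -/
theorem IsHurwitz.of_mul_eq {ν : Type} [Fintype ν] [DecidableEq ν] {X Y H H' : Matrix ν ν ℝ}
    {c : ℝ} (hY : IsHurwitz Y) (hc : 0 < c) (h : c • (X * H) = H * Y) (hH : H * H' = 1) :
    IsHurwitz X := by
  intro z hz
  obtain ⟨v, hv, hvz⟩ := mem_eigenvalues_iff_vecMul.1 hz
  have h1 : (c : ℂ) * z ∈ eigenvalues Y := by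
    refine mem_eigenvalues_iff_vecMul.2 ⟨v ᵥ* H.map (algebraMap ℝ ℂ), fun h0 => hv ?_, ?_⟩
    · have := congrArg (fun w => w ᵥ* H'.map (algebraMap ℝ ℂ)) h0
      simp only [vecMul_vecMul, ← Matrix.map_mul, hH, zero_vecMul] at this
      rwa [Matrix.map_one _ (map_zero _) (map_one _), vecMul_one] at this
    · have e : (c • (X * H)).map (algebraMap ℝ ℂ) =
          (c : ℂ) • (X.map (algebraMap ℝ ℂ) * H.map (algebraMap ℝ ℂ)) := by
        ext i j
        simp [Matrix.mul_apply]
      rw [vecMul_vecMul, ← Matrix.map_mul, ← h, e, vecMul_smul, ← vecMul_vecMul, hvz,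
        smul_vecMul, smul_smul]
  have h2 := hY _ h1
  rw [Complex.re_ofReal_mul] at h2
  by_contra! hcon
  have := mul_nonneg hc.le hcon
  linarith

theorem shiftA_mulVec_apply (x : Fin l × Fin p → ℝ) (r : Fin l × Fin p) :
    (shiftA l p *ᵥ x) r = if h : (r.1 : ℕ) + 1 < l then x (⟨r.1 + 1, h⟩, r.2) else 0 := by
  simp only [shiftA, mulVec, dotProduct, of_apply, ite_mul, one_mul, zero_mul]
  split_ifs with h
  · rw [Finset.sum_eq_single (⟨r.1 + 1, h⟩, r.2)]
    · simp
    · rintro ⟨s, b⟩ - hne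
      refine if_neg fun hs => hne ?_
      exact Prod.ext (Fin.ext hs.1) hs.2
    · simp
  · refine Finset.sum_eq_zero fun s _ => if_neg fun hs => h ?_
    have := s.1.2
    omega

theorem shiftC_mulVec_apply (hl : 0 < l) (x : Fin l × Fin p → ℝ) (b : Fin p) :
    (shiftC l p *ᵥ x) b = x (⟨0, hl⟩, b) := by
  simp only [shiftC, mulVec, dotProduct, of_apply, ite_mul, one_mul, zero_mul]
  rw [Finset.sum_eq_single (⟨0, hl⟩, b)]
  · simp
  · rintro ⟨s, c⟩ - hne
    exact if_neg fun hs => hne (Prod.ext (Fin.ext hs.1) hs.2)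
  · simp

theorem lastRow_mulVec_apply (G : Matrix (Fin p) (Fin l × Fin p) ℝ) (x : Fin l × Fin p → ℝ)
    (r : Fin l × Fin p) :
    (lastRow G *ᵥ x) r = if (r.1 : ℕ) + 1 = l then (G *ᵥ x) r.2 else 0 := by
  simp only [lastRow, mulVec, dotProduct, of_apply]
  split_ifs <;> simp

/-- The block companion pair is observable. -/
theorem observable_shift (G : Matrix (Fin p) (Fin l × Fin p) ℝ) :
    Observable (shiftA l p + lastRow G) (shiftC l p) := by
  intro x hx
  have key : ∀ (k : ℕ) (r : Fin l) (b : Fin p) (h : (r : ℕ) + k < l),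
      ((shiftA l p + lastRow G) ^ k *ᵥ x) (r, b) = x (⟨r + k, h⟩, b) := by
    intro k
    induction k with
    | zero => intro r b h; simp
    | succ k ih =>
      intro r b h
      have h1 : (r : ℕ) + 1 < l := by omega
      have h2 : (⟨r + 1, h1⟩ : Fin l) + k < l := by
        change (r : ℕ) + 1 + k < l
        omega
      rw [pow_succ', ← mulVec_mulVec, add_mulVec, Pi.add_apply, shiftA_mulVec_apply,
        lastRow_mulVec_apply, dif_pos h1, if_neg (by simpa using h1.ne), add_zero, ih _ _ h2]
      congr 3
      change (r : ℕ) + 1 + k = r + (k + 1)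
      omega
  ext ⟨r, b⟩
  have hl : 0 < l := r.pos
  have h1 := congrFun (hx r) b
  rw [← mulVec_mulVec, shiftC_mulVec_apply hl, key r ⟨0, hl⟩ b (by simp)] at h1
  simpa using h1

theorem isRiccati_iff {β ε : ℝ} {K : Matrix (Fin p) (Fin l × Fin p) ℝ}
    {Q : Matrix (Fin l × Fin p) (Fin l × Fin p) ℝ} :
    IsRiccati β K ε Q ↔ riccati β (shiftA l p + gainK K ε) (shiftC l p) Q = 0 := Iff.rfl

theorem existsUnique_isRiccati {β : ℝ} (hβ : 0 < β) (K : Matrix (Fin p) (Fin l × Fin p) ℝ)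
    (ε : ℝ) : ∃! Q : Matrix (Fin l × Fin p) (Fin l × Fin p) ℝ,
      Q.PosDef ∧ IsRiccati β K ε Q := by
  obtain ⟨Q, hQ, h⟩ := exists_riccati hβ (exists_isHurwitz_add_mul
    (observable_shift (ε ^ (l + 1) • (K * gainH l p ε))))
  exact ⟨Q, ⟨hQ, h⟩, fun Q' h' => riccati_unique hβ hQ h'.1 h h'.2⟩

theorem gainK_apply (K : Matrix (Fin p) (Fin l × Fin p) ℝ) {ε : ℝ} (hε : ε ≠ 0)
    (r s : Fin l × Fin p) :
    gainK K ε r s = if (r.1 : ℕ) + 1 = l then ε ^ (l - s.1) * K r.2 s else 0 := by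
  simp only [gainK, lastRow, gainH, of_apply, Matrix.smul_apply, mul_diagonal, smul_eq_mul]
  refine if_congr Iff.rfl ?_ rfl
  have h : ε ^ (l + 1) = ε ^ (l - s.1) * ε ^ ((s.1 : ℕ) + 1) := by
    rw [← pow_add]
    congr 1
    have := s.1.2
    omega
  rw [h, inv_pow]
  field_simp

theorem tendsto_gainK (K : Matrix (Fin p) (Fin l × Fin p) ℝ) :
    Tendsto (gainK K) (𝓝[>] 0) (𝓝 0) := by
  refine tendsto_pi_nhds.2 fun r => tendsto_pi_nhds.2 fun s => ?_
  have h1 : Tendsto (fun ε : ℝ => if (r.1 : ℕ) + 1 = l then ε ^ (l - s.1) * K r.2 s else 0)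
      (𝓝[>] 0) (𝓝 0) := by
    refine Tendsto.mono_left ?_ nhdsWithin_le_nhds
    split_ifs
    · have h2 : Continuous fun ε : ℝ => ε ^ (l - s.1) * K r.2 s := by fun_prop
      have h3 := h2.tendsto 0
      have : l - s.1 ≠ 0 := by
        have := s.1.2
        omega
      rwa [zero_pow this, zero_mul] at h3
    · exact tendsto_const_nhds
  refine h1.congr' ?_
  filter_upwards [self_mem_nhdsWithin] with ε hε using (gainK_apply K (ne_of_gt hε) r s).symm

/-- The scaling by `H_ε` absorbs the gain: up to the factor `ε`, the observer with last block row
`G` is similar to the slightly perturbed observer with system matrix `A_o + G_ε`, where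
`G_ε = gainK G ε`. -/
theorem smul_mul_gainH (G : Matrix (Fin p) (Fin l × Fin p) ℝ) {ε : ℝ} (hε : ε ≠ 0) (c : ℝ)
    (Q : Matrix (Fin l × Fin p) (Fin l × Fin p) ℝ) :
    ε • ((shiftA l p + lastRow G - c • (gainH l p ε * Q * (shiftC l p)ᵀ * shiftC l p)) *
        gainH l p ε) =
      gainH l p ε * (shiftA l p + gainK G ε - c • (Q * (shiftC l p)ᵀ * shiftC l p)) := by
  have h1 : ε • (shiftA l p * gainH l p ε) = gainH l p ε * shiftA l p := by
    ext r s
    simp only [gainH, shiftA, Matrix.smul_apply, mul_diagonal, diagonal_mul, of_apply, smul_eq_mul]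
    split_ifs with h
    · rw [h.1, pow_succ ε⁻¹ ((r.1 : ℕ) + 1)]
      field_simp
    · simp
  have h2 : ε • (lastRow G * gainH l p ε) = gainH l p ε * gainK G ε := by
    ext r s
    simp only [gainK, gainH, lastRow, Matrix.smul_apply, mul_diagonal, diagonal_mul, of_apply,
      smul_eq_mul]
    split_ifs with h
    · simp only [h, inv_pow, pow_succ ε l]
      have := pow_ne_zero l hε
      field_simp
    · simp
  have h3 : ε • (shiftC l p * gainH l p ε) = shiftC l p := by
    ext b s
    simp only [gainH, shiftC, Matrix.smul_apply, mul_diagonal, of_apply, smul_eq_mul]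
    split_ifs with h
    · rw [h.1, zero_add, pow_one, one_mul, mul_inv_cancel₀ hε]
    · simp
  have h4 : ε • (gainH l p ε * Q * (shiftC l p)ᵀ * shiftC l p * gainH l p ε) =
      gainH l p ε * (Q * (shiftC l p)ᵀ * shiftC l p) := by
    rw [Matrix.mul_assoc _ (shiftC l p), ← Matrix.mul_smul, h3]
    simp only [Matrix.mul_assoc]
  rw [Matrix.sub_mul, Matrix.add_mul, smul_sub, smul_add, h1, h2, smul_mul, smul_comm, h4]
  simp only [Matrix.mul_sub, Matrix.mul_add, Matrix.mul_smul]

/-- The sum of the absolute values of the entries, which bounds the quadratic form. -/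
def absSum {ν : Type} [Fintype ν] (N : Matrix ν ν ℝ) : ℝ := ∑ i, ∑ j, |N i j|

omit l p in
theorem eventually_absSum_lt {ν : Type} [Fintype ν] {N : ℝ → Matrix ν ν ℝ} {g : Filter ℝ}
    (h : Tendsto N g (𝓝 0)) {c : ℝ} (hc : 0 < c) : ∀ᶠ ε in g, absSum (N ε) < c := by
  have h1 : Continuous fun N : Matrix ν ν ℝ => absSum N := by
    unfold absSum
    fun_prop
  have h2 := (h1.tendsto 0).comp h
  have h3 : absSum (0 : Matrix ν ν ℝ) = 0 := by simp [absSum]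
  rw [h3] at h2
  exact h2.eventually (gt_mem_nhds hc)

omit l p in
theorem dotProduct_mulVec_le_absSum {ν : Type} [Fintype ν] (N : Matrix ν ν ℝ) (x : ν → ℝ) :
    x ⬝ᵥ N *ᵥ x ≤ absSum N * (x ⬝ᵥ x) :=
  (le_abs_self _).trans (abs_dotProduct_mulVec_le N x)

/-- The solutions of the Riccati equations are bounded uniformly in small `ε`, and the gain `G_ε`
vanishes as `ε → 0`, so that the observer is stable for all weights `c ≥ β` at once. -/
theorem eventually_isHurwitz_observer {β : ℝ} (hβ : 0 < β)
    (K G : Matrix (Fin p) (Fin l × Fin p) ℝ) :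
    ∀ᶠ ε in 𝓝[>] (0 : ℝ), ∀ Q : Matrix (Fin l × Fin p) (Fin l × Fin p) ℝ, Q.PosDef →
      IsRiccati β K ε Q → ∀ c, β ≤ c → IsHurwitz
        (shiftA l p + lastRow G - c • (gainH l p ε * Q * (shiftC l p)ᵀ * shiftC l p)) := by
  obtain ⟨L, hL⟩ := exists_isHurwitz_add_mul
    (observable_shift (0 : Matrix (Fin p) (Fin l × Fin p) ℝ))
  have h0 : lastRow (0 : Matrix (Fin p) (Fin l × Fin p) ℝ) = 0 := by
    ext r s
    simp [lastRow]
  rw [h0, add_zero] at hL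
  set W : Matrix (Fin l × Fin p) (Fin l × Fin p) ℝ := 1 + (2 * β)⁻¹ • (L * Lᵀ) with hW
  have hWx : ∀ x, x ⬝ᵥ x ≤ x ⬝ᵥ W *ᵥ x := fun x => by
    have := dotProduct_smul_mul_transpose_nonneg (c := (2 * β)⁻¹) (by positivity) L x
    rw [hW, add_mulVec, dotProduct_add, one_mulVec]
    linarith
  -- a supersolution with slack, for the limit `ε = 0`
  have hW1 : (1 + W).PosDef := by
    refine posDef_iff_real.2 ⟨by simp [hW], fun x hx => ?_⟩
    have := hWx x
    have := dotProduct_self_pos hx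
    rw [add_mulVec, dotProduct_add, one_mulVec]
    linarith
  obtain ⟨P, hP, hlyap⟩ := hL.exists_lyapunov_posDef hW1
  have hPr := posDef_iff_real.1 hP
  set κ := absSum P with hκ
  have hκ0 : 0 ≤ κ := Finset.sum_nonneg fun _ _ => Finset.sum_nonneg fun _ _ => abs_nonneg _
  have hK0 : Tendsto (fun ε => gainK K ε * P + P * (gainK K ε)ᵀ) (𝓝[>] 0) (𝓝 0) := by
    have hc : Continuous fun N : Matrix (Fin l × Fin p) (Fin l × Fin p) ℝ =>
      N * P + P * Nᵀ := by fun_prop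
    have := (hc.tendsto 0).comp (tendsto_gainK K)
    rw [transpose_zero, Matrix.zero_mul, Matrix.mul_zero, add_zero] at this
    exact this
  have hE0 : Tendsto (fun ε => (gainK G ε - gainK K ε) * P * (gainK G ε - gainK K ε)ᵀ)
      (𝓝[>] 0) (𝓝 0) := by
    have hc : Continuous fun N : Matrix (Fin l × Fin p) (Fin l × Fin p) ℝ =>
      N * P * Nᵀ := by fun_prop
    have hd := (tendsto_gainK G).sub (tendsto_gainK K)
    rw [sub_zero] at hd
    have := (hc.tendsto 0).comp hd
    rw [Matrix.zero_mul, Matrix.zero_mul] at this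
    exact this
  filter_upwards [self_mem_nhdsWithin, eventually_absSum_lt hK0 one_pos,
    eventually_absSum_lt hE0 (show 0 < 1 / (2 * (2 * κ + 1)) by positivity)]
    with ε hε hεK hεE Q hQ hric c hc
  have hε' : (0 : ℝ) < ε := hε
  have hQr := posDef_iff_real.1 hQ
  -- the uniform bound `Q ≤ P`
  have hsup : ∀ x, x ⬝ᵥ ((shiftA l p + gainK K ε + L * shiftC l p) * P +
      P * (shiftA l p + gainK K ε + L * shiftC l p)ᵀ) *ᵥ x ≤ -(x ⬝ᵥ W *ᵥ x) := fun x => by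
    have e : (shiftA l p + gainK K ε + L * shiftC l p) * P +
        P * (shiftA l p + gainK K ε + L * shiftC l p)ᵀ =
        (gainK K ε * P + P * (gainK K ε)ᵀ) +
          ((shiftA l p + L * shiftC l p) * P + P * (shiftA l p + L * shiftC l p)ᵀ) := by
      simp only [transpose_add, Matrix.add_mul, Matrix.mul_add]
      abel
    have h1 := dotProduct_mulVec_le_absSum (gainK K ε * P + P * (gainK K ε)ᵀ) x
    have h2 := mul_le_mul_of_nonneg_right hεK.le (dotProduct_self_nonneg' x)
    rw [e, hlyap, add_mulVec, dotProduct_add, neg_mulVec, dotProduct_neg, add_mulVec 1 W,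
      dotProduct_add, one_mulVec]
    linarith
  have hLε : IsHurwitz (shiftA l p + gainK K ε + L * shiftC l p) :=
    isHurwitz_of_lyapunov hP fun x hx => by
      have := hsup x
      have := hWx x
      have := dotProduct_self_pos hx
      linarith
  have hQP : ∀ x, x ⬝ᵥ Q *ᵥ x ≤ x ⬝ᵥ P *ᵥ x := fun x => by
    refine riccati_le hβ hLε (fun x => ?_) hQr.1 hric x
    have := hsup x
    rw [add_mulVec _ (1 + (2 * β)⁻¹ • (L * Lᵀ)), dotProduct_add]
    linarith
  set E := gainK G ε - gainK K ε with hE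
  have hHur : IsHurwitz (shiftA l p + gainK K ε + E - c • (Q * (shiftC l p)ᵀ * shiftC l p)) := by
    refine isHurwitz_sub_of_riccati hQ (fun x => by rw [isRiccati_iff.1 hric]; simp) hc E ?_
    intro x hx
    set u := Eᵀ *ᵥ x with hu
    set b := 2 * κ + 1 with hb
    have hb0 : 0 < b := by positivity
    -- Young's inequality in the form of `Q`
    have h1 := (posSemidef_iff_real.1 hQ.posSemidef).2 (b • u - x)
    have h2 : (b • u - x) ⬝ᵥ Q *ᵥ (b • u - x) =
        b ^ 2 * (u ⬝ᵥ Q *ᵥ u) - 2 * b * (u ⬝ᵥ Q *ᵥ x) + x ⬝ᵥ Q *ᵥ x := by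
      have h3 : x ⬝ᵥ Q *ᵥ u = u ⬝ᵥ Q *ᵥ x := by rw [← dotProduct_transpose_mulVec, hQr.1]
      simp only [mulVec_sub, mulVec_smul, sub_dotProduct, dotProduct_sub, smul_dotProduct,
        dotProduct_smul, smul_eq_mul, h3]
      ring
    rw [h2] at h1
    have h4 : u ⬝ᵥ P *ᵥ u ≤ 1 / (2 * b) * (x ⬝ᵥ x) := by
      rw [hu, ← dotProduct_conj_mulVec]
      exact (dotProduct_mulVec_le_absSum _ x).trans
        (mul_le_mul_of_nonneg_right hεE.le (dotProduct_self_nonneg' x))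
    have h5 : x ⬝ᵥ P *ᵥ x ≤ κ * (x ⬝ᵥ x) := dotProduct_mulVec_le_absSum P x
    have h6 := hQP u
    have h7 := hQP x
    have h8 := dotProduct_self_pos hx
    rw [dotProduct_lyapunov E hQr.1]
    have h9 : b ^ 2 * (u ⬝ᵥ Q *ᵥ u) ≤ b / 2 * (x ⬝ᵥ x) := by
      calc b ^ 2 * (u ⬝ᵥ Q *ᵥ u) ≤ b ^ 2 * (1 / (2 * b) * (x ⬝ᵥ x)) :=
            mul_le_mul_of_nonneg_left (h6.trans h4) (sq_nonneg b)
        _ = b / 2 * (x ⬝ᵥ x) := by field_simp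
    have h10 : b * (2 * (u ⬝ᵥ Q *ᵥ x)) < b * (x ⬝ᵥ x) := by
      have : κ * (x ⬝ᵥ x) < b / 2 * (x ⬝ᵥ x) :=
        mul_lt_mul_of_pos_right (by rw [hb]; linarith) h8
      linarith
    exact lt_of_mul_lt_mul_left h10 hb0.le
  rw [hE, add_assoc, add_sub_cancel] at hHur
  refine hHur.of_mul_eq hε' (smul_mul_gainH G hε'.ne' c Q)
    (H' := diagonal fun r => ε ^ ((r.1 : ℕ) + 1)) ?_
  rw [gainH, diagonal_mul_diagonal, ← diagonal_one]
  congr 1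
  ext r
  rw [← mul_pow, inv_mul_cancel₀ hε'.ne', one_pow]

end HighGain

/-! ### The observer and output-regulation protocol -/

section RegulationProtocol

variable {M p : ℕ} {S : MAS M p}

theorem shiftC_mul_Ξ {f : Fin M} (D : Coordinates S f) {l : ℕ} (hl : S.n f.succ + S.n 0 ≤ l) :
    shiftC l p * D.Ξ l = D.Cbar := by
  rcases Nat.eq_zero_or_pos l with h0 | hpos
  · -- a system without states
    rw [← Matrix.mul_one (shiftC l p * D.Ξ l), ← Matrix.mul_one D.Cbar]
    have : (1 : Matrix (Fin (S.n f.succ) ⊕ Fin D.k) (Fin (S.n f.succ) ⊕ Fin D.k) ℝ) = 0 := by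
      ext i j
      have hz : Pi.single j (1 : ℝ) = 0 := D.eq_zero_of_forall_lt fun r hr => by omega
      rw [one_apply, Matrix.zero_apply]
      have := congrFun hz j
      simp at this
    rw [this, Matrix.mul_zero, Matrix.mul_zero]
  · ext b j
    have h1 := shiftC_mulVec_apply hpos ((D.Ξ l).col j) b
    rw [← mulVec_single_one, mulVec_mulVec, mulVec_single_one, mulVec_single_one] at h1
    refine h1.trans ?_
    simp [Coordinates.Ξ, obsMatrix, col_apply]

/-- On the range of `Ξ`, the block companion matrix `A_o + K_o` acts as the error system. -/
theorem observer_mul_Ξ {f : Fin M} (D : Coordinates S f) {l : ℕ} (hl : S.n f.succ + S.n 0 ≤ l) :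
    (shiftA l p + lastRow (D.Cbar * D.Abar ^ l * D.Ξpinv l)) * D.Ξ l = D.Ξ l * D.Abar := by
  ext r j
  have h1 : ((shiftA l p + lastRow (D.Cbar * D.Abar ^ l * D.Ξpinv l)) * D.Ξ l) r j =
      ((shiftA l p + lastRow (D.Cbar * D.Abar ^ l * D.Ξpinv l)) *ᵥ (D.Ξ l).col j) r := rfl
  have h2 : (D.Ξ l * D.Abar) r j = (D.Cbar * D.Abar ^ ((r.1 : ℕ) + 1)) r.2 j := by
    rw [pow_succ, ← Matrix.mul_assoc]
    rfl
  rw [h1, h2, add_mulVec, Pi.add_apply, shiftA_mulVec_apply, lastRow_mulVec_apply]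
  have hr := r.1.2
  rcases Nat.lt_or_ge (r.1 + 1) l with h | h
  · rw [dif_pos h, if_neg h.ne, add_zero]
    rfl
  · have heq : (r.1 : ℕ) + 1 = l := by omega
    rw [dif_neg h.not_gt, if_pos heq, zero_add, heq, ← mulVec_single_one, mulVec_mulVec,
      Matrix.mul_assoc, D.Ξpinv_mul_Ξ hl, Matrix.mul_one, mulVec_single_one]
    rfl

/-- The protocol is a regulating observer in the coordinates `φ = Ξ w`. -/
def regulationObserver {β : ℝ} {l : ℕ} {f : Fin M} (D : Design S f) {ε : ℝ}
    {Q : Matrix (Fin l × Fin p) (Fin l × Fin p) ℝ}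
    (hl : S.n f.succ + S.n 0 ≤ l)
    (hH : ∀ c, β ≤ c → IsHurwitz (shiftA l p +
      lastRow (D.Cbar * D.Abar ^ l * D.Ξpinv l) -
        c • (gainH l p ε * Q * (shiftC l p)ᵀ * shiftC l p))) :
    RegulatingObserver S β f
      (shiftA l p + lastRow (D.Cbar * D.Abar ^ l * D.Ξpinv l) +
        D.Ξ l * D.Bbar * (D.F * D.Ξpinv l))
      (gainH l p ε * Q * (shiftC l p)ᵀ) (D.F * D.Ξpinv l) (shiftC l p) where
  N := shiftA l p + lastRow (D.Cbar * D.Abar ^ l * D.Ξpinv l)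
  Φ₁ := D.Ξ l * D.T₁
  Φ₀ := D.Ξ l * D.T₀
  k := S.n f.succ
  E₁ := 1
  E₀ := D.dev * D.T₀
  As := S.A f.succ + S.B f.succ * D.K
  Cs := S.C f.succ
  Ac_eq := by
    rw [Matrix.mul_assoc (D.Ξ l) D.T₁, D.T₁_mul_B]
  N_mul_Φ₁ := by
    rw [← Matrix.mul_assoc, observer_mul_Ξ _ hl, Matrix.mul_assoc, D.Abar_mul_T₁,
      Matrix.mul_assoc]
  N_mul_Φ₀ := by
    rw [← Matrix.mul_assoc, observer_mul_Ξ _ hl, Matrix.mul_assoc, D.Abar_mul_T₀,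
      Matrix.mul_assoc]
  H_mul_Φ₁ := by
    rw [← Matrix.mul_assoc, shiftC_mul_Ξ _ hl, D.Cbar_mul_T₁]
  H_mul_Φ₀ := fun x _ => by
    have h : shiftC l p * (D.Ξ l * D.T₀) + S.C 0 = 0 := by
      rw [← Matrix.mul_assoc, shiftC_mul_Ξ _ hl, D.Cbar_mul_T₀, neg_add_cancel]
    simp [h]
  isHurwitz_observer := hH
  As_mul_E₁ := by
    have h : D.F * D.Ξpinv l * (D.Ξ l * D.T₁) = D.K := by
      rw [Matrix.mul_assoc, ← Matrix.mul_assoc _ _ D.T₁, D.Ξpinv_mul_Ξ hl,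
        Matrix.one_mul, D.F_mul_T₁]
    rw [Matrix.mul_one, Matrix.one_mul, Matrix.mul_assoc, h]
  As_mul_E₀ := by
    have h : D.F * D.Ξpinv l * (D.Ξ l * D.T₀) = D.F * D.T₀ := by
      rw [Matrix.mul_assoc, ← Matrix.mul_assoc _ _ D.T₀, D.Ξpinv_mul_Ξ hl,
        Matrix.one_mul]
    rw [Matrix.one_mul, Matrix.mul_assoc (S.B f.succ), h, ← Matrix.mul_assoc,
      D.closedLoop_mul_dev, Matrix.add_mul, Matrix.mul_assoc _ _ D.T₀,
      D.Abar_mul_T₀, Matrix.mul_assoc, Matrix.mul_assoc]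
    exact add_comm _ _
  Cs_mul_E₁ := Matrix.mul_one _
  Cs_mul_E₀ := fun x _ => by
    have h : S.C f.succ * (D.dev * D.T₀) + S.C 0 = 0 := by
      rw [← Matrix.mul_assoc, D.C_mul_dev, D.Cbar_mul_T₀, neg_add_cancel]
    simp [h]
  isHurwitz_As := D.hurwitz

/-- The protocol solves the problem for all sufficiently small `ε`. -/
theorem exists_regulationProtocol_solves {β : ℝ} (hβ : 0 < β) {l : ℕ}
    (hl : ∀ f : Fin M, S.n f.succ + S.n 0 ≤ l) (K : Matrix (Fin p) (Fin l × Fin p) ℝ)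
    (D : ∀ f : Fin M, Design S f) :
    ∃ ε₀ : ℝ, 0 < ε₀ ∧ ∀ ε : ℝ, 0 < ε → ε ≤ ε₀ →
      ∀ Q : Matrix (Fin l × Fin p) (Fin l × Fin p) ℝ,
        Q.PosDef → IsRiccati β K ε Q → (regulationProtocol l D ε Q).Solves β := by
  have h := eventually_all.2 fun f : Fin M => eventually_isHurwitz_observer hβ K
    ((D f).Cbar * (D f).Abar ^ l * (D f).Ξpinv l)
  obtain ⟨ε₀, hε₀, hsub⟩ := mem_nhdsGT_iff_exists_Ioc_subset.1 h
  refine ⟨ε₀, hε₀, fun ε h0 h1 Q hQ hric => ?_⟩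
  let _ : ∀ f, DecidableEq ((regulationProtocol l D ε Q).σ f) := fun _ =>
    inferInstanceAs (DecidableEq (Fin l × Fin p))
  exact solves_of_regulatingObserver
    (fun f => regulationObserver (D f) (hl f) (hsub ⟨h0, h1⟩ f Q hQ hric))
    (fun _ => rfl) fun _ => rfl

end RegulationProtocol

/-! ### Invariant zeros and the rank of the Rosenbrock matrix -/

section Rosenbrock

variable {ν μ π : Type} [Fintype ν] [DecidableEq ν] [Fintype μ] [DecidableEq μ]
  [Fintype π] [DecidableEq π]

/-- The Rosenbrock matrix at `z` has trivial left null space, with the rows of a left null vector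
`(u, w)` written out. -/
def HasFullRowRankAt (A : Matrix ν ν ℝ) (B : Matrix ν μ ℝ) (C : Matrix π ν ℝ) (z : ℂ) : Prop :=
  ∀ (u : ν → ℂ) (w : π → ℂ),
    u ᵥ* A.map (algebraMap ℝ ℂ) + w ᵥ* C.map (algebraMap ℝ ℂ) = z • u →
    u ᵥ* B.map (algebraMap ℝ ℂ) = 0 → u = 0 ∧ w = 0

omit [DecidableEq ν] [DecidableEq μ] in
theorem rank_eq_card_iff_vecMul {𝕜 : Type} [Field 𝕜] (N : Matrix ν μ 𝕜) :
    N.rank = Fintype.card ν ↔ ∀ v, v ᵥ* N = 0 → v = 0 := by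
  have h1 := LinearMap.finrank_range_add_finrank_ker Nᵀ.mulVecLin
  have h2 : Module.finrank 𝕜 (LinearMap.range Nᵀ.mulVecLin) = N.rank := N.rank_transpose
  rw [h2, Module.finrank_fintype_fun_eq_card] at h1
  have h3 : (∀ v, v ᵥ* N = 0 → v = 0) ↔ LinearMap.ker Nᵀ.mulVecLin = ⊥ := by
    rw [LinearMap.ker_eq_bot']
    simp
  rw [h3, ← Submodule.finrank_eq_zero]
  omega

omit [Fintype μ] [DecidableEq μ] [DecidableEq π] in
theorem vecMul_rosenbrock_eq_zero_iff {𝕜 : Type} [Field 𝕜] [Algebra ℝ 𝕜] {A : Matrix ν ν ℝ}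
    {B : Matrix ν μ ℝ} {C : Matrix π ν ℝ} {s : 𝕜} {v : ν ⊕ π → 𝕜} :
    v ᵥ* rosenbrock A B C s = 0 ↔
      (v ∘ Sum.inl) ᵥ* A.map (algebraMap ℝ 𝕜) + (v ∘ Sum.inr) ᵥ* C.map (algebraMap ℝ 𝕜) =
        s • (v ∘ Sum.inl) ∧ (v ∘ Sum.inl) ᵥ* B.map (algebraMap ℝ 𝕜) = 0 := by
  have hs : Matrix.scalar ν s = s • (1 : Matrix ν ν 𝕜) := by
    rw [scalar_apply, smul_one_eq_diagonal]
  have h0 : ∀ a : ν ⊕ μ → 𝕜, a = 0 ↔ a ∘ Sum.inl = 0 ∧ a ∘ Sum.inr = 0 := fun a => by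
    refine ⟨fun h => by subst h; exact ⟨rfl, rfl⟩, fun h => funext fun i => ?_⟩
    rcases i with i | i
    · exact congrFun h.1 i
    · exact congrFun h.2 i
  rw [rosenbrock, vecMul_fromBlocks, h0, Sum.elim_comp_inl, Sum.elim_comp_inr, vecMul_zero,
    add_zero, vecMul_sub, hs, vecMul_smul, vecMul_one, sub_add_eq_add_sub, sub_eq_zero]

omit [DecidableEq μ] in
/-- For a right-invertible system the normal rank is full, so that the Rosenbrock matrix has full
row rank away from the invariant zeros. -/
theorem RightInvertible.hasFullRowRankAt {A : Matrix ν ν ℝ} {B : Matrix ν μ ℝ}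
    {C : Matrix π ν ℝ} (h : RightInvertible A B C) {z : ℂ} (hz : ¬IsInvariantZero A B C z) :
    HasFullRowRankAt A B C z := by
  obtain ⟨R, hR⟩ := h
  have hnormal : normalRank A B C = Fintype.card (ν ⊕ π) := by
    refine (rank_eq_card_iff_vecMul _).2 fun v hv => ?_
    obtain ⟨h1, h2⟩ := vecMul_rosenbrock_eq_zero_iff.1 hv
    set u := v ∘ Sum.inl with hu
    set w := v ∘ Sum.inr with hw
    set G : Matrix ν ν (RatFunc ℝ) :=
      Matrix.scalar ν (RatFunc.X : RatFunc ℝ) - A.map (algebraMap ℝ (RatFunc ℝ)) with hG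
    have hdet : IsUnit G.det := by
      have e : G = A.charmatrix.map (algebraMap (Polynomial ℝ) (RatFunc ℝ)) := by
        ext i j
        by_cases hij : i = j
        · subst hij
          simp [hG, charmatrix_apply_eq, RatFunc.algebraMap_X, RatFunc.algebraMap_C,
            RatFunc.algebraMap_eq_C]
        · simp [hG, hij, RatFunc.algebraMap_C,
            RatFunc.algebraMap_eq_C]
      rw [e, ← RingHom.mapMatrix_apply, ← RingHom.map_det, isUnit_iff_ne_zero]
      exact (map_ne_zero_iff _ (RatFunc.algebraMap_injective ℝ)).2 A.charpoly_monic.ne_zero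
    have hs : Matrix.scalar ν (RatFunc.X : RatFunc ℝ) =
        (RatFunc.X : RatFunc ℝ) • (1 : Matrix ν ν (RatFunc ℝ)) := by
      rw [scalar_apply, smul_one_eq_diagonal]
    have h3 : u ᵥ* G = w ᵥ* C.map (algebraMap ℝ (RatFunc ℝ)) := by
      rw [hG, vecMul_sub, hs, vecMul_smul, vecMul_one, ← h1, add_sub_cancel_left]
    have h4 : u = w ᵥ* (C.map (algebraMap ℝ (RatFunc ℝ)) * G⁻¹) := by
      rw [← vecMul_vecMul, ← h3, vecMul_vecMul, mul_nonsing_inv _ hdet, vecMul_one]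
    have h5 : w = 0 := by
      rw [h4, vecMul_vecMul] at h2
      have := congrArg (fun y => y ᵥ* R) h2
      simp only [zero_vecMul] at this
      rw [vecMul_vecMul] at this
      rw [transferMatrix] at hR
      rwa [hR, vecMul_one] at this
    have h6 : u = 0 := by rw [h4, h5, zero_vecMul]
    ext i
    rcases i with i | i
    · exact congrFun h6 i
    · exact congrFun h5 i
  intro u w h1 h2
  have hrank : (rosenbrock A B C z).rank = Fintype.card (ν ⊕ π) := by
    refine le_antisymm (rank_le_card_height _) ?_
    rw [← hnormal]
    exact not_lt.1 hz
  have h3 := (rank_eq_card_iff_vecMul _).1 hrank (Sum.elim u w)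
    (vecMul_rosenbrock_eq_zero_iff.2 ⟨by simpa using h1, by simpa using h2⟩)
  exact ⟨funext fun i => congrFun h3 (Sum.inl i), funext fun i => congrFun h3 (Sum.inr i)⟩

end Rosenbrock

/-! ### The regulator equations -/

section Regulator

variable {ν μ π κ : Type} [Fintype ν] [DecidableEq ν] [Fintype μ] [DecidableEq μ]
  [Fintype π] [DecidableEq π] [Fintype κ] [DecidableEq κ]

omit [Fintype μ] [DecidableEq ν] [DecidableEq μ] [DecidableEq π] in
/-- The dual of the regulator equations: generalized left eigenvectors of `Z` are annihilated one
after another, by the full row rank of the Rosenbrock matrix. -/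
theorem eq_zero_of_dual_regulator {A : Matrix ν ν ℝ} {B : Matrix ν μ ℝ} {C : Matrix π ν ℝ}
    {Z : Matrix κ κ ℝ} (h : ∀ z ∈ eigenvalues Z, HasFullRowRankAt A B C z)
    {U : Matrix κ ν ℝ} {V : Matrix κ π ℝ} (h1 : U * A + V * C = Z * U) (h2 : U * B = 0) :
    U = 0 ∧ V = 0 := by
  set Uc := U.map (algebraMap ℝ ℂ) with hUc
  set Vc := V.map (algebraMap ℝ ℂ) with hVc
  set Zc := Z.map (algebraMap ℝ ℂ) with hZc
  have h1c : Uc * A.map (algebraMap ℝ ℂ) + Vc * C.map (algebraMap ℝ ℂ) = Zc * Uc := by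
    have := congrArg (fun N : Matrix κ ν ℝ => N.map (algebraMap ℝ ℂ)) h1
    simp only [Matrix.map_add _ (map_add _), Matrix.map_mul] at this
    exact this
  have h2c : Uc * B.map (algebraMap ℝ ℂ) = 0 := by
    have := congrArg (fun N : Matrix κ μ ℝ => N.map (algebraMap ℝ ℂ)) h2
    simp only [Matrix.map_mul, Matrix.map_zero _ (map_zero _)] at this
    exact this
  set E : Module.End ℂ (κ → ℂ) := Zc.vecMulLinear with hE
  set N : Submodule ℂ (κ → ℂ) :=
    LinearMap.ker Uc.vecMulLinear ⊓ LinearMap.ker Vc.vecMulLinear with hN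
  have hmem : ∀ r, r ∈ N ↔ r ᵥ* Uc = 0 ∧ r ᵥ* Vc = 0 := fun r => by simp [hN]
  have hle : ∀ z, E.maxGenEigenspace z ≤ N := by
    intro z
    by_cases hz : z ∈ eigenvalues Z
    · intro r hr
      obtain ⟨k, hk⟩ := Module.End.mem_maxGenEigenspace _ _ _ |>.1 hr
      clear hr
      induction k generalizing r with
      | zero => simp_all
      | succ k ih =>
        have h3 : (E - z • 1) r ∈ N := ih (by rwa [pow_succ] at hk)
        have h4 : (E - z • 1) r = r ᵥ* Zc - z • r := rfl
        rw [h4, hmem, sub_vecMul, sub_eq_zero] at h3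
        refine (hmem r).2 (h z hz _ _ ?_ ?_)
        · rw [vecMul_vecMul, vecMul_vecMul, ← vecMul_add, h1c, ← vecMul_vecMul, h3.1,
            smul_vecMul]
        · rw [vecMul_vecMul, h2c, vecMul_zero]
    · intro r hr
      obtain ⟨k, hk⟩ := Module.End.mem_maxGenEigenspace _ _ _ |>.1 hr
      suffices r = 0 by rw [this]; exact N.zero_mem
      clear hr
      induction k generalizing r with
      | zero => simpa using hk
      | succ k ih =>
        have h3 : (E - z • 1) r = 0 := ih (by rwa [pow_succ] at hk)
        have h4 : (E - z • 1) r = r ᵥ* Zc - z • r := rfl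
        by_contra hne
        exact hz (mem_eigenvalues_iff_vecMul.2 ⟨r, hne, sub_eq_zero.1 (h4.symm.trans h3)⟩)
  have htop : N = ⊤ := by
    rw [eq_top_iff, ← Module.End.iSup_maxGenEigenspace_eq_top E]
    exact iSup_le hle
  have hall : ∀ r : κ → ℂ, r ᵥ* Uc = 0 ∧ r ᵥ* Vc = 0 := fun r =>
    (hmem r).1 (htop ▸ Submodule.mem_top)
  constructor
  · ext i j
    have := congrFun (hall (Pi.single i 1)).1 j
    rw [single_one_vecMul] at this
    simpa [hUc] using this
  · ext i j
    have := congrFun (hall (Pi.single i 1)).2 j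
    rw [single_one_vecMul] at this
    simpa [hVc] using this

omit [DecidableEq μ] in
/-- The regulator equations are solvable if the Rosenbrock matrix has full row rank at the
eigenvalues of the exosystem `Z`: a functional that annihilates the range of the regulator operator
solves the dual equations. -/
theorem exists_regulator {A : Matrix ν ν ℝ} {B : Matrix ν μ ℝ} {C : Matrix π ν ℝ}
    {Z : Matrix κ κ ℝ} (h : ∀ z ∈ eigenvalues Z, HasFullRowRankAt A B C z)
    (Y₁ : Matrix ν κ ℝ) (Y₂ : Matrix π κ ℝ) :
    ∃ (X : Matrix ν κ ℝ) (Γ : Matrix μ κ ℝ), X * Z = A * X + Y₁ + B * Γ ∧ C * X = Y₂ := by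
  let Ψ : (Matrix ν κ ℝ × Matrix μ κ ℝ) →ₗ[ℝ] (Matrix ν κ ℝ × Matrix π κ ℝ) :=
    { toFun := fun x => (x.1 * Z - A * x.1 - B * x.2, C * x.1)
      map_add' := fun x y => by
        refine Prod.ext ?_ (Matrix.mul_add _ _ _)
        simp only [Prod.fst_add, Prod.snd_add, Matrix.mul_add, Matrix.add_mul]
        abel
      map_smul' := fun c x => by
        refine Prod.ext ?_ (Matrix.mul_smul _ _ _)
        simp only [Prod.smul_fst, Prod.smul_snd, Matrix.mul_smul, Matrix.smul_mul, smul_sub,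
          RingHom.id_apply] }
  suffices hsurj : LinearMap.range Ψ = ⊤ by
    obtain ⟨⟨X, Γ⟩, hX⟩ := LinearMap.range_eq_top.1 hsurj (Y₁, Y₂)
    have e1 : X * Z - A * X - B * Γ = Y₁ := congrArg Prod.fst hX
    refine ⟨X, Γ, ?_, congrArg Prod.snd hX⟩
    rw [← e1]
    abel
  by_contra hne
  obtain ⟨φ, hφ, hle⟩ := Submodule.exists_le_ker_of_lt_top _ (lt_top_iff_ne_top.2 hne)
  -- represent the annihilating functional by the trace form
  set U : Matrix κ ν ℝ := Matrix.of fun j i => φ (Matrix.single i j 1, 0) with hU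
  set V : Matrix κ π ℝ := Matrix.of fun j i => φ (0, Matrix.single i j 1) with hV
  have hrep : ∀ Y Y', φ (Y, Y') = (U * Y).trace + (V * Y').trace := by
    intro Y Y'
    have e1 : φ.comp (LinearMap.inl ℝ (Matrix ν κ ℝ) (Matrix π κ ℝ)) =
        (Matrix.traceLinearMap κ ℝ ℝ).comp (mulLeftLinearMap κ ℝ U) := by
      refine Matrix.ext_linearMap ℝ fun i j => LinearMap.ext_ring ?_
      simp [hU, Matrix.singleLinearMap, trace_mul_single]
    have e2 : φ.comp (LinearMap.inr ℝ (Matrix ν κ ℝ) (Matrix π κ ℝ)) =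
        (Matrix.traceLinearMap κ ℝ ℝ).comp (mulLeftLinearMap κ ℝ V) := by
      refine Matrix.ext_linearMap ℝ fun i j => LinearMap.ext_ring ?_
      simp [hV, Matrix.singleLinearMap, trace_mul_single]
    have e3 : φ (Y, 0) = (U * Y).trace := LinearMap.congr_fun e1 Y
    have e4 : φ (0, Y') = (V * Y').trace := LinearMap.congr_fun e2 Y'
    rw [← e3, ← e4, ← map_add]
    simp
  have hzero : ∀ (X : Matrix ν κ ℝ) (Γ : Matrix μ κ ℝ),
      (U * (X * Z - A * X - B * Γ)).trace + (V * (C * X)).trace = 0 :=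
    fun X Γ => by
      rw [← hrep]
      exact hle ⟨(X, Γ), rfl⟩
  have d1 : Z * U - U * A + V * C = 0 := by
    refine ext_iff_trace_mul_right.2 fun X => ?_
    have h3 := hzero X 0
    rw [Matrix.mul_zero, sub_zero, Matrix.mul_sub, trace_sub, ← Matrix.mul_assoc U X Z,
      trace_mul_comm (U * X) Z, ← trace_sub, ← trace_add] at h3
    rw [Matrix.zero_mul, trace_zero, ← h3]
    simp only [Matrix.add_mul, Matrix.sub_mul, Matrix.mul_assoc]
  have d2 : U * B = 0 := by
    refine ext_iff_trace_mul_right.2 fun Γ => ?_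
    have h3 := hzero 0 Γ
    simp only [Matrix.mul_zero, Matrix.zero_mul, sub_zero, zero_sub, trace_zero, add_zero,
      Matrix.mul_neg, trace_neg, neg_eq_zero] at h3
    rw [Matrix.zero_mul, trace_zero, Matrix.mul_assoc, h3]
  obtain ⟨hU0, hV0⟩ := eq_zero_of_dual_regulator h (U := U) (V := -V)
    (by rw [Matrix.neg_mul, ← sub_eq_add_neg, sub_eq_iff_eq_add, ← sub_eq_zero, ← neg_eq_zero,
      ← d1]; abel) d2
  refine hφ (LinearMap.ext fun x => ?_)
  obtain ⟨Y, Y'⟩ := x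
  rw [hrep, hU0, neg_eq_zero.1 hV0]
  simp

end Regulator

/-! ### Quotient systems -/

section Quotient

variable {ν ν' μ π : Type} [Fintype ν] [DecidableEq ν] [Fintype ν'] [DecidableEq ν']
  [Fintype μ] [DecidableEq μ] [Fintype π] [DecidableEq π]

/-- The quotient map `T` by a subspace `N`, in coordinates, with a section `R`. -/
theorem exists_quotient (N : Submodule ℝ (ν → ℝ)) :
    ∃ (k : ℕ) (T : Matrix (Fin k) ν ℝ) (R : Matrix ν (Fin k) ℝ),
      T * R = 1 ∧ ∀ x, T *ᵥ x = 0 ↔ x ∈ N := by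
  set e := (Module.finBasis ℝ ((ν → ℝ) ⧸ N)).equivFun with he
  set g : (ν → ℝ) →ₗ[ℝ] (Fin (Module.finrank ℝ ((ν → ℝ) ⧸ N)) → ℝ) :=
    e.toLinearMap ∘ₗ N.mkQ with hg
  have hsurj : LinearMap.range g = ⊤ := by
    rw [hg, LinearMap.range_comp, Submodule.range_mkQ, Submodule.map_top, LinearEquiv.range]
  obtain ⟨r, hr⟩ := g.exists_rightInverse_of_surjective hsurj
  refine ⟨_, LinearMap.toMatrix' g, LinearMap.toMatrix' r, ?_, fun x => ?_⟩
  · rw [← LinearMap.toMatrix'_comp, hr, LinearMap.toMatrix'_id]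
  · rw [LinearMap.toMatrix'_mulVec, hg, LinearMap.comp_apply]
    simp

omit [DecidableEq ν] [Fintype μ] [DecidableEq μ] [Fintype π] [DecidableEq π] in
/-- A matrix that vanishes on the kernel of the quotient map `T` factors through `T`. -/
theorem mul_mul_eq_of_ker_le {T : Matrix ν' ν ℝ} {R : Matrix ν ν' ℝ} (hTR : T * R = 1)
    (N : Matrix μ ν ℝ) (h : ∀ x, T *ᵥ x = 0 → N *ᵥ x = 0) : N * R * T = N := by
  classical
  refine ext_of_mulVec_single fun j => ?_
  have h1 : T *ᵥ (Pi.single j 1 - R *ᵥ (T *ᵥ Pi.single j 1)) = 0 := by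
    have e : T *ᵥ (R *ᵥ (T *ᵥ Pi.single j 1)) = T *ᵥ Pi.single j 1 := by
      rw [mulVec_mulVec _ T R, hTR, one_mulVec]
    rw [mulVec_sub, e, sub_self]
  have h2 := h _ h1
  rw [mulVec_sub, sub_eq_zero] at h2
  rw [h2, mulVec_mulVec, mulVec_mulVec, Matrix.mul_assoc]

omit [DecidableEq ν] in
theorem eq_zero_of_vecMul_map_eq_zero {T : Matrix ν' ν ℝ} {R : Matrix ν ν' ℝ} (hTR : T * R = 1)
    {v : ν' → ℂ} (h : v ᵥ* T.map (algebraMap ℝ ℂ) = 0) : v = 0 := by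
  have h1 := congrArg (fun y => y ᵥ* R.map (algebraMap ℝ ℂ)) h
  simp only [vecMul_vecMul, ← Matrix.map_mul, hTR, zero_vecMul] at h1
  rwa [Matrix.map_one _ (map_zero _) (map_one _), vecMul_one] at h1

omit [DecidableEq ν] [DecidableEq ν'] in
theorem vecMul_map_of_intertwine {T : Matrix ν' ν ℝ} {A : Matrix ν ν ℝ} {A' : Matrix ν' ν' ℝ}
    (h : T * A = A' * T) (v : ν' → ℂ) :
    (v ᵥ* T.map (algebraMap ℝ ℂ)) ᵥ* A.map (algebraMap ℝ ℂ) =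
      (v ᵥ* A'.map (algebraMap ℝ ℂ)) ᵥ* T.map (algebraMap ℝ ℂ) := by
  rw [vecMul_vecMul, vecMul_vecMul, ← Matrix.map_mul, ← Matrix.map_mul, h]

theorem eigenvalues_quotient_subset {T : Matrix ν' ν ℝ} {R : Matrix ν ν' ℝ} (hTR : T * R = 1)
    {A : Matrix ν ν ℝ} {A' : Matrix ν' ν' ℝ} (h : T * A = A' * T) :
    eigenvalues A' ⊆ eigenvalues A := by
  intro z hz
  obtain ⟨v, hv, hvz⟩ := mem_eigenvalues_iff_vecMul.1 hz
  refine mem_eigenvalues_iff_vecMul.2 ⟨v ᵥ* T.map (algebraMap ℝ ℂ),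
    fun h0 => hv (eq_zero_of_vecMul_map_eq_zero hTR h0), ?_⟩
  rw [vecMul_map_of_intertwine h, hvz, smul_vecMul]

omit [DecidableEq ν] [DecidableEq μ] [Fintype μ] [DecidableEq π] in
theorem HasFullRowRankAt.quotient {A : Matrix ν ν ℝ} {B : Matrix ν μ ℝ} {C : Matrix π ν ℝ}
    {z : ℂ} (h : HasFullRowRankAt A B C z) {T : Matrix ν' ν ℝ} {R : Matrix ν ν' ℝ}
    (hTR : T * R = 1) {A' : Matrix ν' ν' ℝ} {C' : Matrix π ν' ℝ} (hA : T * A = A' * T)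
    (hC : C' * T = C) : HasFullRowRankAt A' (T * B) C' z := by
  intro u w h1 h2
  have h3 := h (u ᵥ* T.map (algebraMap ℝ ℂ)) w ?_ ?_
  · exact ⟨eq_zero_of_vecMul_map_eq_zero hTR h3.1, h3.2⟩
  · rw [vecMul_map_of_intertwine hA, ← hC, Matrix.map_mul, ← vecMul_vecMul, ← add_vecMul, h1,
      smul_vecMul]
  · rw [vecMul_vecMul, ← Matrix.map_mul, h2]

omit [DecidableEq μ] in
/-- Stabilizability passes to quotients. It is equivalent to the solvability of
`A P + P Aᵀ < 2 γ B Bᵀ` with `P > 0`, and this inequality can be conjugated by the quotient map. -/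
theorem Stabilizable.quotient {A : Matrix ν ν ℝ} {B : Matrix ν μ ℝ} (h : Stabilizable A B)
    {T : Matrix ν' ν ℝ} {R : Matrix ν ν' ℝ} (hTR : T * R = 1) {A' : Matrix ν' ν' ℝ}
    (hA : T * A = A' * T) : Stabilizable A' (T * B) := by
  obtain ⟨K, hK⟩ := h
  obtain ⟨P, hP, hlyap⟩ := hK.exists_lyapunov_posDef (PosDef.one (n := ν) (R := ℝ))
  have hPr := posDef_iff_real.1 hP
  set N := K * P with hN
  set c := absSum (Nᵀ * N) with hc
  have hc0 : 0 ≤ c := Finset.sum_nonneg fun _ _ => Finset.sum_nonneg fun _ _ => abs_nonneg _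
  set γ := c + 1 with hγ
  have hγ0 : 0 < γ := by positivity
  have hT : ∀ y : ν' → ℝ, y ≠ 0 → Tᵀ *ᵥ y ≠ 0 := fun y hy h0 => hy <| by
    have := congrArg (fun v => Rᵀ *ᵥ v) h0
    simpa only [mulVec_mulVec, ← transpose_mul, hTR, transpose_one, one_mulVec, mulVec_zero]
      using this
  have hineq : ∀ x, x ≠ 0 → x ⬝ᵥ (A * P + P * Aᵀ - (2 * γ) • (B * Bᵀ)) *ᵥ x < 0 := fun x hx => by
    have e : A * P + P * Aᵀ = -1 - (B * N + (B * N)ᵀ) := by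
      rw [← hlyap, hN]
      simp only [transpose_add, transpose_mul, hPr.1, Matrix.add_mul, Matrix.mul_add,
        Matrix.mul_assoc]
      abel
    set u := Bᵀ *ᵥ x with hu
    set v := N *ᵥ x with hv
    have h1 : x ⬝ᵥ (B * N) *ᵥ x = u ⬝ᵥ v := by
      rw [← mulVec_mulVec, dotProduct_mulVec, ← mulVec_transpose]
    have h2 : x ⬝ᵥ (B * Bᵀ) *ᵥ x = u ⬝ᵥ u := by
      rw [← mulVec_mulVec, dotProduct_mulVec, ← mulVec_transpose]
    have h3 : v ⬝ᵥ v ≤ c * (x ⬝ᵥ x) := by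
      rw [hv, ← dotProduct_transpose_mul_self]
      exact dotProduct_mulVec_le_absSum _ _
    have h4 : 0 ≤ ((2 * γ) • u + v) ⬝ᵥ ((2 * γ) • u + v) := dotProduct_self_nonneg' _
    have h5 : ((2 * γ) • u + v) ⬝ᵥ ((2 * γ) • u + v) =
        (2 * γ) ^ 2 * (u ⬝ᵥ u) + 2 * (2 * γ) * (u ⬝ᵥ v) + v ⬝ᵥ v := by
      simp only [add_dotProduct, dotProduct_add, smul_dotProduct, dotProduct_smul, smul_eq_mul,
        dotProduct_comm v u]
      ring
    rw [e, sub_mulVec, dotProduct_sub, sub_mulVec, dotProduct_sub, neg_mulVec, one_mulVec,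
      dotProduct_neg, add_mulVec, dotProduct_add, dotProduct_transpose_mulVec, h1, smul_mulVec,
      dotProduct_smul, h2, smul_eq_mul]
    have h6 := dotProduct_self_pos hx
    rw [h5] at h4
    have h7 : 2 * γ * (-(x ⬝ᵥ x) - (u ⬝ᵥ v + u ⬝ᵥ v) - 2 * γ * (u ⬝ᵥ u)) < 2 * γ * 0 := by
      nlinarith
    exact lt_of_mul_lt_mul_left h7 (by positivity)
  set P' := T * P * Tᵀ with hP'
  have hP'd : P'.PosDef := by
    refine posDef_iff_real.2 ⟨?_, fun y hy => ?_⟩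
    · simp [hP', transpose_mul, hPr.1, Matrix.mul_assoc]
    · rw [hP', dotProduct_conj_mulVec]
      exact hPr.2 _ (hT y hy)
  have hu := (Matrix.isUnit_iff_isUnit_det _).1 hP'd.isUnit
  have hP'i : P'⁻¹ᵀ = P'⁻¹ := by rw [transpose_nonsing_inv, (posDef_iff_real.1 hP'd).1]
  refine ⟨-(γ • ((T * B)ᵀ * P'⁻¹)), isHurwitz_of_lyapunov hP'd fun y hy => ?_⟩
  have e : (A' + T * B * -(γ • ((T * B)ᵀ * P'⁻¹))) * P' +
      P' * (A' + T * B * -(γ • ((T * B)ᵀ * P'⁻¹)))ᵀ =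
      T * (A * P + P * Aᵀ - (2 * γ) • (B * Bᵀ)) * Tᵀ := by
    have e1 : A' * P' = T * (A * P) * Tᵀ := by
      rw [hP', ← Matrix.mul_assoc, ← Matrix.mul_assoc, ← hA]
      simp only [Matrix.mul_assoc]
    have e2 : P' * A'ᵀ = T * (P * Aᵀ) * Tᵀ := by
      have := congrArg transpose e1
      simpa only [transpose_mul, transpose_transpose, hPr.1, (posDef_iff_real.1 hP'd).1,
        Matrix.mul_assoc] using this
    have e3 : (T * B * -(γ • ((T * B)ᵀ * P'⁻¹))) * P' = -(γ • (T * (B * Bᵀ) * Tᵀ)) := by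
      rw [Matrix.mul_neg, Matrix.neg_mul, Matrix.mul_smul, Matrix.smul_mul,
        ← Matrix.mul_assoc (T * B), Matrix.mul_assoc (T * B * (T * B)ᵀ), nonsing_inv_mul _ hu,
        Matrix.mul_one]
      simp only [transpose_mul, Matrix.mul_assoc]
    have e4 : P' * (T * B * -(γ • ((T * B)ᵀ * P'⁻¹)))ᵀ = -(γ • (T * (B * Bᵀ) * Tᵀ)) := by
      have := congrArg transpose e3
      rw [transpose_mul, (posDef_iff_real.1 hP'd).1] at this
      rw [this]
      simp only [transpose_neg, transpose_smul, transpose_mul, transpose_transpose,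
        Matrix.mul_assoc]
    rw [transpose_add, Matrix.add_mul, Matrix.mul_add, e1, e2, e3, e4]
    simp only [Matrix.mul_sub, Matrix.sub_mul, Matrix.mul_add, Matrix.add_mul, Matrix.mul_smul,
      Matrix.smul_mul]
    module
  rw [e, dotProduct_conj_mulVec]
  exact hineq _ (hT y hy)

omit [Fintype π] [DecidableEq π] in
/-- The observable quotient of a system. -/
theorem exists_observable_quotient (A : Matrix ν ν ℝ) (C : Matrix π ν ℝ) :
    ∃ (k : ℕ) (T : Matrix (Fin k) ν ℝ) (R : Matrix ν (Fin k) ℝ) (A' : Matrix (Fin k) (Fin k) ℝ)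
      (C' : Matrix π (Fin k) ℝ),
      T * R = 1 ∧ T * A = A' * T ∧ C' * T = C ∧ Observable A' C' := by
  set N : Submodule ℝ (ν → ℝ) := ⨅ k : ℕ, LinearMap.ker (C * A ^ k).mulVecLin with hN
  have hmem : ∀ x, x ∈ N ↔ ∀ k : ℕ, (C * A ^ k) *ᵥ x = 0 := fun x => by
    simp [hN, Submodule.mem_iInf]
  obtain ⟨k, T, R, hTR, hker⟩ := exists_quotient N
  have hA : T * A * R * T = T * A := mul_mul_eq_of_ker_le hTR _ fun x hx => by
    rw [← mulVec_mulVec, hker, hmem]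
    intro k
    have := (hmem x).1 ((hker x).1 hx) (k + 1)
    rwa [pow_succ, ← Matrix.mul_assoc, ← mulVec_mulVec] at this
  have hC : C * R * T = C := mul_mul_eq_of_ker_le hTR _ fun x hx => by
    simpa using (hmem x).1 ((hker x).1 hx) 0
  refine ⟨k, T, R, T * A * R, C * R, hTR, hA.symm, hC, fun y hy => ?_⟩
  have hpow : ∀ k : ℕ, C * R * (T * A * R) ^ k * T = C * A ^ k := by
    intro k
    induction k with
    | zero => simpa using hC
    | succ k ih => rw [pow_succ, ← Matrix.mul_assoc, Matrix.mul_assoc _ (T * A * R), hA,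
        ← Matrix.mul_assoc, ih, Matrix.mul_assoc, pow_succ]
  have h1 : T *ᵥ (R *ᵥ y) = y := by rw [mulVec_mulVec, hTR, one_mulVec]
  rw [← h1, hker, hmem]
  intro k
  rw [← hpow, ← mulVec_mulVec, h1, hy]

end Quotient

/-! ### Existence of design data -/

section DesignExistence

variable {M p : ℕ}

/-- If agent `f` is observable, the null space of the observability matrix of the pair is a graph
over a subspace of the state space of the root; this gives the coordinates. -/
theorem nonempty_coordinates (S : MAS M p) (f : Fin M)
    (hobs : Observable (S.A f.succ) (S.C f.succ)) : Nonempty (Coordinates S f) := by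
  set N := LinearMap.ker (S.pairObs f).mulVecLin with hN
  set b := Module.finBasis ℝ N with hb
  set W : Matrix (Fin (S.n f.succ) ⊕ Fin (S.n 0)) (Fin (Module.finrank ℝ N)) ℝ :=
    Matrix.of fun i j => (b j : Fin (S.n f.succ) ⊕ Fin (S.n 0) → ℝ) i with hW
  have hWmul : ∀ ξ, W *ᵥ ξ = ((∑ j, ξ j • b j : N) : Fin (S.n f.succ) ⊕ Fin (S.n 0) → ℝ) := by
    intro ξ
    ext i
    simp [hW, mulVec, dotProduct, mul_comm]
  have hinj : ∀ ξ, W *ᵥ ξ = 0 → ξ = 0 := fun ξ h => by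
    rw [hWmul, ZeroMemClass.coe_eq_zero] at h
    exact funext fun j => Fintype.linearIndependent_iff.1 b.linearIndependent ξ h j
  have hnull : S.pairObs f * W = 0 := by
    refine ext_of_mulVec_single fun j => ?_
    rw [← mulVec_mulVec, hWmul, zero_mulVec]
    exact (∑ i, (Pi.single j (1 : ℝ) : _ → ℝ) i • b i : N).2
  have hrank : W.rank = Module.finrank ℝ N := by
    have h1 := (rank_eq_card_iff_vecMul Wᵀ).2 fun v hv => hinj v (by rwa [vecMul_transpose] at hv)
    rwa [rank_transpose, Fintype.card_fin] at h1
  set Λu := W.toRows₁ with hΛu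
  set Φu := W.toRows₂ with hΦu
  have hWr : fromRows Λu Φu = W := fromRows_toRows W
  -- `Φu` has full column rank
  have hΦinj : ∀ ξ, Φu *ᵥ ξ = 0 → ξ = 0 := fun ξ h => by
    have hsplit : W *ᵥ ξ = Sum.elim (Λu *ᵥ ξ) 0 := by
      rw [← hWr, fromRows_mulVec, h]
    have hk : ∀ k : ℕ, (S.pairC f * S.pairA f ^ k) *ᵥ Sum.elim (Λu *ᵥ ξ) 0 = 0 := by
      refine (S.pairObs_mulVec_eq_zero_iff f).1 ?_
      rw [← hsplit, mulVec_mulVec, hnull, zero_mulVec]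
    have hpow : ∀ k : ℕ, S.pairA f ^ k = fromBlocks (S.A f.succ ^ k) 0 0 (S.A 0 ^ k) := by
      intro k
      induction k with
      | zero => simp
      | succ k ih => rw [pow_succ, ih, MAS.pairA, fromBlocks_multiply]; simp [pow_succ]
    have h0 : Λu *ᵥ ξ = 0 := hobs _ fun k => by
      have := hk k
      rw [hpow, MAS.pairC, fromCols_mul_fromBlocks, fromCols_mulVec_sumElim] at this
      simpa using this
    refine hinj ξ ?_
    rw [hsplit, h0]
    ext i
    rcases i with i | i <;> rfl
  obtain ⟨k, T, R, hTR, hker⟩ := exists_quotient (LinearMap.range Φu.mulVecLin)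
  obtain ⟨g, hg⟩ := Φu.mulVecLin.exists_leftInverse_of_injective
    (LinearMap.ker_eq_bot'.2 hΦinj)
  set G := LinearMap.toMatrix' g with hG
  have hGΦ : G * Φu = 1 := by
    have := congrArg LinearMap.toMatrix' hg
    rwa [LinearMap.toMatrix'_comp, LinearMap.toMatrix'_id, ← Matrix.toLin'_apply',
      LinearMap.toMatrix'_toLin'] at this
  have hTΦ : T * Φu = 0 := ext_of_mulVec_single fun j => by
    rw [← mulVec_mulVec, zero_mulVec]
    exact (hker _).2 ⟨_, rfl⟩
  have hproj : Φu * (G * (1 - R * T)) = 1 - R * T := ext_of_mulVec_single fun j => by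
    have h1 : T *ᵥ ((1 - R * T) *ᵥ Pi.single j 1) = 0 := by
      rw [mulVec_mulVec, Matrix.mul_sub, ← Matrix.mul_assoc, hTR, Matrix.mul_one,
        Matrix.one_mul, sub_self, zero_mulVec]
    obtain ⟨ξ, hξ⟩ := (hker _).1 h1
    rw [mulVecLin_apply] at hξ
    rw [← mulVec_mulVec, ← mulVec_mulVec, ← hξ, mulVec_mulVec ξ G Φu, hGΦ, one_mulVec]
  refine ⟨{
    q := Module.finrank ℝ N
    k := k
    Λu := Λu
    Φu := Φu
    Φc := R
    Φinv := fromRows (G * (1 - R * T)) T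
    q_eq := rfl
    null := by rw [hWr, hnull]
    rank_eq := by rw [hWr, hrank]
    mul_inv := by
      rw [fromCols_mul_fromRows, hproj]
      simp
    inv_mul := by
      rw [fromRows_mul_fromCols, ← fromBlocks_one, fromBlocks_inj]
      refine ⟨?_, ?_, hTΦ, hTR⟩
      · rw [Matrix.mul_assoc, Matrix.sub_mul, Matrix.mul_assoc R, hTΦ]
        simpa using hGΦ
      · rw [Matrix.mul_assoc, Matrix.sub_mul, Matrix.mul_assoc R, hTR]
        simp }⟩

/-- The eigenvalues of `A22` are eigenvalues of the root, so that the regulator equations are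
solvable. -/
theorem nonempty_design (S : MAS M p) (f : Fin M)
    (hobs : Observable (S.A f.succ) (S.C f.succ))
    (hstab : Stabilizable (S.A f.succ) (S.B f.succ))
    (hfull : ∀ z ∈ eigenvalues (S.A 0),
      HasFullRowRankAt (S.A f.succ) (S.B f.succ) (S.C f.succ) z) : Nonempty (Design S f) := by
  obtain ⟨D⟩ := nonempty_coordinates S f hobs
  obtain ⟨K, hK⟩ := hstab
  obtain ⟨X, Γ, h1, h2⟩ := exists_regulator (Z := D.A22) (fun z hz => hfull z
    (eigenvalues_quotient_subset D.inv_mul_blocks.2.2.2 D.A0_mul_rows₂ hz)) D.A12 D.C2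
  exact ⟨⟨D, K, Γ, X, hK, h1, h2⟩⟩

end DesignExistence

/-! ### Removal of the stable modes -/

section StableModes

open Polynomial in
/-- The roots of an irreducible real polynomial are conjugate, so that the irreducible factors of
a real polynomial can be distributed over the two half planes. -/
theorem exists_mul_eq_re_neg_re_nonneg (p : ℝ[X]) (hp : p ≠ 0) :
    ∃ s u : ℝ[X], p = s * u ∧ (∀ z : ℂ, aeval z s = 0 → z.re < 0) ∧
      ∀ z : ℂ, aeval z u = 0 → 0 ≤ z.re := by
  induction p using WfDvdMonoid.induction_on_irreducible with
  | zero => exact absurd rfl hp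
  | unit u hu =>
    refine ⟨1, u, (one_mul u).symm, fun z hz => ?_, fun z hz => ?_⟩
    · simp at hz
    · exact absurd hz (hu.map (aeval z)).ne_zero
  | mul a i ha hi ih =>
    obtain ⟨s, u, rfl, hs, hu⟩ := ih ha
    have hre : ∀ z w : ℂ, aeval z i = 0 → aeval w i = 0 → z.re = w.re := fun z w hz hw => by
      have h1 : IsConjRoot ℝ z w :=
        (minpoly.eq_of_irreducible hi hz).symm.trans (minpoly.eq_of_irreducible hi hw)
      have : IsAlgClosure ℝ ℂ := ⟨inferInstance, inferInstance⟩
      have : Normal ℝ ℂ := IsAlgClosure.normal ℝ ℂ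
      obtain ⟨σ, rfl⟩ := isConjRoot_iff_exists_algEquiv.1 h1
      rcases Complex.real_algHom_eq_id_or_conj σ.toAlgHom with h | h
      · have : σ w = w := congrArg (fun g : ℂ →ₐ[ℝ] ℂ => g w) h
        rw [this]
      · have : σ w = Complex.conjAe w := congrArg (fun g : ℂ →ₐ[ℝ] ℂ => g w) h
        rw [this]
        simp
    by_cases h : ∀ z : ℂ, aeval z i = 0 → z.re < 0
    · refine ⟨i * s, u, by ring, fun z hz => ?_, hu⟩
      rw [map_mul, mul_eq_zero] at hz
      exact hz.elim (h z) (hs z)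
    · push Not at h
      obtain ⟨w, hw, hw0⟩ := h
      refine ⟨s, i * u, by ring, hs, fun z hz => ?_⟩
      rw [map_mul, mul_eq_zero] at hz
      exact hz.elim (fun hz => hre w z hw hz ▸ hw0) (hu z)

variable {ν : Type} [Fintype ν] [DecidableEq ν]

theorem vecMul_map_aeval {A : Matrix ν ν ℝ} {v : ν → ℂ} {z : ℂ}
    (h : v ᵥ* A.map (algebraMap ℝ ℂ) = z • v) (p : Polynomial ℝ) :
    v ᵥ* (Polynomial.aeval A p).map (algebraMap ℝ ℂ) = Polynomial.aeval z p • v := by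
  induction p using Polynomial.induction_on with
  | C a =>
    rw [Polynomial.aeval_C, Polynomial.aeval_C, Algebra.algebraMap_eq_smul_one,
      Matrix.map_smul' _ _ _ (map_mul _), Matrix.map_one _ (map_zero _) (map_one _), vecMul_smul,
      vecMul_one]
  | add p q hp hq =>
    rw [map_add, map_add, Matrix.map_add _ (map_add _), vecMul_add, hp, hq, add_smul]
  | monomial n a ih =>
    rw [pow_succ, ← mul_assoc, map_mul _ (_ * _), map_mul _ (_ * _) Polynomial.X,
      Polynomial.aeval_X, Polynomial.aeval_X, Matrix.map_mul, ← vecMul_vecMul, ih, smul_vecMul, h,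
      smul_smul]

/-- The quotient `z' = A' z` of an autonomous system by its stable modes. What the quotient loses
of the output vanishes along all trajectories. -/
theorem exists_antistable_quotient {π : Type} [Fintype π] (A : Matrix ν ν ℝ)
    (C : Matrix π ν ℝ) :
    ∃ (k : ℕ) (T : Matrix (Fin k) ν ℝ) (A' : Matrix (Fin k) (Fin k) ℝ)
      (C' : Matrix π (Fin k) ℝ), T * A = A' * T ∧
      (∀ z ∈ eigenvalues A', z ∈ eigenvalues A ∧ 0 ≤ z.re) ∧
      ∀ x : ℝ → ν → ℝ, (∀ t > 0, HasDerivAt x (A *ᵥ x t) t) →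
        Tendsto (fun t => (C - C' * T) *ᵥ x t) atTop (𝓝 0) := by
  obtain ⟨s, u, hsu, hs, hu⟩ :=
    exists_mul_eq_re_neg_re_nonneg A.charpoly A.charpoly_monic.ne_zero
  have hcop : IsCoprime s u := by
    refine (Polynomial.isCoprime_iff_aeval_ne_zero_of_isAlgClosed ℝ ℂ s u).2 fun z => ?_
    by_contra! h
    exact absurd (hs z h.1) (not_lt.2 (hu z h.2))
  obtain ⟨a, b, hab⟩ := hcop
  -- `Eu` and `Es` are the projections onto the antistable and the stable modes
  set Eu := Polynomial.aeval A (a * s) with hEu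
  set Es := Polynomial.aeval A (b * u) with hEs
  have hsum : Eu + Es = 1 := by rw [hEu, hEs, ← map_add, hab, map_one]
  have hEuA : Eu * A = A * Eu := by
    have : Polynomial.aeval A (a * s * Polynomial.X) =
        Polynomial.aeval A (Polynomial.X * (a * s)) := by rw [mul_comm]
    rwa [map_mul, map_mul _ Polynomial.X, Polynomial.aeval_X] at this
  have hEsA : Es * A = A * Es := by
    have : Polynomial.aeval A (b * u * Polynomial.X) =
        Polynomial.aeval A (Polynomial.X * (b * u)) := by rw [mul_comm]
    rwa [map_mul, map_mul _ Polynomial.X, Polynomial.aeval_X] at this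
  have hEus : Eu * Es = 0 := by
    rw [hEu, hEs, ← map_mul, mul_mul_mul_comm, ← hsu, map_mul,
      Matrix.aeval_self_charpoly, mul_zero]
  have hEuu : Eu * Eu = Eu := by
    have := congrArg (Eu * ·) hsum
    simpa [Matrix.mul_add, hEus] using this
  have hEss : Es * Es = Es := by
    have := congrArg (· * Es) hsum
    simpa [Matrix.add_mul, hEus] using this
  have hEsu : Es * Eu = 0 := by
    have := congrArg (· * Eu) hsum
    simpa [Matrix.add_mul, hEuu] using this
  have hEuu0 : Eu * Polynomial.aeval A u = 0 := by
    rw [hEu, ← map_mul, mul_assoc, ← hsu, map_mul,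
      Matrix.aeval_self_charpoly, mul_zero]
  have hEss0 : Es * Polynomial.aeval A s = 0 := by
    rw [hEs, ← map_mul, mul_assoc, mul_comm u, ← hsu, map_mul,
      Matrix.aeval_self_charpoly, mul_zero]
  obtain ⟨k, T, R, hTR, hker⟩ := exists_quotient (LinearMap.ker Eu.mulVecLin)
  have hker' : ∀ x, T *ᵥ x = 0 ↔ Eu *ᵥ x = 0 := fun x => by rw [hker]; rfl
  have hEuT : Eu * R * T = Eu := mul_mul_eq_of_ker_le hTR _ fun x hx => (hker' x).1 hx
  have hA : T * A * R * T = T * A := mul_mul_eq_of_ker_le hTR _ fun x hx => by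
    rw [← mulVec_mulVec, hker', mulVec_mulVec, hEuA, ← mulVec_mulVec, (hker' x).1 hx, mulVec_zero]
  have hTEs : T * Es = 0 := ext_of_mulVec_single fun j => by
    rw [← mulVec_mulVec, zero_mulVec, hker', mulVec_mulVec, hEus, zero_mulVec]
  have hTEu : T * Eu = T := by
    have := congrArg (T * ·) hsum
    simpa [Matrix.mul_add, hTEs] using this
  refine ⟨k, T, T * A * R, C * (Eu * R), hA.symm, fun z hz => ?_, fun x hx => ?_⟩
  · refine ⟨eigenvalues_quotient_subset hTR hA.symm hz, hu z ?_⟩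
    obtain ⟨v, hv, hvz⟩ := mem_eigenvalues_iff_vecMul.1 hz
    have h1 : (v ᵥ* T.map (algebraMap ℝ ℂ)) ᵥ* A.map (algebraMap ℝ ℂ) =
        z • (v ᵥ* T.map (algebraMap ℝ ℂ)) := by
      rw [vecMul_map_of_intertwine hA.symm, hvz, smul_vecMul]
    have h2 := vecMul_map_aeval h1 u
    rw [vecMul_vecMul, ← Matrix.map_mul, ← hTEu, Matrix.mul_assoc, hEuu0, Matrix.mul_zero,
      Matrix.map_zero _ (map_zero _), vecMul_zero, hTEu] at h2
    exact (smul_eq_zero.1 h2.symm).resolve_right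
      fun h0 => hv (eq_zero_of_vecMul_map_eq_zero hTR h0)
  · -- on the antistable modes, where the trajectory vanishes, `A` is replaced by `-1`
    have hH : IsHurwitz (A * Es - Eu) := fun z hz => by
      obtain ⟨v, hv, hvz⟩ := mem_eigenvalues_iff_vecMul.1 hz
      set ι : Matrix ν ν ℝ → Matrix ν ν ℂ := fun N => N.map (algebraMap ℝ ℂ) with hι
      have hmul : ∀ N N' : Matrix ν ν ℝ, ι (N * N') = ι N * ι N' := fun N N' => Matrix.map_mul
      have e1 : (A * Es - Eu) * Eu = -Eu := by
        rw [Matrix.sub_mul, Matrix.mul_assoc, hEsu, Matrix.mul_zero, hEuu, zero_sub]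
      have e2 : (A * Es - Eu) * Es = Es * A := by
        rw [Matrix.sub_mul, Matrix.mul_assoc, hEss, hEus, sub_zero, hEsA]
      have h1 : z • (v ᵥ* ι Eu) = -(v ᵥ* ι Eu) := by
        rw [← smul_vecMul, ← hvz, vecMul_vecMul, ← Matrix.map_mul, e1,
          Matrix.map_neg _ (map_neg _), vecMul_neg]
      have h2 : (v ᵥ* ι Es) ᵥ* ι A = z • (v ᵥ* ι Es) := by
        rw [← smul_vecMul, ← hvz, vecMul_vecMul, vecMul_vecMul, ← hmul, ← Matrix.map_mul, e2]
      by_cases h0 : v ᵥ* ι Eu = 0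
      · have h3 := vecMul_map_aeval h2 s
        rw [vecMul_vecMul, ← hmul, hEss0] at h3
        have h4 : v ᵥ* ι Es = v := by
          have := congrArg (fun N => v ᵥ* ι N) hsum
          simp only [hι, Matrix.map_add _ (map_add (algebraMap ℝ ℂ)), vecMul_add,
            Matrix.map_one _ (map_zero (algebraMap ℝ ℂ)) (map_one _), vecMul_one] at this
          rwa [h0, zero_add] at this
        have h5 : ι 0 = 0 := Matrix.map_zero _ (map_zero _)
        rw [h4, h5, vecMul_zero] at h3
        exact hs z ((smul_eq_zero.1 h3.symm).resolve_right hv)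
      · have h3 : (z + 1) • (v ᵥ* ι Eu) = 0 := by rw [add_smul, h1, one_smul, neg_add_cancel]
        have h4 := (smul_eq_zero.1 h3).resolve_right h0
        rw [eq_neg_of_add_eq_zero_left h4]
        simp
    have hd : ∀ t > 0, HasDerivAt (fun t => Es *ᵥ x t)
        ((A * Es - Eu) *ᵥ (Es *ᵥ x t) + 0) t := fun t ht => by
      refine (hasDerivAt_mulVec Es (hx t ht)).congr_deriv ?_
      rw [add_zero, mulVec_mulVec, mulVec_mulVec, Matrix.sub_mul, Matrix.mul_assoc, hEss, hEus,
        sub_zero, hEsA]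
    have h1 := tendsto_mulVec_zero C (hH.tendsto_zero hd tendsto_const_nhds)
    refine h1.congr fun t => ?_
    have e : C - C * (Eu * R) * T = C * Es := by
      rw [Matrix.mul_assoc C, hEuT, eq_sub_of_add_eq' hsum, Matrix.mul_sub, Matrix.mul_one]
    rw [e, mulVec_mulVec]

end StableModes

/-! ### Solvability for arbitrary admissible agents -/

section Solvability

variable {M p : ℕ}

/-- The agents with state spaces replaced by quotients, in which the states are `T i *ᵥ x i`. -/
abbrev MAS.reduce (S : MAS M p) {k : Fin (M + 1) → ℕ}
    (T : ∀ i, Matrix (Fin (k i)) (Fin (S.n i)) ℝ) (A' : ∀ i, Matrix (Fin (k i)) (Fin (k i)) ℝ)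
    (C' : ∀ i, Matrix (Fin p) (Fin (k i)) ℝ) : MAS M p where
  n := k
  m := S.m
  A := A'
  B := fun i => T i * S.B i
  C := C'

/-- Design data of the reduced agents give a regulating observer for the original agents: the
protocol estimates the state of the pair in the coordinates of the design. -/
def reducedObserver {S : MAS M p} {β : ℝ} {k : Fin (M + 1) → ℕ}
    {T : ∀ i, Matrix (Fin (k i)) (Fin (S.n i)) ℝ} {A' : ∀ i, Matrix (Fin (k i)) (Fin (k i)) ℝ}
    {C' : ∀ i, Matrix (Fin p) (Fin (k i)) ℝ} (hA : ∀ i, T i * S.A i = A' i * T i)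
    {f : Fin M} (hC : C' f.succ * T f.succ = S.C f.succ)
    (h₀ : ∀ x : ℝ → Fin (S.n 0) → ℝ, (∀ t > 0, HasDerivAt x (S.A 0 *ᵥ x t) t) →
      Tendsto (fun t => (S.C 0 - C' 0 * T 0) *ᵥ x t) atTop (𝓝 0))
    (D : Design (S.reduce T A' C') f) {L : Matrix (Fin (k f.succ) ⊕ Fin D.k) (Fin p) ℝ}
    (hL : ∀ l, β ≤ l → IsHurwitz (D.Abar - l • (L * D.Cbar))) :
    RegulatingObserver S β f (D.Abar + D.Bbar * D.F) L D.F D.Cbar where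
  N := D.Abar
  Φ₁ := D.T₁ * T f.succ
  Φ₀ := D.T₀ * T 0
  k := k f.succ
  E₁ := T f.succ
  E₀ := D.dev * D.T₀ * T 0
  As := A' f.succ + T f.succ * S.B f.succ * D.K
  Cs := C' f.succ
  Ac_eq := by
    have h : D.T₁ * (T f.succ * S.B f.succ) = D.Bbar := D.T₁_mul_B
    rw [Matrix.mul_assoc D.T₁, h]
  N_mul_Φ₁ := by
    rw [← Matrix.mul_assoc, D.Abar_mul_T₁, Matrix.mul_assoc, ← hA, ← Matrix.mul_assoc]
  N_mul_Φ₀ := by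
    rw [← Matrix.mul_assoc, D.Abar_mul_T₀, Matrix.mul_assoc, ← hA, ← Matrix.mul_assoc]
  H_mul_Φ₁ := by
    rw [← Matrix.mul_assoc, D.Cbar_mul_T₁, hC]
  H_mul_Φ₀ := by
    have h : D.Cbar * (D.T₀ * T 0) + S.C 0 = S.C 0 - C' 0 * T 0 := by
      rw [← Matrix.mul_assoc, D.Cbar_mul_T₀, Matrix.neg_mul]
      abel
    rwa [h]
  isHurwitz_observer := hL
  As_mul_E₁ := by
    have h : D.F * D.T₁ = D.K := D.F_mul_T₁
    rw [Matrix.add_mul, Matrix.mul_add, hA, ← h]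
    simp only [Matrix.mul_assoc]
  As_mul_E₀ := by
    have h : (A' f.succ + T f.succ * S.B f.succ * D.K) * D.dev =
      D.dev * D.Abar + T f.succ * S.B f.succ * D.F := D.closedLoop_mul_dev
    have h' : D.Abar * D.T₀ = D.T₀ * A' 0 := D.Abar_mul_T₀
    rw [Matrix.mul_assoc D.dev, ← Matrix.mul_assoc, h, Matrix.add_mul, Matrix.mul_assoc D.dev,
      ← Matrix.mul_assoc D.Abar, h', Matrix.mul_assoc D.T₀, ← hA]
    simp only [Matrix.mul_assoc]
    exact add_comm _ _
  Cs_mul_E₁ := hC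
  Cs_mul_E₀ := by
    have h1 : C' f.succ * D.dev = D.Cbar := D.C_mul_dev
    have h : C' f.succ * (D.dev * D.T₀ * T 0) + S.C 0 = S.C 0 - C' 0 * T 0 := by
      rw [← Matrix.mul_assoc, ← Matrix.mul_assoc, h1, D.Cbar_mul_T₀, Matrix.neg_mul]
      abel
    rwa [h]
  isHurwitz_As := D.hurwitz

/-- The reduced agents: the root without its stable modes, the other agents without their
unobservable modes. -/
theorem MAS.exists_reduction (S : MAS M p) (i : Fin (M + 1)) :
    ∃ (k : ℕ) (T : Matrix (Fin k) (Fin (S.n i)) ℝ) (A' : Matrix (Fin k) (Fin k) ℝ)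
      (C' : Matrix (Fin p) (Fin k) ℝ), T * S.A i = A' * T ∧
      (i ≠ 0 → (∃ R : Matrix (Fin (S.n i)) (Fin k) ℝ, T * R = 1) ∧ C' * T = S.C i ∧
        Observable A' C') ∧
      (i = 0 → (∀ z ∈ eigenvalues A', z ∈ eigenvalues (S.A i) ∧ 0 ≤ z.re) ∧
        ∀ x : ℝ → Fin (S.n i) → ℝ, (∀ t > 0, HasDerivAt x (S.A i *ᵥ x t) t) →
          Tendsto (fun t => (S.C i - C' * T) *ᵥ x t) atTop (𝓝 0)) := by
  by_cases hi : i = 0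
  · obtain ⟨k, T, A', C', hA, h1, h2⟩ := exists_antistable_quotient (S.A i) (S.C i)
    exact ⟨k, T, A', C', hA, fun h => absurd hi h, fun _ => ⟨h1, h2⟩⟩
  · obtain ⟨k, T, R, A', C', hTR, hA, hC, hobs⟩ := exists_observable_quotient (S.A i) (S.C i)
    exact ⟨k, T, A', C', hA, fun _ => ⟨⟨R, hTR⟩, hC, hobs⟩, fun h => absurd h hi⟩

/-- The protocol is an output regulator for the reduced agents with a Riccati gain in the observer.
The unstable modes of the root are no invariant zeros, so that design data exist. -/
theorem MAS.Admissible.exists_protocol_solves {S : MAS M p} (hS : S.Admissible) {β : ℝ}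
    (hβ : 0 < β) : ∃ P : Protocol S, P.Solves β := by
  choose k T A' C' hA hne hz using S.exists_reduction
  obtain ⟨hroot, h₀⟩ := hz 0 rfl
  have hD : ∀ f : Fin M, Nonempty (Design (S.reduce T A' C') f) := fun f => by
    obtain ⟨⟨R, hTR⟩, hC, hobs⟩ := hne f.succ (Fin.succ_ne_zero f)
    refine nonempty_design _ f hobs ((hS.stabilizable f.succ).quotient hTR (hA f.succ))
      fun z hz => ?_
    obtain ⟨h1, h2⟩ := hroot z hz
    exact ((hS.rightInvertible f.succ).hasFullRowRankAt (hS.zeros f.succ z h1 h2)).quotient hTR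
      (hA f.succ) hC
  have hQ : ∀ f : Fin M, ∃ Q : Matrix (Fin (k f.succ) ⊕ Fin (hD f).some.k)
      (Fin (k f.succ) ⊕ Fin (hD f).some.k) ℝ,
      ∀ l, β ≤ l → IsHurwitz ((hD f).some.Abar -
        l • (Q * (hD f).some.Cbarᵀ * (hD f).some.Cbar)) := fun f => by
    obtain ⟨Q, hQ, hric⟩ :=
      exists_riccati hβ (exists_isHurwitz_add_mul (hD f).some.observable_bar)
    exact ⟨Q, fun l hl => isHurwitz_sub_of_riccati' hQ (fun x => by simp [hric]) hl⟩
  choose Q hQ using hQ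
  set D : ∀ f, Design (S.reduce T A' C') f := fun f => (hD f).some with hDdef
  let P : Protocol S :=
    { σ := fun f => Fin (k f.succ) ⊕ Fin (D f).k
      Ac := fun f => (D f).Abar + (D f).Bbar * (D f).F
      Bc := fun f => Q f * (D f).Cbarᵀ
      Ec := fun f => -(Q f * (D f).Cbarᵀ)
      Cc := fun f => (D f).F
      Dc := fun _ => 0
      H := fun f => (D f).Cbar }
  let _ : ∀ f, DecidableEq (P.σ f) := fun f =>
    inferInstanceAs (DecidableEq (Fin (k f.succ) ⊕ Fin (D f).k))
  exact ⟨P, solves_of_regulatingObserver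
    (fun f => reducedObserver hA (hne f.succ (Fin.succ_ne_zero f)).2.1 h₀ (D f) (hQ f))
    (fun _ => rfl) fun _ => rfl⟩

end Solvability

end DelayedSync

end

theorem mainTheorem3 {M p : ℕ} (S : DelayedSync.MAS M p) (hS : S.Admissible)
    (β : ℝ) (hβ : 0 < β) :
    -- the problem is solvable for the class of graphs
    (∃ P : DelayedSync.Protocol S, P.Solves β) ∧
    -- the observer and output-regulation protocol solves it, for all small `ε`
    (∀ l : ℕ, (∀ f : Fin M, S.n f.succ + S.n 0 ≤ l) →
      ∀ K : Matrix (Fin p) (Fin l × Fin p) ℝ,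
        (∀ ε : ℝ, 0 < ε → ∃! Q : Matrix (Fin l × Fin p) (Fin l × Fin p) ℝ,
          Q.PosDef ∧ DelayedSync.IsRiccati β K ε Q) ∧
        (∀ D : ∀ f : Fin M, DelayedSync.Design S f,
          ∃ ε₀ : ℝ, 0 < ε₀ ∧ ∀ ε : ℝ, 0 < ε → ε ≤ ε₀ →
            ∀ Q : Matrix (Fin l × Fin p) (Fin l × Fin p) ℝ,
              Q.PosDef → DelayedSync.IsRiccati β K ε Q →
                (DelayedSync.regulationProtocol l D ε Q).Solves β)) ∧
    -- the design data of that protocol exist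
    ((∀ f : Fin M, DelayedSync.Observable (S.A f.succ) (S.C f.succ)) →
      (∀ f : Fin M, ∀ z ∈ DelayedSync.eigenvalues (S.A 0),
        ¬ DelayedSync.IsInvariantZero (S.A f.succ) (S.B f.succ) (S.C f.succ) z) →
      ∀ f : Fin M, Nonempty (DelayedSync.Design S f)) := by
  exact ⟨hS.exists_protocol_solves hβ, fun l hl K =>
    ⟨fun ε _ => DelayedSync.existsUnique_isRiccati hβ K ε,
      fun D => DelayedSync.exists_regulationProtocol_solves hβ hl K D⟩,
    fun hobs hz f => DelayedSync.nonempty_design S f (hobs f) (hS.stabilizable f.succ)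
      fun z hzA => (hS.rightInvertible f.succ).hasFullRowRankAt (hz f z hzA)⟩
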